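/- Let $d\ge 4$ and let $Q$ be a positive definite quadratic form on $\mathbb{R}^d$ with real coefficients. For $\operatorname{Re} s>d/2$ let \[ Z_Q(s)=\sum_{n\in\mathbb{Z}^d\setminus\{0\}}\frac{1}{Q(n)^s} \] be the Epstein zeta function of $Q$; it has a (unique) meromorphic continuation to $\mathbb{C}$, holomorphic on $\mathbb{C}\setminus\{d/2\}$, which is again denoted by $Z_Q$. Then for every $s\in\mathbb{C}$ with $d/2-1<\operatorname{Re} s<d/2$, the function $x\mapsto Q(x)^{-s}$ is integrable on every Euclidean ball $\{x\in\mathbb{R}^d:\|x\|_2\le N\}$, and the limit \[ \widehat\sigma(s)=\lim_{N\to\infty}\left[\sum_{n\in\mathbb{Z}^d,\ 0<\|n\|_2\le N}\frac{1}{Q(n)^s}-\int_{\|x\|_2\le N}\frac{1}{Q(x)^s}\,\mathrm{d}x\right], \] over real $N\to\infty$, exists and satisfies $\widehat\sigma(s)=Z_Q(s)$. -/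

import Mathlib

open Filter Topology MeasureTheory

noncomputable section

namespace EpsteinWigner

/-- The integer vector `n ∈ ℤ^d`, viewed as a point of Euclidean space `ℝ^d`. -/
def latticePoint {d : ℕ} (n : Fin d → ℤ) : EuclideanSpace ℝ (Fin d) :=
  WithLp.toLp 2 fun i => (n i : ℝ)

theorem finite_latticePoint_norm_le (d : ℕ) (N : ℝ) :
    {n : Fin d → ℤ | 0 < ‖latticePoint n‖ ∧ ‖latticePoint n‖ ≤ N}.Finite := by
  refine (Set.finite_Icc (fun _ : Fin d => -⌈N⌉) (fun _ => ⌈N⌉)).subset ?_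
  rintro n ⟨-, hn⟩
  have h : ∀ i, |((n i : ℤ) : ℝ)| ≤ N := fun i => by
    have := (PiLp.norm_apply_le (latticePoint n) i).trans hn
    simpa [latticePoint, Real.norm_eq_abs] using this
  constructor
  · intro i
    have h1 := (abs_le.1 (h i)).1
    have h2 := Int.le_ceil N
    have h3 : -((⌈N⌉ : ℤ) : ℝ) ≤ ((n i : ℤ) : ℝ) := by linarith
    exact_mod_cast h3
  · intro i
    have h3 : ((n i : ℤ) : ℝ) ≤ ((⌈N⌉ : ℤ) : ℝ) := ((abs_le.1 (h i)).2).trans (Int.le_ceil N)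
    exact_mod_cast h3

/-- The finite set of `n ∈ ℤ^d` with `0 < ‖n‖₂ ≤ N`. -/
def latticeBall (d : ℕ) (N : ℝ) : Finset (Fin d → ℤ) :=
  (finite_latticePoint_norm_le d N).toFinset

/-- The truncated lattice sum `∑_{0 < ‖n‖₂ ≤ N} 1 / Q(n)^s`. -/
def alphaHat {d : ℕ} (Q : QuadraticForm ℝ (EuclideanSpace ℝ (Fin d))) (N : ℝ) (s : ℂ) : ℂ :=
  ∑ n ∈ latticeBall d N, 1 / (Q (latticePoint n) : ℂ) ^ s

/-- The truncated integral `∫_{‖x‖₂ ≤ N} 1 / Q(x)^s dx`. -/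
def betaHat {d : ℕ} (Q : QuadraticForm ℝ (EuclideanSpace ℝ (Fin d))) (N : ℝ) (s : ℂ) : ℂ :=
  ∫ x in Metric.closedBall (0 : EuclideanSpace ℝ (Fin d)) N, 1 / (Q x : ℂ) ^ s

/-- `Z` is the analytic continuation of the Epstein zeta function `∑_{n ≠ 0} 1 / Q(n)^s`
(given by this absolutely convergent series for `Re s > d / 2`): it is meromorphic on `ℂ`, and
holomorphic away from `s = d / 2`. -/
structure IsEpsteinContinuation {d : ℕ} (Q : QuadraticForm ℝ (EuclideanSpace ℝ (Fin d)))
    (Z : ℂ → ℂ) : Prop where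
  differentiableOn : DifferentiableOn ℂ Z {(d : ℂ) / 2}ᶜ
  meromorphicAt : MeromorphicAt Z ((d : ℂ) / 2)
  hasSum : ∀ s : ℂ, (d : ℝ) / 2 < s.re →
    HasSum (fun n : {n : Fin d → ℤ // n ≠ 0} => 1 / (Q (latticePoint n.1) : ℂ) ^ s) (Z s)

end EpsteinWigner

end

noncomputable section
namespace EpsteinWigner
open Real FourierTransform

/-! Write `θ(u) = ∑ exp(-u Q(n))` over `ℤ^d`, `G(u) = ∫ exp(-u Q)`, and `D_N(u)` for the lattice sum
minus the integral of `exp(-u Q)` over the Euclidean ball of radius `N`. For `0 < Re s < d/2`,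
`Γ(s)` times the truncated difference is the Mellin transform of `D_N - 1`, while `Γ(s) Z_Q(s)` is
the Mellin transform of `θ - G - 1`: crossing the pole `d/2` amounts to subtracting `G`. The error
is thus governed by `D_N - (θ - G)`, and the analytic heart is the bound `N^(d-2+3η) (1 + u
N²)^(-J)` for it (`exists_abs_discrepancy_sub_theta_le`). Its Mellin integral at `σ = Re s` is
`O(N^(d-2+3η-2σ))`, which tends to zero exactly because `σ > d/2 - 1` leaves room for a small `η`.

For `u N²` larger than a small power of `N`, the bound follows from Gaussian tails. For smaller `u
N²`, `θ - G` is bounded and `D_N` is estimated by the circle method (`exists_abs_discrepancy_le`).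
Although `Q` is real, the cutoff involves the Euclidean norm, and `‖n‖²` is an integer. The sharp
cutoff may therefore be replaced on lattice points by a continuous function of `‖n‖²` with
integrable Fourier transform, at the cost, in the integral, of a shell of volume `O(N^(d-2))`.
Fourier inversion turns the difference into an integral over `w` of a kernel times (theta series
minus Gaussian integral), with quadratic form `A - 2πiw` for a real diagonal `A` of size about
`R⁻²`, where `R` is the integer part of `N`.

On the major arc `|w| ≤ 1/(2R)` Poisson summation makes theta series and Gaussian integral nearly
equal (`mul_norm_theta_sub_le`). On the minor arcs Weyl differencing and Poisson summation bound the
square of the theta series by the `d`-th power of a theta series of a unimodular plane lattice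
(`enorm_tsum_gauss_sq_le`). A Dirichlet approximation `a/q` to `2w` supplies a short primitive
vector of that lattice, of squared length `D`, and for `d ≥ 4` the result is `R^(d-2)/D`.
Integrating over `w` and summing over `q` and `a` loses only `R^(2η)` (`exists_lintegral_minor_le`).
-/

/-! ### Gaussian sums over `ℤ^d`. -/

theorem ennreal_tsum_pi_prod {ι : Type*} (g : ι → ENNReal) (d : ℕ) :
    ∑' n : Fin d → ι, ∏ i, g (n i) = (∑' j, g j) ^ d := by
  induction d with
  | zero => simp
  | succ d ih =>
    rw [← (Fin.consEquiv fun _ => ι).tsum_eq, pow_succ', ← ih]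
    simp only [Fin.consEquiv, Equiv.coe_fn_mk, Fin.prod_univ_succ, Fin.cons_zero, Fin.cons_succ]
    rw [ENNReal.tsum_prod (f := fun a (b : Fin d → ι) => g a * ∏ i, g (b i))]
    simp_rw [ENNReal.tsum_mul_left, ENNReal.tsum_mul_right]

theorem exp_neg_sq_le (y : ℝ) : exp (-y ^ 2) ≤ exp 1 * exp (-y) := by
  rw [← exp_add]
  exact exp_le_exp.2 (by nlinarith [sq_nonneg (y - 1 / 2)])

/-- Comparison with a geometric series of ratio `exp(-√b)`; since `exp √b ≥ 1 + √b`, its sum is at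
most `1 + 1/√b`. -/
theorem ennreal_tsum_nat_exp_neg_mul_sq_le {b : ℝ} (hb : 0 < b) :
    ∑' k : ℕ, ENNReal.ofReal (exp (-b * (k : ℝ) ^ 2))
      ≤ ENNReal.ofReal (exp 1 * (1 + 1 / √b)) := by
  have hs : 0 < √b := sqrt_pos.2 hb
  have h1 : exp (-√b) < 1 := by rw [exp_lt_one_iff]; linarith
  have hle : ∀ k : ℕ, exp (-b * (k : ℝ) ^ 2) ≤ exp 1 * exp (-√b) ^ k := fun k => by
    have := exp_neg_sq_le (√b * k)
    rw [mul_pow, sq_sqrt hb.le] at this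
    rw [← exp_nat_mul]
    convert this using 2
    · ring
    · congr 1; ring
  have hg : Summable fun k : ℕ => exp 1 * exp (-√b) ^ k :=
    (summable_geometric_of_lt_one (exp_pos _).le h1).mul_left _
  calc ∑' k : ℕ, ENNReal.ofReal (exp (-b * (k : ℝ) ^ 2))
      ≤ ∑' k : ℕ, ENNReal.ofReal (exp 1 * exp (-√b) ^ k) :=
        ENNReal.tsum_le_tsum fun k => ENNReal.ofReal_le_ofReal (hle k)
    _ = ENNReal.ofReal (∑' k : ℕ, exp 1 * exp (-√b) ^ k) :=
        (ENNReal.ofReal_tsum_of_nonneg (fun _ => by positivity) hg).symm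
    _ ≤ _ := by
        apply ENNReal.ofReal_le_ofReal
        rw [tsum_mul_left, tsum_geometric_of_lt_one (exp_pos _).le h1]
        gcongr
        rw [inv_le_comm₀ (by linarith) (by positivity), exp_neg]
        have h2 := add_one_le_exp √b
        have h3 : (exp √b)⁻¹ ≤ (√b + 1)⁻¹ := by gcongr
        have h4 : (1 + 1 / √b)⁻¹ = 1 - (√b + 1)⁻¹ := by field_simp; ring
        linarith

/-- A one-dimensional Gaussian lattice sum, uniformly in the shift. -/
theorem ennreal_tsum_int_exp_neg_mul_sq_le {b : ℝ} (hb : 0 < b) (x : ℝ) :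
    ∑' j : ℤ, ENNReal.ofReal (exp (-b * ((j : ℝ) + x) ^ 2))
      ≤ ENNReal.ofReal (2 * exp 1 * (1 + 1 / √b)) := by
  -- For a shift in `[0, 1]` the terms `j ≥ 0` and `j ≤ -1` are each dominated termwise by the
  -- unshifted half-sum; a general shift reduces to its fractional part by reindexing.
  have key : ∀ y : ℝ, 0 ≤ y → y ≤ 1 → ∑' j : ℤ, ENNReal.ofReal (exp (-b * ((j : ℝ) + y) ^ 2))
      ≤ ENNReal.ofReal (2 * exp 1 * (1 + 1 / √b)) := fun y hy0 hy1 => by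
    have e := (HasSum.of_nat_of_neg_add_one
      (f := fun j : ℤ => ENNReal.ofReal (exp (-b * ((j : ℝ) + y) ^ 2)))
      ENNReal.summable.hasSum ENNReal.summable.hasSum).tsum_eq
    rw [e]
    have h := ennreal_tsum_nat_exp_neg_mul_sq_le hb
    have h1 : ∑' k : ℕ, ENNReal.ofReal (exp (-b * (((k : ℤ) : ℝ) + y) ^ 2))
        ≤ ∑' k : ℕ, ENNReal.ofReal (exp (-b * (k : ℝ) ^ 2)) :=
      ENNReal.tsum_le_tsum fun k => ENNReal.ofReal_le_ofReal <| exp_le_exp.2 <| by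
        rw [neg_mul, neg_mul, neg_le_neg_iff]
        gcongr
        push_cast
        linarith
    have h2 : ∑' k : ℕ, ENNReal.ofReal (exp (-b * (((-((k : ℤ) + 1) : ℤ) : ℝ) + y) ^ 2))
        ≤ ∑' k : ℕ, ENNReal.ofReal (exp (-b * (k : ℝ) ^ 2)) :=
      ENNReal.tsum_le_tsum fun k => ENNReal.ofReal_le_ofReal <| exp_le_exp.2 <| by
        rw [neg_mul, neg_mul, neg_le_neg_iff]
        have : (((-((k : ℤ) + 1) : ℤ) : ℝ) + y) ^ 2 = ((k : ℝ) + (1 - y)) ^ 2 := by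
          push_cast; ring
        rw [this]
        gcongr
        linarith
    refine (add_le_add (h1.trans h) (h2.trans h)).trans (le_of_eq ?_)
    rw [← ENNReal.ofReal_add (by positivity) (by positivity)]
    congr 1
    ring
  have := key (Int.fract x) (Int.fract_nonneg x) (Int.fract_lt_one x).le
  rw [← (Equiv.addRight ⌊x⌋).tsum_eq] at this
  refine le_trans (le_of_eq ?_) this
  rw [← (Equiv.addRight ⌊x⌋).tsum_eq]
  rw [← (Equiv.addRight (-⌊x⌋)).tsum_eq]
  refine tsum_congr fun j => ?_
  congr 4
  simp only [Equiv.coe_addRight, Int.cast_add, Int.cast_neg, Int.fract]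
  ring

variable {d : ℕ}

theorem latticePoint_apply (n : Fin d → ℤ) (i : Fin d) : latticePoint n i = n i := rfl

theorem norm_latticePoint_sq (n : Fin d → ℤ) : ‖latticePoint n‖ ^ 2 = ∑ i, (n i : ℝ) ^ 2 := by
  simp [EuclideanSpace.norm_sq_eq, latticePoint_apply]

theorem norm_latticePoint_sq_int (n : Fin d → ℤ) :
    ‖latticePoint n‖ ^ 2 = ((∑ i, (n i) ^ 2 : ℤ) : ℝ) := by
  rw [norm_latticePoint_sq]; push_cast; rfl

theorem latticePoint_add (m n : Fin d → ℤ) :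
    latticePoint (m + n) = latticePoint m + latticePoint n := by
  ext i; simp [latticePoint_apply]

theorem latticePoint_zero : latticePoint (0 : Fin d → ℤ) = 0 := by
  ext i; simp [latticePoint_apply]

theorem latticePoint_eq_zero {n : Fin d → ℤ} : latticePoint n = 0 ↔ n = 0 := by
  refine ⟨fun h => ?_, fun h => by rw [h, latticePoint_zero]⟩
  ext i
  have := congrArg (fun x => x i) h
  simpa [latticePoint_apply] using this

theorem one_le_norm_latticePoint_sq {n : Fin d → ℤ} (hn : n ≠ 0) :
    1 ≤ ‖latticePoint n‖ ^ 2 := by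
  have h : 0 < ‖latticePoint n‖ ^ 2 := by
    have : latticePoint n ≠ 0 := fun h => hn (latticePoint_eq_zero.1 h)
    positivity
  rw [norm_latticePoint_sq_int] at h ⊢
  exact_mod_cast h

theorem ennreal_tsum_exp_neg_norm_sq_le (d : ℕ) {b : ℝ} (hb : 0 < b) :
    ∑' n : Fin d → ℤ, ENNReal.ofReal (exp (-b * ‖latticePoint n‖ ^ 2))
      ≤ ENNReal.ofReal ((2 * exp 1 * (1 + 1 / √b)) ^ d) := by
  have : ∀ n : Fin d → ℤ, ENNReal.ofReal (exp (-b * ‖latticePoint n‖ ^ 2))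
      = ∏ i, ENNReal.ofReal (exp (-b * ((n i : ℝ) + 0) ^ 2)) := fun n => by
    rw [← ENNReal.ofReal_prod_of_nonneg fun _ _ => (exp_pos _).le, ← exp_sum,
      norm_latticePoint_sq, Finset.mul_sum]
    simp
  simp_rw [this]
  rw [ennreal_tsum_pi_prod (fun j : ℤ => ENNReal.ofReal (exp (-b * ((j : ℝ) + 0) ^ 2))),
    ENNReal.ofReal_pow (by positivity)]
  gcongr
  exact ennreal_tsum_int_exp_neg_mul_sq_le hb 0

theorem summable_of_ennreal_tsum_le {ι : Type*} {f : ι → ℝ} (hf : ∀ i, 0 ≤ f i) {C : ℝ}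
    (h : ∑' i, ENNReal.ofReal (f i) ≤ ENNReal.ofReal C) : Summable f := by
  have := ENNReal.summable_toReal (ne_top_of_le_ne_top ENNReal.ofReal_ne_top h)
  simpa [ENNReal.toReal_ofReal (hf _)] using this

theorem tsum_le_of_ennreal_tsum_le {ι : Type*} {f : ι → ℝ} (hf : ∀ i, 0 ≤ f i) {C : ℝ}
    (hC : 0 ≤ C) (h : ∑' i, ENNReal.ofReal (f i) ≤ ENNReal.ofReal C) : ∑' i, f i ≤ C := by
  rw [← ENNReal.ofReal_le_ofReal_iff hC,
    ENNReal.ofReal_tsum_of_nonneg hf (summable_of_ennreal_tsum_le hf h)]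
  exact h

theorem summable_exp_neg_norm_sq (d : ℕ) {b : ℝ} (hb : 0 < b) :
    Summable fun n : Fin d → ℤ => exp (-b * ‖latticePoint n‖ ^ 2) :=
  summable_of_ennreal_tsum_le (fun _ => (exp_pos _).le) (ennreal_tsum_exp_neg_norm_sq_le d hb)

theorem tsum_exp_neg_norm_sq_le (d : ℕ) {b : ℝ} (hb : 0 < b) :
    ∑' n : Fin d → ℤ, exp (-b * ‖latticePoint n‖ ^ 2) ≤ (2 * exp 1 * (1 + 1 / √b)) ^ d :=
  tsum_le_of_ennreal_tsum_le (fun _ => (exp_pos _).le) (by positivity)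
    (ennreal_tsum_exp_neg_norm_sq_le d hb)

/-- Gaussian tails over `{n : ‖n‖² > M}`. -/
theorem tsum_indicator_exp_neg_norm_sq_le (d : ℕ) {b : ℝ} (hb : 0 < b) (S : Set (Fin d → ℤ))
    {M : ℝ} (hS : ∀ n ∈ S, M ≤ ‖latticePoint n‖ ^ 2) :
    ∑' n : Fin d → ℤ, S.indicator (fun n => exp (-b * ‖latticePoint n‖ ^ 2)) n
      ≤ exp (-b * M / 2) * (2 * exp 1 * (1 + 1 / √(b / 2))) ^ d := by
  -- Half of the exponent yields the tail factor, the other half keeps the sum convergent.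
  have hs := (summable_exp_neg_norm_sq d (half_pos hb)).mul_left (exp (-b * M / 2))
  refine (Summable.tsum_le_tsum (fun n => ?_)
    ((summable_exp_neg_norm_sq d hb).indicator S) hs).trans ?_
  · by_cases hn : n ∈ S
    · rw [Set.indicator_of_mem hn, ← exp_add]
      refine exp_le_exp.2 ?_
      nlinarith [hS n hn]
    · rw [Set.indicator_of_notMem hn]
      positivity
  · rw [tsum_mul_left]
    gcongr
    exact tsum_exp_neg_norm_sq_le d (half_pos hb)

/-! ### Poisson summation over `ℤ^d`. -/

section Poisson

variable {d : ℕ} {f : EuclideanSpace ℝ (Fin d) → ℂ} {C c : ℝ}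

/-- From `‖n‖² ≤ 2‖x + n‖² + 2‖x‖²`: a majorant summable over `n` and locally uniform in `x`. -/
theorem gaussian_bound_shift (hc : 0 < c) (hC : 0 ≤ C) (hb : ∀ x, ‖f x‖ ≤ C * exp (-c * ‖x‖ ^ 2))
    (x : EuclideanSpace ℝ (Fin d)) (n : Fin d → ℤ) :
    ‖f (x + latticePoint n)‖
      ≤ C * exp (c * ‖x‖ ^ 2) * exp (-(c / 2) * ‖latticePoint n‖ ^ 2) := by
  refine (hb _).trans ?_
  rw [mul_assoc, ← exp_add]
  gcongr
  have h1 : ‖latticePoint n‖ ≤ ‖x + latticePoint n‖ + ‖x‖ := by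
    have := norm_sub_le (x + latticePoint n) x
    simpa using this
  have h2 : ‖latticePoint n‖ ^ 2 ≤ 2 * ‖x + latticePoint n‖ ^ 2 + 2 * ‖x‖ ^ 2 := by
    have := pow_le_pow_left₀ (norm_nonneg _) h1 2
    nlinarith [sq_nonneg (‖x + latticePoint n‖ - ‖x‖)]
  nlinarith

theorem summable_shift_of_gaussian_bound (hc : 0 < c) (hC : 0 ≤ C)
    (hb : ∀ x, ‖f x‖ ≤ C * exp (-c * ‖x‖ ^ 2)) (x : EuclideanSpace ℝ (Fin d)) :
    Summable fun n : Fin d → ℤ => f (x + latticePoint n) :=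
  .of_norm_bounded ((summable_exp_neg_norm_sq d (half_pos hc)).mul_left _)
    (gaussian_bound_shift hc hC hb x)

theorem continuous_periodization (hf : Continuous f) (hc : 0 < c) (hC : 0 ≤ C)
    (hb : ∀ x, ‖f x‖ ≤ C * exp (-c * ‖x‖ ^ 2)) :
    Continuous fun x => ∑' n : Fin d → ℤ, f (x + latticePoint n) := by
  rw [continuous_iff_continuousAt]
  intro x₀
  have : ContinuousOn (fun x => ∑' n : Fin d → ℤ, f (x + latticePoint n))
      (Metric.ball 0 (‖x₀‖ + 1)) := by
    refine continuousOn_tsum (u := fun n => C * exp (c * (‖x₀‖ + 1) ^ 2)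
      * exp (-(c / 2) * ‖latticePoint n‖ ^ 2)) (fun n => by fun_prop)
      ((summable_exp_neg_norm_sq d (half_pos hc)).mul_left _) fun n x hx => ?_
    refine (gaussian_bound_shift hc hC hb x n).trans ?_
    have : ‖x‖ ≤ ‖x₀‖ + 1 := by simpa using (Metric.mem_ball.1 hx).le
    gcongr
  exact this.continuousAt (Metric.isOpen_ball.mem_nhds (by simp))

theorem integrable_of_gaussian_bound (hf : Continuous f) (hc : 0 < c)
    (hb : ∀ x, ‖f x‖ ≤ C * exp (-c * ‖x‖ ^ 2)) : Integrable f := by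
  have h : Integrable fun x : EuclideanSpace ℝ (Fin d) => exp (-c * ‖x‖ ^ 2) := by
    have := (GaussianFourier.integrable_cexp_neg_mul_sq_norm_add (V := EuclideanSpace ℝ (Fin d))
      (b := c) (by simpa using hc) 0 0).norm
    refine this.congr (Eventually.of_forall fun x => ?_)
    simp only [Complex.norm_exp]
    congr 1
    simp [← Complex.ofReal_pow]
  exact (h.const_mul C).mono' hf.aestronglyMeasurable (Eventually.of_forall hb)

/-- The half-open unit cube with lower corner `n`. -/
def unitCube (n : Fin d → ℤ) : Set (Fin d → ℝ) := {x | ∀ i, x i ∈ Set.Ioc (n i : ℝ) (n i + 1)}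

theorem measurableSet_unitCube (n : Fin d → ℤ) : MeasurableSet (unitCube n) :=
  MeasurableSet.univ_pi' fun _ => measurableSet_Ioc

theorem pairwise_disjoint_unitCube : Pairwise (Function.onFun Disjoint (unitCube (d := d))) := by
  intro m n hmn
  refine Set.disjoint_left.2 fun x hx hy => hmn ?_
  ext i
  have h1 := hx i
  have h2 := hy i
  have h3 : (m i : ℝ) < n i + 1 := h1.1.trans_le h2.2
  have h4 : (n i : ℝ) < m i + 1 := h2.1.trans_le h1.2
  have h3' : m i < n i + 1 := by exact_mod_cast h3
  have h4' : n i < m i + 1 := by exact_mod_cast h4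
  omega

theorem iUnion_unitCube : ⋃ n, unitCube (d := d) n = Set.univ := by
  refine Set.eq_univ_of_forall fun x => Set.mem_iUnion.2 ⟨fun i => ⌈x i⌉ - 1, fun i => ?_⟩
  have h1 := Int.ceil_lt_add_one (x i)
  have h2 := Int.le_ceil (x i)
  constructor
  · push_cast; linarith
  · push_cast; linarith

theorem hasSum_integral_unitCube {g : (Fin d → ℝ) → ℂ} (hg : Integrable g) :
    HasSum (fun n : Fin d → ℤ => ∫ x in unitCube 0, g (x + fun i => (n i : ℝ))) (∫ x, g x) := by
  have h := hasSum_integral_iUnion (f := g) (μ := volume) (s := unitCube (d := d))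
    measurableSet_unitCube pairwise_disjoint_unitCube (by simpa [iUnion_unitCube] using hg)
  rw [iUnion_unitCube, setIntegral_univ] at h
  refine h.congr_fun fun n => ?_
  have hm : MeasurePreserving (fun x : Fin d → ℝ => x + fun i => (n i : ℝ)) volume volume :=
    measurePreserving_add_right _ _
  have hp : (fun x : Fin d → ℝ => x + fun i => (n i : ℝ)) ⁻¹' unitCube n = unitCube 0 := by
    ext x
    simp only [unitCube, Set.mem_preimage, Set.mem_ofPred_eq, Set.mem_Ioc, Pi.add_apply,
      Pi.zero_apply, Int.cast_zero]
    refine forall_congr' fun i => ?_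
    constructor <;> rintro ⟨h1, h2⟩ <;> constructor <;> linarith
  rw [← hm.setIntegral_preimage_emb (MeasurableEquiv.addRight _).measurableEmbedding g, hp]

/-- Poisson summation over `ℤ^d` for continuous functions with Gaussian decay. -/
theorem poisson_summation (hf : Continuous f) (hc : 0 < c) (hC : 0 ≤ C)
    (hb : ∀ x, ‖f x‖ ≤ C * exp (-c * ‖x‖ ^ 2))
    (hs : Summable fun ξ : Fin d → ℤ => 𝓕 f (latticePoint ξ)) :
    ∑' n : Fin d → ℤ, f (latticePoint n) = ∑' ξ : Fin d → ℤ, 𝓕 f (latticePoint ξ) := by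
  -- The projection to the torus is a quotient map, so the continuous periodization of `f` descends
  -- to a continuous function on the torus.
  have hp : IsOpenQuotientMap (Pi.map fun _ => ((↑) : ℝ → UnitAddCircle) :
      (Fin d → ℝ) → UnitAddTorus (Fin d)) :=
    IsOpenQuotientMap.piMap fun _ => QuotientAddGroup.isOpenQuotientMap_mk
  let p : C(Fin d → ℝ, UnitAddTorus (Fin d)) := ⟨_, hp.continuous⟩
  have hq : IsQuotientMap p := hp.isQuotientMap
  let F : C(Fin d → ℝ, ℂ) := ⟨fun x => ∑' n : Fin d → ℤ, f (WithLp.toLp 2 x + latticePoint n),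
    (continuous_periodization hf hc hC hb).comp (PiLp.continuous_toLp 2 _)⟩
  have hper : Function.FactorsThrough F p := fun x y hxy => by
    have h1 : ∀ i, ∃ k : ℤ, y i = x i + k := fun i => by
      have h2 : ((x i : ℝ) : UnitAddCircle) = (y i : ℝ) := congrFun hxy i
      have h3 : ((y i - x i : ℝ) : UnitAddCircle) = 0 := by
        rw [AddCircle.coe_sub, h2, sub_self]
      obtain ⟨k, hk⟩ := (AddCircle.coe_eq_zero_iff (1 : ℝ)).1 h3
      refine ⟨k, ?_⟩
      simp at hk
      linarith
    choose k hk using h1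
    change ∑' n : Fin d → ℤ, f (WithLp.toLp 2 x + latticePoint n)
      = ∑' n : Fin d → ℤ, f (WithLp.toLp 2 y + latticePoint n)
    rw [← (Equiv.addRight k).tsum_eq]
    refine tsum_congr fun n => ?_
    congr 1
    ext i
    simp [latticePoint_apply, hk]
    ring
  let g : C(UnitAddTorus (Fin d), ℂ) := hq.lift F hper
  have hg : ∀ x, g (p x) = F x := fun x =>
    congrArg (fun h : C(Fin d → ℝ, ℂ) => h x) (hq.lift_comp F hper)
  have hint := integrable_of_gaussian_bound hf hc hb
  -- Unfolding: the character `e` is `ℤ^d`-periodic, so the integral of the periodization over a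
  -- unit cube is the integral of `e * f` over the whole space.
  have hcoef : ∀ ξ : Fin d → ℤ, UnitAddTorus.mFourierCoeff g ξ = 𝓕 f (latticePoint ξ) := by
    intro ξ
    rw [UnitAddTorus.mFourierCoeff_eq_integral g ξ 0]
    let e : (Fin d → ℝ) → ℂ := fun x => UnitAddTorus.mFourier (-ξ) (p x)
    have he : ∀ x, e x = 𝐞 (-inner ℝ (WithLp.toLp 2 x) (latticePoint ξ)) := fun x => by
      change ∏ i, fourier ((-ξ) i) ((x i : ℝ) : UnitAddCircle) = _
      simp only [fourier_coe_apply]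
      rw [← Complex.exp_sum, Real.fourierChar_apply]
      congr 1
      simp only [PiLp.inner_apply, latticePoint_apply, RCLike.inner_apply, conj_trivial,
        Pi.neg_apply]
      push_cast
      rw [← Finset.sum_neg_distrib, Finset.mul_sum, Finset.sum_mul]
      refine Finset.sum_congr rfl fun i _ => ?_
      ring
    have hec : Continuous e := (UnitAddTorus.mFourier (-ξ)).continuous.comp hp.continuous
    have hen : ∀ x, ‖e x‖ = 1 := fun x => by rw [he]; exact Circle.norm_coe _
    have heper : ∀ x (n : Fin d → ℤ), e (x + fun i => (n i : ℝ)) = e x := fun x n => by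
      have : p (x + fun i => (n i : ℝ)) = p x := by
        funext i
        change ((x i + n i : ℝ) : UnitAddCircle) = ((x i : ℝ) : UnitAddCircle)
        rw [AddCircle.coe_add]
        have : ((n i : ℝ) : UnitAddCircle) = 0 :=
          (AddCircle.coe_eq_zero_iff (1 : ℝ)).2 ⟨n i, by simp⟩
        rw [this, add_zero]
      simp only [e, this]
    have hmp := EuclideanSpace.volume_preserving_symm_measurableEquiv_toLp (Fin d)
    have hG : Integrable fun x : Fin d → ℝ => e x * f (WithLp.toLp 2 x) := by
      have h1 : Integrable fun x : Fin d → ℝ => f (WithLp.toLp 2 x) :=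
        ((PiLp.volume_preserving_toLp (Fin d)).integrable_comp_emb
          (MeasurableEquiv.toLp 2 _).measurableEmbedding).2 hint
      exact h1.bdd_mul hec.aestronglyMeasurable (Eventually.of_forall fun x => (hen x).le)
    have h1 := hasSum_integral_unitCube hG
    have h2 : ∫ x : Fin d → ℝ, e x * f (WithLp.toLp 2 x) = 𝓕 f (latticePoint ξ) := by
      rw [Real.fourier_eq, ← (PiLp.volume_preserving_toLp (Fin d)).integral_comp
        (MeasurableEquiv.toLp 2 _).measurableEmbedding]
      refine integral_congr_ae (Eventually.of_forall fun x => ?_)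
      simp only [he]
      rfl
    rw [h2] at h1
    rw [← h1.tsum_eq]
    have hset : {x : Fin d → ℝ | ∀ i, x i ∈ Set.Ioc ((0 : Fin d → ℝ) i) ((0 : Fin d → ℝ) i + 1)}
        = unitCube 0 := by
      ext x; simp [unitCube]
    rw [hset]
    have h3 : ∀ x, (UnitAddTorus.mFourier (-ξ) fun i => ((x i : ℝ) : UnitAddCircle))
        • g (fun i => ((x i : ℝ) : UnitAddCircle)) = ∑' n : Fin d → ℤ,
          e (x + fun i => (n i : ℝ)) * f (WithLp.toLp 2 (x + fun i => (n i : ℝ))) := fun x => by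
      have : g (fun i => ((x i : ℝ) : UnitAddCircle)) = F x := hg x
      rw [this]
      simp_rw [heper]
      rw [tsum_mul_left, smul_eq_mul]
      rfl
    simp_rw [h3]
    -- The interchange of sum and integral is justified by cutting the integral of the norm into
    -- unit cubes as well.
    refine integral_tsum_of_summable_integral_norm (fun n => ?_) ?_ |>.symm
    · refine Integrable.integrableOn ?_
      exact hG.comp_add_right _
    · have h4 := (hasSum_integral_unitCube (g := fun x => ((‖e x * f (WithLp.toLp 2 x)‖ : ℝ) : ℂ))
        hG.norm.ofReal).summable
      have h5 : ∀ n : Fin d → ℤ, (∫ x in unitCube 0,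
          ((‖e (x + fun i => (n i : ℝ)) * f (WithLp.toLp 2 (x + fun i => (n i : ℝ)))‖ : ℝ) : ℂ))
          = ((∫ x in unitCube 0,
          ‖e (x + fun i => (n i : ℝ)) * f (WithLp.toLp 2 (x + fun i => (n i : ℝ)))‖ : ℝ) : ℂ) :=
        fun n => integral_ofReal
      simp_rw [h5] at h4
      exact Complex.summable_ofReal.1 h4
  -- With summable coefficients the Fourier series converges pointwise; its value at the origin is
  -- the Poisson formula.
  have hfin := UnitAddTorus.hasSum_mFourier_series_apply_of_summable (f := g)
    (by rw [show UnitAddTorus.mFourierCoeff g = _ from funext hcoef]; exact hs) (p 0)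
  have h0 : ∀ ξ : Fin d → ℤ, UnitAddTorus.mFourier ξ (p 0) = 1 := fun ξ => by
    change ∏ i, fourier (ξ i) (((0 : ℝ)) : UnitAddCircle) = _
    exact Finset.prod_eq_one fun i _ => by rw [fourier_coe_apply]; simp
  simp_rw [hcoef, h0, smul_eq_mul, mul_one] at hfin
  rw [hfin.tsum_eq, hg]
  change _ = ∑' n : Fin d → ℤ, f (WithLp.toLp 2 0 + latticePoint n)
  simp

end Poisson

/-! ### Complex Gaussians diagonal in an orthonormal basis. -/

section Gaussian

variable {d : ℕ} (b : OrthonormalBasis (Fin d) ℝ (EuclideanSpace ℝ (Fin d)))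

/-- The complex Gaussian with quadratic part `a` and linear part `c`, both diagonal in the
orthonormal basis `b`. -/
def gauss (a c : Fin d → ℂ) (x : EuclideanSpace ℝ (Fin d)) : ℂ :=
  Complex.exp (-∑ k, a k * (b.repr x k : ℂ) ^ 2 + ∑ k, c k * (b.repr x k : ℂ))

theorem sum_repr_sq (x : EuclideanSpace ℝ (Fin d)) : ∑ k, b.repr x k ^ 2 = ‖x‖ ^ 2 := by
  rw [← b.repr.norm_map x, EuclideanSpace.norm_sq_eq]
  simp

theorem continuous_gauss (a c : Fin d → ℂ) : Continuous (gauss b a c) := by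
  unfold gauss
  have h : ∀ k, Continuous fun x => (b.repr x k : ℂ) := fun k =>
    Complex.continuous_ofReal.comp
      ((EuclideanSpace.proj (𝕜 := ℝ) k).continuous.comp b.repr.continuous)
  fun_prop

theorem norm_gauss (a c : Fin d → ℂ) (x : EuclideanSpace ℝ (Fin d)) :
    ‖gauss b a c x‖
      = exp (-∑ k, (a k).re * b.repr x k ^ 2 + ∑ k, (c k).re * b.repr x k) := by
  rw [gauss, Complex.norm_exp]
  congr 1
  simp [← Complex.ofReal_pow]

theorem norm_gauss_zero_le {a : Fin d → ℂ} {α : ℝ} (ha : ∀ k, α ≤ (a k).re)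
    (x : EuclideanSpace ℝ (Fin d)) : ‖gauss b a 0 x‖ ≤ exp (-α * ‖x‖ ^ 2) := by
  rw [norm_gauss, ← sum_repr_sq b, Finset.mul_sum]
  refine exp_le_exp.2 ?_
  simp only [Pi.zero_apply, Complex.zero_re, zero_mul, Finset.sum_const_zero, add_zero,
    ← Finset.sum_neg_distrib]
  refine Finset.sum_le_sum fun k _ => ?_
  nlinarith [ha k, sq_nonneg (b.repr x k)]

/-- Completing the square: half of the quadratic decay absorbs the linear term. -/
theorem norm_gauss_le {a : Fin d → ℂ} {α : ℝ} (hα : 0 < α) (ha : ∀ k, α ≤ (a k).re)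
    (c : Fin d → ℂ) (x : EuclideanSpace ℝ (Fin d)) :
    ‖gauss b a c x‖ ≤ exp (∑ k, (c k).re ^ 2 / (2 * α)) * exp (-(α / 2) * ‖x‖ ^ 2) := by
  rw [norm_gauss, ← sum_repr_sq b, ← exp_add, Finset.mul_sum]
  refine exp_le_exp.2 ?_
  rw [← Finset.sum_neg_distrib, ← Finset.sum_add_distrib, ← Finset.sum_add_distrib]
  refine Finset.sum_le_sum fun k _ => ?_
  have h1 : (c k).re * b.repr x k ≤ (c k).re ^ 2 / (2 * α) + α / 2 * b.repr x k ^ 2 := by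
    have : (c k).re ^ 2 / (2 * α) + α / 2 * b.repr x k ^ 2 - (c k).re * b.repr x k
        = ((c k).re - α * b.repr x k) ^ 2 / (2 * α) := by field_simp; ring
    have h2 : 0 ≤ ((c k).re - α * b.repr x k) ^ 2 / (2 * α) := by positivity
    linarith
  nlinarith [mul_le_mul_of_nonneg_right (ha k) (sq_nonneg (b.repr x k))]

theorem exists_pos_le_re {a : Fin d → ℂ} (ha : ∀ k, 0 < (a k).re) :
    ∃ α : ℝ, 0 < α ∧ ∀ k, α ≤ (a k).re := by
  rcases isEmpty_or_nonempty (Fin d) with h | h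
  · exact ⟨1, one_pos, fun k => h.elim k⟩
  · obtain ⟨k₀, hk₀⟩ := Finite.exists_min fun k => (a k).re
    exact ⟨(a k₀).re, ha k₀, hk₀⟩

theorem integrable_gauss {a : Fin d → ℂ} (ha : ∀ k, 0 < (a k).re) (c : Fin d → ℂ) :
    Integrable (gauss b a c) := by
  obtain ⟨α, hα, h⟩ := exists_pos_le_re ha
  exact integrable_of_gaussian_bound (continuous_gauss b a c) (half_pos hα)
    (norm_gauss_le b hα h c)

theorem summable_gauss {a : Fin d → ℂ} (ha : ∀ k, 0 < (a k).re) (c : Fin d → ℂ) :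
    Summable fun n : Fin d → ℤ => gauss b a c (latticePoint n) := by
  obtain ⟨α, hα, h⟩ := exists_pos_le_re ha
  simpa using summable_shift_of_gaussian_bound (half_pos hα) (exp_pos _).le
    (norm_gauss_le b hα h c) 0

theorem integral_gauss {a : Fin d → ℂ} (ha : ∀ k, 0 < (a k).re) (c : Fin d → ℂ) :
    ∫ x, gauss b a c x
      = ∏ k, (π / a k) ^ (1 / 2 : ℂ) * Complex.exp (c k ^ 2 / (4 * a k)) := by
  rw [← GaussianFourier.integral_cexp_neg_sum_mul_add ha c,
    ← (EuclideanSpace.volume_preserving_symm_measurableEquiv_toLp (Fin d)).integral_comp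
      (MeasurableEquiv.toLp 2 (Fin d → ℝ)).symm.measurableEmbedding]
  exact b.measurePreserving_repr.integral_comp b.repr.toHomeomorph.measurableEmbedding (fun y =>
      Complex.exp (-∑ k, a k * (y k : ℂ) ^ 2 + ∑ k, c k * (y k : ℂ)))

/-- The Fourier character only shifts the linear coefficient by `-2πi ξ`, so the transform is
another Gaussian integral. -/
theorem fourier_gauss {a : Fin d → ℂ} (ha : ∀ k, 0 < (a k).re) (c : Fin d → ℂ)
    (ξ : EuclideanSpace ℝ (Fin d)) :
    𝓕 (gauss b a c) ξ = ∏ k, (π / a k) ^ (1 / 2 : ℂ)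
      * Complex.exp ((c k - 2 * π * Complex.I * b.repr ξ k) ^ 2 / (4 * a k)) := by
  rw [← integral_gauss b ha (fun k => c k - 2 * π * Complex.I * b.repr ξ k), Real.fourier_eq']
  refine integral_congr_ae (Eventually.of_forall fun x => ?_)
  simp only [gauss, smul_eq_mul, ← Complex.exp_add]
  congr 1
  have : inner ℝ x ξ = ∑ k, b.repr x k * b.repr ξ k := by
    rw [← b.repr.inner_map_map, PiLp.inner_apply]
    simp [mul_comm]
  rw [this]
  push_cast
  simp only [sub_mul, Finset.sum_sub_distrib, Finset.mul_sum, Finset.sum_mul]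
  have h : ∀ k, 2 * (π : ℂ) * Complex.I * b.repr ξ k * b.repr x k
    = 2 * π * (b.repr x k * b.repr ξ k) * Complex.I := fun k => by ring
  simp only [h, neg_mul, Finset.sum_neg_distrib]
  ring

theorem norm_cpow_half (z : ℂ) : ‖z ^ (1 / 2 : ℂ)‖ = √‖z‖ := by
  have := Complex.norm_cpow_real z (1 / 2)
  rw [sqrt_eq_rpow, ← this]
  norm_num

theorem norm_pi_div_cpow_half (z : ℂ) : ‖((π : ℂ) / z) ^ (1 / 2 : ℂ)‖ = √(π / ‖z‖) := by
  rw [norm_cpow_half, norm_div, Complex.norm_real, norm_of_nonneg pi_pos.le]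

theorem norm_integral_gauss_zero {a : Fin d → ℂ} (ha : ∀ k, 0 < (a k).re) :
    ‖∫ x, gauss b a 0 x‖ = ∏ k, √(π / ‖a k‖) := by
  rw [integral_gauss b ha, norm_prod]
  simp [norm_pi_div_cpow_half, -one_div]

/-- The exponent of the transform is `-π² ξ²/a` in each coordinate, so decay is controlled by the
real part of `1/a`, not of `a`. -/
theorem norm_fourier_gauss_zero_le {a : Fin d → ℂ} (ha : ∀ k, 0 < (a k).re) {ρ : ℝ}
    (hρ : ∀ k, ρ ≤ ((a k)⁻¹).re) (ξ : EuclideanSpace ℝ (Fin d)) :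
    ‖𝓕 (gauss b a 0) ξ‖ ≤ (∏ k, √(π / ‖a k‖)) * exp (-(π ^ 2 * ρ) * ‖ξ‖ ^ 2) := by
  rw [fourier_gauss b ha, norm_prod, ← sum_repr_sq b, Finset.mul_sum, exp_sum,
    ← Finset.prod_mul_distrib]
  refine Finset.prod_le_prod (fun _ _ => norm_nonneg _) fun k _ => ?_
  rw [norm_mul, norm_pi_div_cpow_half]
  gcongr
  rw [Complex.norm_exp]
  refine exp_le_exp.2 ?_
  have h : ((0 : Fin d → ℂ) k - 2 * π * Complex.I * b.repr ξ k) ^ 2 / (4 * a k)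
      = ((-(π ^ 2) * b.repr ξ k ^ 2 : ℝ) : ℂ) * (a k)⁻¹ := by
    have := Complex.I_sq
    have h0 : a k ≠ 0 := fun h => by have := ha k; simp [h] at this
    push_cast
    field_simp
    simp only [Pi.zero_apply, zero_sub]
    linear_combination (4 * (π : ℂ) ^ 2 * (b.repr ξ k : ℂ) ^ 2) * this
  rw [h, Complex.re_ofReal_mul]
  nlinarith [mul_le_mul_of_nonneg_left (hρ k) (by positivity : 0 ≤ π ^ 2 * b.repr ξ k ^ 2)]

theorem poisson_gauss {a : Fin d → ℂ} (ha : ∀ k, 0 < (a k).re) (c : Fin d → ℂ)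
    (hs : Summable fun ξ : Fin d → ℤ => 𝓕 (gauss b a c) (latticePoint ξ)) :
    ∑' n : Fin d → ℤ, gauss b a c (latticePoint n)
      = ∑' ξ : Fin d → ℤ, 𝓕 (gauss b a c) (latticePoint ξ) := by
  obtain ⟨α, hα, h⟩ := exists_pos_le_re ha
  exact poisson_summation (continuous_gauss b a c) (half_pos hα) (exp_pos _).le
    (norm_gauss_le b hα h c) hs

/-- A Gaussian lattice sum differs little from the corresponding integral. -/
theorem norm_tsum_gauss_sub_integral_le {a : Fin d → ℂ} (ha : ∀ k, 0 < (a k).re) {ρ : ℝ}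
    (hρ0 : 0 < ρ) (hρ : ∀ k, ρ ≤ ((a k)⁻¹).re) :
    ‖∑' n : Fin d → ℤ, gauss b a 0 (latticePoint n) - ∫ x, gauss b a 0 x‖
      ≤ (∏ k, √(π / ‖a k‖)) * (exp (-(π ^ 2 * ρ) / 2)
        * (2 * exp 1 * (1 + 1 / √(π ^ 2 * ρ / 2))) ^ d) := by
  have hb : 0 < π ^ 2 * ρ := by positivity
  have hF := norm_fourier_gauss_zero_le b ha hρ
  have hsn : Summable fun ξ : Fin d → ℤ => ‖𝓕 (gauss b a 0) (latticePoint ξ)‖ :=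
    .of_nonneg_of_le (fun _ => norm_nonneg _) (fun ξ => hF (latticePoint ξ))
      ((summable_exp_neg_norm_sq d hb).mul_left _)
  rw [poisson_gauss b ha 0 hsn.of_norm]
  have h0 : 𝓕 (gauss b a 0) (latticePoint 0) = ∫ x, gauss b a 0 x := by
    rw [latticePoint_zero, fourier_gauss b ha, integral_gauss b ha]
    simp
  classical
  -- The frequency `ξ = 0` contributes exactly the integral; every other frequency has norm at least
  -- one and falls under the tail estimate with `M = 1`.
  rw [hsn.of_norm.tsum_eq_add_tsum_ite 0, h0, add_sub_cancel_left]
  have h1 : ∀ ξ : Fin d → ℤ, ‖if ξ = 0 then 0 else 𝓕 (gauss b a 0) (latticePoint ξ)‖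
      ≤ (∏ k, √(π / ‖a k‖)) * ({0}ᶜ : Set (Fin d → ℤ)).indicator
        (fun n => exp (-(π ^ 2 * ρ) * ‖latticePoint n‖ ^ 2)) ξ := fun ξ => by
    by_cases h : ξ = 0
    · simp [h]
    · rw [if_neg h, Set.indicator_of_mem (by simpa using h)]
      exact hF _
  have h2 := ((summable_exp_neg_norm_sq d hb).indicator ({0}ᶜ : Set (Fin d → ℤ))).mul_left
    (∏ k, √(π / ‖a k‖))
  refine (tsum_of_norm_bounded h2.hasSum h1).trans ?_
  rw [tsum_mul_left]
  gcongr
  simpa using tsum_indicator_exp_neg_norm_sq_le d hb ({0}ᶜ : Set (Fin d → ℤ)) (M := 1)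
    fun n hn => one_le_norm_latticePoint_sq (by simpa using hn)

end Gaussian

/-! ### Weyl differencing of the theta series. -/

section Weyl

variable {d : ℕ} (b : OrthonormalBasis (Fin d) ℝ (EuclideanSpace ℝ (Fin d)))

/-- The Weyl difference: the quadratic phases in `x` cancel, leaving a real quadratic part `2A` and
a complex linear term proportional to the shift `t`. -/
theorem gauss_add_mul_conj (A : Fin d → ℝ) (w : ℝ) (x t : EuclideanSpace ℝ (Fin d)) :
    gauss b (fun k => A k - 2 * π * w * Complex.I) 0 (x + t)
        * (starRingEnd ℂ) (gauss b (fun k => A k - 2 * π * w * Complex.I) 0 x)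
      = gauss b (fun k => A k - 2 * π * w * Complex.I) 0 t
        * gauss b (fun k => ((2 * A k : ℝ) : ℂ))
          (fun k => -2 * (A k - 2 * π * w * Complex.I) * b.repr t k) x := by
  simp only [gauss, ← Complex.exp_conj, ← Complex.exp_add, map_add, map_neg, map_sum, map_mul,
    map_pow, map_sub, Complex.conj_ofReal, Complex.conj_I, map_ofNat, Pi.zero_apply, map_zero]
  congr 1
  simp only [zero_mul, Finset.sum_const_zero, add_zero, PiLp.add_apply,
    ← Finset.sum_neg_distrib, ← Finset.sum_add_distrib]
  refine Finset.sum_congr rfl fun k _ => ?_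
  push_cast
  ring

/-- In each coordinate the transform contributes `+A t²/2 - π²(ξ - 2wt)²/(2A)` to the exponent; half
of the decay `-A t²` survives. Bounding `A` by `α` and `Λ` leaves only Euclidean norms, so the bound
no longer depends on the basis `b`. -/
theorem norm_gauss_mul_norm_fourier_le {A : Fin d → ℝ} {α Λ : ℝ} (hα : 0 < α)
    (hA : ∀ k, α ≤ A k) (hΛ : ∀ k, A k ≤ Λ) (w : ℝ) (t ξ : EuclideanSpace ℝ (Fin d)) :
    ‖gauss b (fun k => A k - 2 * π * w * Complex.I) 0 t‖
        * ‖𝓕 (gauss b (fun k => ((2 * A k : ℝ) : ℂ))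
          (fun k => -2 * (A k - 2 * π * w * Complex.I) * b.repr t k)) ξ‖
      ≤ √(π / (2 * α)) ^ d
        * (exp (-(α / 2) * ‖t‖ ^ 2) * exp (-(π ^ 2 / (2 * Λ)) * ‖ξ - (2 * w) • t‖ ^ 2)) := by
  have hA0 : ∀ k, 0 < A k := fun k => hα.trans_le (hA k)
  rw [norm_gauss, fourier_gauss b (fun k => by simpa using hA0 k), norm_prod]
  have h1 : exp (-∑ k, ((A k : ℂ) - 2 * π * w * Complex.I).re * b.repr t k ^ 2
      + ∑ k, ((0 : Fin d → ℂ) k).re * b.repr t k) = ∏ k, exp (-A k * b.repr t k ^ 2) := by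
    rw [← exp_sum]
    congr 1
    simp
  have h2 : √(π / (2 * α)) ^ d = ∏ _k : Fin d, √(π / (2 * α)) := by simp
  rw [h1, h2, ← sum_repr_sq b t, ← sum_repr_sq b (ξ - _), Finset.mul_sum, Finset.mul_sum,
    exp_sum, exp_sum, ← Finset.prod_mul_distrib, ← Finset.prod_mul_distrib,
    ← Finset.prod_mul_distrib]
  refine Finset.prod_le_prod (fun _ _ => by positivity) fun k _ => ?_
  rw [norm_mul, norm_pi_div_cpow_half, Complex.norm_exp, mul_left_comm, ← exp_add, ← exp_add,
    Complex.norm_real, norm_of_nonneg (by have := hA0 k; positivity)]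
  have h3 : ((-2 * ((A k : ℂ) - 2 * π * w * Complex.I) * b.repr t k
      - 2 * π * Complex.I * b.repr ξ k) ^ 2 / (4 * ((2 * A k : ℝ) : ℂ)))
      = ((A k * b.repr t k ^ 2 / 2 - π ^ 2 / (2 * A k) * (b.repr ξ k - 2 * w * b.repr t k) ^ 2
        : ℝ) : ℂ) + ((π * b.repr t k * (b.repr ξ k - 2 * w * b.repr t k) : ℝ) : ℂ)
        * Complex.I := by
    have hne : (A k : ℂ) ≠ 0 := by exact_mod_cast (hA0 k).ne'
    push_cast
    field_simp
    ring_nf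
    simp only [Complex.I_sq]
    ring
  rw [h3, Complex.add_re, Complex.re_ofReal_mul, Complex.ofReal_re, Complex.I_re]
  have h4 : b.repr (ξ - (2 * w) • t) k = b.repr ξ k - 2 * w * b.repr t k := by simp
  rw [h4]
  have h5 : π ^ 2 / (2 * Λ) ≤ π ^ 2 / (2 * A k) := by
    have := hA0 k
    have := hΛ k
    gcongr
  have h6 : √(π / (2 * A k)) ≤ √(π / (2 * α)) := by
    have := hA k
    gcongr
  refine mul_le_mul h6 (exp_le_exp.2 ?_) (exp_pos _).le (sqrt_nonneg _)
  nlinarith [mul_le_mul_of_nonneg_right h5 (sq_nonneg (b.repr ξ k - 2 * w * b.repr t k)),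
    mul_le_mul_of_nonneg_right (hA k) (sq_nonneg (b.repr t k))]

theorem summable_exp_neg_norm_sub_sq {c : ℝ} (hc : 0 < c) (x : EuclideanSpace ℝ (Fin d)) :
    Summable fun ξ : Fin d → ℤ => exp (-c * ‖latticePoint ξ - x‖ ^ 2) := by
  have := summable_shift_of_gaussian_bound (f := fun y => ((exp (-c * ‖y‖ ^ 2) : ℝ) : ℂ)) hc
    zero_le_one (fun y => by
      rw [Complex.norm_real, norm_of_nonneg (exp_pos _).le, one_mul]) (-x)
  have h := Complex.summable_ofReal.1 this
  refine h.congr fun ξ => ?_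
  rw [neg_add_eq_sub]

/-- Weyl differencing followed by Poisson summation bounds a quadratic exponential sum by a power
of a positive theta series over `ℤ × ℤ`. -/
theorem enorm_tsum_gauss_sq_le {A : Fin d → ℝ} {α Λ : ℝ} (hα : 0 < α)
    (hA : ∀ k, α ≤ A k) (hΛ : ∀ k, A k ≤ Λ) (hΛ0 : 0 < Λ) (w : ℝ) :
    ‖∑' n : Fin d → ℤ, gauss b (fun k => A k - 2 * π * w * Complex.I) 0 (latticePoint n)‖ₑ ^ 2
      ≤ ENNReal.ofReal (√(π / (2 * α)) ^ d) * (∑' z : ℤ × ℤ, ENNReal.ofReal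
        (exp (-(α / 2) * (z.1 : ℝ) ^ 2 - π ^ 2 / (2 * Λ) * ((z.2 : ℝ) - 2 * w * z.1) ^ 2))) ^ d := by
  set a : Fin d → ℂ := fun k => A k - 2 * π * w * Complex.I with ha
  have hare : ∀ k, α ≤ (a k).re := fun k => by simpa [ha] using hA k
  have hare0 : ∀ k, 0 < (a k).re := fun k => hα.trans_le (hare k)
  set g : (Fin d → ℤ) → ℂ := fun n => gauss b a 0 (latticePoint n) with hg
  have hgs : Summable fun n => ‖g n‖ :=
    .of_nonneg_of_le (fun _ => norm_nonneg _) (fun n => norm_gauss_zero_le b hare _)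
      (summable_exp_neg_norm_sq d hα)
  have hgs' : Summable fun n => ‖(starRingEnd ℂ) (g n)‖ := by simpa using hgs
  -- Substitution `(m, n) = (n + q, n)` in the double sum for the squared modulus, with `q` the
  -- difference.
  let e : (Fin d → ℤ) × (Fin d → ℤ) ≃ (Fin d → ℤ) × (Fin d → ℤ) :=
    { toFun := fun z => (z.2 + z.1, z.2)
      invFun := fun z => (z.1 - z.2, z.2)
      left_inv := fun z => by simp
      right_inv := fun z => by simp }
  have hsum := summable_mul_of_summable_norm hgs hgs'
  have hsum' : Summable fun z : (Fin d → ℤ) × (Fin d → ℤ) =>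
      g (z.2 + z.1) * (starRingEnd ℂ) (g z.2) := (e.summable_iff).2 hsum
  have hsq : (∑' n, g n) * (starRingEnd ℂ) (∑' n, g n)
      = ∑' q, ∑' n, g (n + q) * (starRingEnd ℂ) (g n) := by
    rw [Complex.conj_tsum, tsum_mul_tsum_of_summable_norm hgs hgs', ← e.tsum_eq]
    exact hsum'.tsum_prod
  have hc : 0 < π ^ 2 / (2 * Λ) := by positivity
  have hinner : ∀ q : Fin d → ℤ, ‖∑' n, g (n + q) * (starRingEnd ℂ) (g n)‖ₑ
      ≤ ∑' ξ : Fin d → ℤ, ENNReal.ofReal (√(π / (2 * α)) ^ d)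
        * ENNReal.ofReal (exp (-(α / 2) * ‖latticePoint q‖ ^ 2)
        * exp (-(π ^ 2 / (2 * Λ)) * ‖latticePoint ξ - (2 * w) • latticePoint q‖ ^ 2)) := by
    intro q
    have h1 : ∀ n, g (n + q) * (starRingEnd ℂ) (g n) = g q
        * gauss b (fun k => ((2 * A k : ℝ) : ℂ))
          (fun k => -2 * (A k - 2 * π * w * Complex.I) * b.repr (latticePoint q) k)
          (latticePoint n) := fun n => by
      simp only [hg, latticePoint_add]
      exact gauss_add_mul_conj b A w _ _
    simp_rw [h1]
    have hb := fun ξ : Fin d → ℤ => norm_gauss_mul_norm_fourier_le b hα hA hΛ w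
      (latticePoint q) (latticePoint ξ)
    have hs : Summable fun ξ : Fin d → ℤ => ‖g q * 𝓕 (gauss b (fun k => ((2 * A k : ℝ) : ℂ))
          (fun k => -2 * (A k - 2 * π * w * Complex.I) * b.repr (latticePoint q) k))
          (latticePoint ξ)‖ :=
      .of_nonneg_of_le (fun _ => norm_nonneg _) (fun ξ => by rw [norm_mul]; exact hb ξ)
        (((summable_exp_neg_norm_sub_sq hc _).mul_left _).mul_left _)
    -- The bound is for the transform multiplied by `g q`; dividing by this nonzero factor gives the
    -- summability that Poisson summation requires.
    have hq0 : g q ≠ 0 := Complex.exp_ne_zero _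
    rw [tsum_mul_left, poisson_gauss b (fun k => by simpa using hα.trans_le (hA k)) _
      ((summable_mul_left_iff hq0).1 hs.of_norm), ← tsum_mul_left]
    refine (enorm_tsum_le_tsum_enorm).trans (ENNReal.tsum_le_tsum fun ξ => ?_)
    rw [← ENNReal.ofReal_mul (by positivity), ← ofReal_norm, norm_mul]
    exact ENNReal.ofReal_le_ofReal (hb ξ)
  have hS : ‖∑' n, g n‖ₑ ^ 2 = ‖(∑' n, g n) * (starRingEnd ℂ) (∑' n, g n)‖ₑ := by
    rw [← ofReal_norm, ← ofReal_norm, norm_mul, RCLike.norm_conj,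
      ← ENNReal.ofReal_pow (norm_nonneg _), sq]
  rw [hS, hsq]
  refine (enorm_tsum_le_tsum_enorm).trans ((ENNReal.tsum_le_tsum hinner).trans (le_of_eq ?_))
  simp_rw [ENNReal.tsum_mul_left]
  congr 1
  -- Euclidean norms split equally well in the standard coordinates of `ℤ^d`, so the sum over pairs
  -- `(q, ξ)` is the `d`-th power of a sum over `ℤ × ℤ`, even though `b` need not be the standard
  -- basis.
  rw [← ennreal_tsum_pi_prod, ← (Equiv.arrowProdEquivProdArrow (Fin d) (fun _ => ℤ)
    (fun _ => ℤ)).symm.tsum_eq, ← ENNReal.tsum_prod]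
  refine tsum_congr fun z => ?_
  rw [← ENNReal.ofReal_prod_of_nonneg fun _ _ => (exp_pos _).le, ← exp_sum, ← exp_add,
    norm_latticePoint_sq, EuclideanSpace.norm_sq_eq]
  congr 2
  simp only [Equiv.arrowProdEquivProdArrow, Equiv.coe_fn_symm_mk, Finset.sum_sub_distrib,
    Finset.mul_sum, PiLp.sub_apply, PiLp.smul_apply, latticePoint_apply, smul_eq_mul,
    norm_eq_abs, sq_abs, neg_mul, Finset.sum_neg_distrib]
  ring

end Weyl

/-! ### Theta series of a unimodular plane lattice. -/

section Lattice

/-- The change of basis of `ℤ × ℤ` with determinant one sending `(0, 1)` to `(q, a)`. -/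
def unimodularEquiv {q a r t : ℤ} (h : q * t - a * r = 1) : ℤ × ℤ ≃ ℤ × ℤ where
  toFun z := (z.2 * q + z.1 * r, z.2 * a + z.1 * t)
  invFun z := (q * z.2 - a * z.1, t * z.1 - r * z.2)
  left_inv z := by
    ext
    · linear_combination z.1 * h
    · linear_combination z.2 * h
  right_inv z := by
    ext
    · linear_combination z.1 * h
    · linear_combination z.2 * h

/-- Lattice points of a unimodular plane lattice, counted with Gaussian weight, in terms of the
length `lam` of a primitive vector of length at most `√2`. -/
theorem ennreal_tsum_plane_lattice_le {L R gam lam : ℝ} (hL : 1 ≤ L) (hR : 0 < R) {q a : ℤ}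
    (hqa : IsCoprime q a) (hlam : 0 < lam)
    (hlam_sq : lam ^ 2 = (q : ℝ) ^ 2 / R ^ 2 + R ^ 2 * (gam * q - a) ^ 2) (hlam2 : lam ^ 2 ≤ 2) :
    ∑' z : ℤ × ℤ, ENNReal.ofReal
        (exp (-((z.1 : ℝ) ^ 2 / R ^ 2 + R ^ 2 * ((z.2 : ℝ) - gam * z.1) ^ 2) / (2 * L)))
      ≤ ENNReal.ofReal (36 * exp 1 ^ 2 * (L / lam)) := by
  obtain ⟨t, r', hrt⟩ := hqa
  obtain ⟨r, rfl⟩ : ∃ r, r' = -r := ⟨-r', by simp⟩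
  have h : q * t - a * r = 1 := by linear_combination hrt
  have hR' : (q : ℝ) * t - a * r = 1 := by exact_mod_cast h
  rw [← (unimodularEquiv h).tsum_eq]
  -- The inner product of the basis vectors `(q/R, R(gam q - a))` and `(r/R, R(gam r - t))`; the
  -- first has length `lam`.
  set s : ℝ := q * r / R ^ 2 + R ^ 2 * (gam * q - a) * (gam * r - t) with hs
  have hquad : ∀ z : ℤ × ℤ, (((unimodularEquiv h z).1 : ℝ) ^ 2 / R ^ 2
      + R ^ 2 * (((unimodularEquiv h z).2 : ℝ) - gam * (unimodularEquiv h z).1) ^ 2)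
      = lam ^ 2 * ((z.2 : ℝ) + z.1 * s / lam ^ 2) ^ 2 + (z.1 : ℝ) ^ 2 / lam ^ 2 := fun z => by
    simp only [unimodularEquiv, Equiv.coe_fn_mk]
    push_cast
    -- Lagrange's identity for two vectors spanning a parallelogram of area one.
    have h1 : ((r : ℝ) ^ 2 / R ^ 2 + R ^ 2 * (gam * r - t) ^ 2) * lam ^ 2 = s ^ 2 + 1 := by
      rw [hlam_sq, hs]
      have : ((q : ℝ) * t - a * r) ^ 2 = 1 := by rw [hR']; norm_num
      field_simp
      linear_combination (R ^ 4) * this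
    have h2 : lam ^ 2 * ((z.2 : ℝ) + z.1 * s / lam ^ 2) ^ 2 + (z.1 : ℝ) ^ 2 / lam ^ 2
        = lam ^ 2 * (z.2 : ℝ) ^ 2 + 2 * z.2 * z.1 * s + (z.1 : ℝ) ^ 2 * ((s ^ 2 + 1) / lam ^ 2) := by
      field_simp
      ring
    rw [h2, ← h1, mul_div_assoc, div_self (by positivity), hlam_sq, hs]
    field_simp
    ring
  simp_rw [hquad]
  have hL0 : 0 < L := by linarith
  have hb1 : 0 < lam ^ 2 / (2 * L) := by positivity
  have hb2 : 0 < 1 / (2 * L * lam ^ 2) := by positivity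
  have hsplit : ∀ z : ℤ × ℤ, ENNReal.ofReal (exp (-(lam ^ 2 * ((z.2 : ℝ) + z.1 * s / lam ^ 2) ^ 2
      + (z.1 : ℝ) ^ 2 / lam ^ 2) / (2 * L)))
      = ENNReal.ofReal (exp (-(1 / (2 * L * lam ^ 2)) * ((z.1 : ℝ) + 0) ^ 2))
        * ENNReal.ofReal (exp (-(lam ^ 2 / (2 * L)) * ((z.2 : ℝ) + z.1 * s / lam ^ 2) ^ 2)) :=
    fun z => by
      rw [← ENNReal.ofReal_mul (exp_pos _).le, ← exp_add]
      congr 2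
      field_simp
      ring
  simp_rw [hsplit]
  rw [ENNReal.tsum_prod (f := fun (k j : ℤ) =>
    ENNReal.ofReal (exp (-(1 / (2 * L * lam ^ 2)) * ((k : ℝ) + 0) ^ 2))
      * ENNReal.ofReal (exp (-(lam ^ 2 / (2 * L)) * ((j : ℝ) + k * s / lam ^ 2) ^ 2)))]
  simp_rw [ENNReal.tsum_mul_left]
  -- The sum along the short vector is bounded uniformly in its shift, which decouples it from the
  -- sum over the parallel lines, spaced `1/lam` apart.
  calc _ ≤ ∑' k : ℤ, ENNReal.ofReal (exp (-(1 / (2 * L * lam ^ 2)) * ((k : ℝ) + 0) ^ 2))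
        * ENNReal.ofReal (2 * exp 1 * (1 + 1 / √(lam ^ 2 / (2 * L)))) := by
        refine ENNReal.tsum_le_tsum fun k => ?_
        gcongr
        exact ennreal_tsum_int_exp_neg_mul_sq_le hb1 _
    _ ≤ ENNReal.ofReal (2 * exp 1 * (1 + 1 / √(1 / (2 * L * lam ^ 2))))
        * ENNReal.ofReal (2 * exp 1 * (1 + 1 / √(lam ^ 2 / (2 * L)))) := by
        rw [ENNReal.tsum_mul_right]
        gcongr
        exact ennreal_tsum_int_exp_neg_mul_sq_le hb2 0
    _ ≤ _ := by
        rw [← ENNReal.ofReal_mul (by positivity)]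
        apply ENNReal.ofReal_le_ofReal
        have hsL : 1 ≤ √L := one_le_sqrt.2 hL
        have hs2 : √2 ≤ 3 / 2 := by
          rw [sqrt_le_left (by norm_num)]; norm_num
        have hlam' : lam ≤ √2 := le_sqrt_of_sq_le hlam2
        have e1 : 1 / √(lam ^ 2 / (2 * L)) = √2 * √L / lam := by
          rw [sqrt_div (by positivity), sqrt_sq hlam.le, sqrt_mul (by norm_num), one_div_div]
        have e2 : 1 / √(1 / (2 * L * lam ^ 2)) = √2 * √L * lam := by
          rw [one_div, one_div, sqrt_inv, inv_inv, sqrt_mul (by positivity), sqrt_sq hlam.le,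
            sqrt_mul (by norm_num)]
        rw [e1, e2]
        have hs22 : √2 * √2 = 2 := mul_self_sqrt (by norm_num)
        have hsL2 : √L * √L = L := mul_self_sqrt hL0.le
        -- Since `lam ≤ √2` and `1 ≤ L`, the summands `1` are absorbed; the two factors `2e` and two
        -- factors `3` make up the constant `36 e²`.
        have f1 : 1 + √2 * √L / lam ≤ 3 * √L / lam := by
          rw [← sub_nonneg]
          have : 3 * √L / lam - (1 + √2 * √L / lam) = (3 * √L - lam - √2 * √L) / lam := by
            field_simp
            ring
          rw [this]
          apply div_nonneg _ hlam.le
          nlinarith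
        have f2 : 1 + √2 * √L * lam ≤ 3 * √L := by
          have : √2 * √L * lam ≤ √2 * √L * √2 := by gcongr
          nlinarith
        calc 2 * exp 1 * (1 + √2 * √L * lam) * (2 * exp 1 * (1 + √2 * √L / lam))
            ≤ 2 * exp 1 * (3 * √L) * (2 * exp 1 * (3 * √L / lam)) := by gcongr
          _ = 36 * exp 1 ^ 2 * ((√L * √L) / lam) := by ring
          _ = _ := by rw [hsL2]

end Lattice

/-! ### Theta series near a rational point. -/

section Minor

variable {d : ℕ} (b : OrthonormalBasis (Fin d) ℝ (EuclideanSpace ℝ (Fin d)))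

/-- A constant for the bound of the theta series on the minor arcs. -/
def minorConst : ℝ := √(π / 2) * (36 * exp 1 ^ 2)

theorem one_le_minorConst : 1 ≤ minorConst := by
  have h1 : 1 ≤ √(π / 2) := one_le_sqrt.2 (by linarith [pi_gt_three])
  have h2 : 1 ≤ exp 1 := one_le_exp zero_le_one
  unfold minorConst
  nlinarith [one_le_pow₀ h2 (n := 2)]

/-- With `D` the squared length of the vector given by `(q, a)`, the squared theta series is at most
`(√(π/2) R)^d (36 e² L/√D)^d`. As `1/√D ≤ R`, all but four of the factors `1/√D` are traded for `R`,
which is where `d ≥ 4` enters; the square root is `R^(d-2)/D` up to constants and powers of `L`. -/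
theorem norm_tsum_gauss_le_of_coprime (hd : 4 ≤ d) {A : Fin d → ℝ} {L R : ℝ} (hL : 1 ≤ L)
    (hR : 1 ≤ R) (hA : ∀ k, 1 / R ^ 2 ≤ A k) (hΛ : ∀ k, A k ≤ L / R ^ 2) (w : ℝ) {q a : ℤ}
    (hq : 1 ≤ q) (hqR : (q : ℝ) ≤ R) (hqa : IsCoprime q a) (hw : |2 * w * q - a| ≤ 1 / R) :
    ‖∑' n : Fin d → ℤ, gauss b (fun k => A k - 2 * π * w * Complex.I) 0 (latticePoint n)‖
      ≤ minorConst ^ d * L ^ d * R ^ (d - 2)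
        * ((q : ℝ) ^ 2 / R ^ 2 + R ^ 2 * (2 * w * q - a) ^ 2)⁻¹ := by
  have hR0 : 0 < R := by linarith
  have hL0 : 0 < L := by linarith
  have hq0 : (1 : ℝ) ≤ q := by exact_mod_cast hq
  set D : ℝ := (q : ℝ) ^ 2 / R ^ 2 + R ^ 2 * (2 * w * q - a) ^ 2 with hD
  have hD0 : 0 < D := by positivity
  have hD1 : 1 / R ^ 2 ≤ D := by
    have : 1 / R ^ 2 ≤ (q : ℝ) ^ 2 / R ^ 2 := by gcongr; nlinarith
    have : 0 ≤ R ^ 2 * (2 * w * q - a) ^ 2 := by positivity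
    linarith
  -- Each of the two squares is at most one: the first by `q ≤ R`, the second by the Dirichlet
  -- approximation.
  have hD2 : D ≤ 2 := by
    have h1 : (q : ℝ) ^ 2 / R ^ 2 ≤ 1 := by
      rw [div_le_one (by positivity)]
      gcongr
    have h2 : R ^ 2 * (2 * w * q - a) ^ 2 ≤ R ^ 2 * (1 / R) ^ 2 := by
      gcongr R ^ 2 * ?_
      exact sq_le_sq' (by linarith [neg_abs_le (2 * w * q - a)]) (by linarith [le_abs_self (2 * w * q - a)])
    have h3 : R ^ 2 * (1 / R) ^ 2 = 1 := by field_simp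
    linarith
  set T := ‖∑' n : Fin d → ℤ, gauss b (fun k => A k - 2 * π * w * Complex.I) 0 (latticePoint n)‖
    with hT
  have hM := one_le_minorConst
  have hM0 : 0 < minorConst := by linarith
  have h1 := enorm_tsum_gauss_sq_le b (by positivity : 0 < 1 / R ^ 2) hA hΛ (by positivity) w
  have h2 := ennreal_tsum_plane_lattice_le (gam := 2 * w) hL hR0 hqa (sqrt_pos.2 hD0)
    (by rw [sq_sqrt hD0.le]) (by rwa [sq_sqrt hD0.le])
  have h3 : ∑' z : ℤ × ℤ, ENNReal.ofReal (exp (-(1 / R ^ 2 / 2) * (z.1 : ℝ) ^ 2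
      - π ^ 2 / (2 * (L / R ^ 2)) * ((z.2 : ℝ) - 2 * w * z.1) ^ 2))
      ≤ ENNReal.ofReal (36 * exp 1 ^ 2 * (L / √D)) := by
    -- The first term of the exponent is weakened by `1/L ≤ 1` and the second by `1 ≤ π²`, so that
    -- both match the form of the plane lattice.
    refine le_trans (ENNReal.tsum_le_tsum fun z => ENNReal.ofReal_le_ofReal
      (exp_le_exp.2 ?_)) h2
    have e1 : -((z.1 : ℝ) ^ 2 / R ^ 2 + R ^ 2 * ((z.2 : ℝ) - 2 * w * z.1) ^ 2) / (2 * L)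
        = -(1 / R ^ 2 / 2) * (z.1 : ℝ) ^ 2 * (1 / L)
          - 1 / (2 * (L / R ^ 2)) * ((z.2 : ℝ) - 2 * w * z.1) ^ 2 := by
      field_simp
      ring
    rw [e1]
    have e2 : 1 / L ≤ 1 := by rw [div_le_one hL0]; exact hL
    have e3 : 1 / (2 * (L / R ^ 2)) ≤ π ^ 2 / (2 * (L / R ^ 2)) := by
      gcongr
      nlinarith [pi_gt_three]
    have e4 : 0 ≤ 1 / R ^ 2 / 2 * (z.1 : ℝ) ^ 2 := by positivity
    nlinarith [mul_le_mul_of_nonneg_left e2 e4,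
      mul_le_mul_of_nonneg_right e3 (sq_nonneg ((z.2 : ℝ) - 2 * w * z.1))]
  have h4 : ENNReal.ofReal (T ^ 2) ≤ ENNReal.ofReal (√(π / (2 * (1 / R ^ 2))) ^ d
      * (36 * exp 1 ^ 2 * (L / √D)) ^ d) := by
    rw [ENNReal.ofReal_mul (by positivity), ENNReal.ofReal_pow (p := 36 * exp 1 ^ 2 * (L / √D))
      (by positivity), ENNReal.ofReal_pow (norm_nonneg _), ofReal_norm]
    exact h1.trans (by gcongr)
  rw [ENNReal.ofReal_le_ofReal_iff (by positivity)] at h4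
  refine (abs_le_of_sq_le_sq' (h4.trans ?_) (by positivity)).2
  have hs : √(π / (2 * (1 / R ^ 2))) = √(π / 2) * R := by
    have : π / (2 * (1 / R ^ 2)) = π / 2 * R ^ 2 := by field_simp
    rw [this, sqrt_mul (by positivity), sqrt_sq hR0.le]
  have hsD : (1 / √D) ^ 2 = D⁻¹ := by rw [div_pow, sq_sqrt hD0.le, one_pow, one_div]
  have hsR : 1 / √D ≤ R := by
    rw [div_le_iff₀ (sqrt_pos.2 hD0)]
    have : 1 / R ≤ √D := by
      apply le_sqrt_of_sq_le
      rw [div_pow, one_pow]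
      exact hD1
    rw [div_le_iff₀ hR0] at this
    linarith
  obtain ⟨e, rfl⟩ : ∃ e, d = e + 4 := ⟨d - 4, by omega⟩
  calc √(π / (2 * (1 / R ^ 2))) ^ (e + 4) * (36 * exp 1 ^ 2 * (L / √D)) ^ (e + 4)
      = minorConst ^ (e + 4) * L ^ (e + 4) * R ^ (e + 4) * ((1 / √D) ^ 2) ^ 2 * (1 / √D) ^ e := by
        rw [hs, minorConst]
        ring
    _ ≤ minorConst ^ (e + 4) * L ^ (e + 4) * R ^ (e + 4) * ((1 / √D) ^ 2) ^ 2 * R ^ e := by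
        gcongr
    _ = (minorConst ^ (e + 4) * L ^ (e + 4)) * (R ^ (e + 2) * D⁻¹) ^ 2 := by
        rw [hsD]; ring
    _ ≤ (minorConst ^ (e + 4) * L ^ (e + 4)) ^ 2 * (R ^ (e + 2) * D⁻¹) ^ 2 := by
        gcongr
        have : 1 ≤ minorConst ^ (e + 4) * L ^ (e + 4) :=
          one_le_mul_of_one_le_of_one_le (one_le_pow₀ hM) (one_le_pow₀ hL)
        nlinarith
    _ = _ := by
        rw [show e + 4 - 2 = e + 2 by omega]
        ring

end Minor

/-! ### Integration over the minor arcs. -/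

section MinorIntegral

/-- A rescaled Cauchy density: its height `R²/q²` and its width, of order `R⁻²`, compensate, so the
result is free of `R` and `a`. -/
theorem lintegral_inv_arc {R q : ℝ} (hR : 0 < R) (hq : 0 < q) (a : ℝ) :
    ∫⁻ w : ℝ, ENNReal.ofReal ((q ^ 2 / R ^ 2 + R ^ 2 * (2 * w * q - a) ^ 2)⁻¹)
      = ENNReal.ofReal (π / (2 * q ^ 2)) := by
  have h : ∀ w : ℝ, (q ^ 2 / R ^ 2 + R ^ 2 * (2 * w * q - a) ^ 2)⁻¹
      = R ^ 2 / q ^ 2 * (1 + (2 * R ^ 2 * w - R ^ 2 * a / q) ^ 2)⁻¹ := fun w => by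
    have : q ^ 2 / R ^ 2 + R ^ 2 * (2 * w * q - a) ^ 2
        = q ^ 2 / R ^ 2 * (1 + (2 * R ^ 2 * w - R ^ 2 * a / q) ^ 2) := by
      field_simp
    rw [this, mul_inv, inv_div]
  simp_rw [h]
  have hi : Integrable fun w : ℝ => R ^ 2 / q ^ 2
      * (1 + (2 * R ^ 2 * w - R ^ 2 * a / q) ^ 2)⁻¹ :=
    (((integrable_inv_one_add_sq).comp_sub_right (R ^ 2 * a / q)).comp_mul_left'
      (by positivity)).const_mul _
  rw [← ofReal_integral_eq_lintegral_ofReal hi (Eventually.of_forall fun w => by positivity),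
    integral_const_mul,
    Measure.integral_comp_mul_left (fun y : ℝ => (1 + (y - R ^ 2 * a / q) ^ 2)⁻¹),
    integral_sub_right_eq_self (fun y : ℝ => (1 + y ^ 2)⁻¹), integral_univ_inv_one_add_sq,
    abs_of_pos (by positivity)]
  congr 1
  rw [smul_eq_mul]
  field_simp

theorem exists_coprime_approx {R : ℕ} (hR : 1 ≤ R) (γ : ℝ) :
    ∃ q a : ℤ, 1 ≤ q ∧ q ≤ R ∧ IsCoprime q a ∧ |γ * q - a| ≤ 1 / R := by
  obtain ⟨r, hr, hrR⟩ := Real.exists_rat_abs_sub_le_and_den_le γ (n := R) hR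
  refine ⟨r.den, r.num, by exact_mod_cast r.den_pos, by exact_mod_cast hrR, ?_, ?_⟩
  · have := r.reduced
    exact (Int.isCoprime_iff_gcd_eq_one.2 (by simpa [Int.gcd] using this)).symm
  · have hden : (0 : ℝ) < r.den := by exact_mod_cast r.den_pos
    have hR0 : (0 : ℝ) < R := by exact_mod_cast hR
    have h1 : γ * ((r.den : ℤ) : ℝ) - r.num = (γ - r) * r.den := by
      have : (r : ℝ) * r.den = r.num := by exact_mod_cast Rat.mul_den_eq_num r
      push_cast
      linear_combination this
    rw [h1, abs_mul, abs_of_pos hden]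
    calc |γ - r| * r.den ≤ 1 / ((R + 1) * r.den) * r.den := by gcongr
      _ = 1 / (R + 1) := by field_simp
      _ ≤ 1 / R := by gcongr; linarith

variable {d : ℕ} (b : OrthonormalBasis (Fin d) ℝ (EuclideanSpace ℝ (Fin d)))

/-- Pointwise bound on the minor arcs by a sum over rational points. -/
theorem rpow_mul_enorm_tsum_gauss_le (hd : 4 ≤ d) {η : ℝ} (hη : 0 < η) {A : Fin d → ℝ} {L : ℝ}
    {R : ℕ} (hL : 1 ≤ L) (hR : 2 ≤ R) (hA : ∀ k, 1 / (R : ℝ) ^ 2 ≤ A k)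
    (hΛ : ∀ k, A k ≤ L / (R : ℝ) ^ 2) {w : ℝ} (hw : 1 / (2 * R) < |w|) :
    ENNReal.ofReal (|w| ^ (-(1 + η)))
        * ‖∑' n : Fin d → ℤ, gauss b (fun k => A k - 2 * π * w * Complex.I) 0 (latticePoint n)‖ₑ
      ≤ ∑ q ∈ Finset.Icc 1 R, ∑' a : ℤ,
        ENNReal.ofReal ((4 * q / |(a : ℝ)|) ^ (1 + η) * (minorConst ^ d * L ^ d * R ^ (d - 2)))
        * ENNReal.ofReal (((q : ℝ) ^ 2 / R ^ 2 + R ^ 2 * (2 * w * q - a) ^ 2)⁻¹) := by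
  obtain ⟨q, a, hq1, hqR, hqa, hap⟩ := exists_coprime_approx (by omega : 1 ≤ R) (2 * w)
  lift q to ℕ using by omega
  have hq1' : 1 ≤ q := by exact_mod_cast hq1
  have hqR' : q ≤ R := by exact_mod_cast hqR
  have hR2 : (2 : ℝ) ≤ R := by exact_mod_cast hR
  have hq0 : (1 : ℝ) ≤ q := by exact_mod_cast hq1'
  have hM := one_le_minorConst
  have hbound := norm_tsum_gauss_le_of_coprime b hd hL (by linarith) hA hΛ w hq1
    (by exact_mod_cast hqR') hqa hap
  simp only [Int.cast_natCast] at hbound hap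
  have hw0 : 0 < |w| := lt_trans (by positivity) hw
  have hwq : 1 / (R : ℝ) < |2 * w * q| := by
    rw [abs_mul, abs_mul, abs_two, Nat.abs_cast]
    have : 1 / (R : ℝ) = 2 * (1 / (2 * R)) := by field_simp
    rw [this]
    nlinarith
  -- On the minor arcs `|2wq| > 1/R`, more than the approximation error; so `a` does not vanish and
  -- the weight `|w|^(-1-η)` turns into a decaying power of `a`.
  have ha0 : a ≠ 0 := by
    rintro rfl
    rw [Int.cast_zero, sub_zero] at hap
    linarith
  have ha1 : (1 : ℝ) ≤ |(a : ℝ)| := by exact_mod_cast Int.one_le_abs ha0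
  have hR12 : 1 / (R : ℝ) ≤ 1 / 2 := by gcongr
  have hwa : |(a : ℝ)| / (4 * q) ≤ |w| := by
    rw [div_le_iff₀ (by positivity)]
    have h1 : |(a : ℝ)| ≤ |2 * w * q| + 1 / R := by
      have := abs_sub_abs_le_abs_sub (a : ℝ) (2 * w * q)
      rw [abs_sub_comm] at this
      linarith
    rw [abs_mul, abs_mul, abs_two, Nat.abs_cast] at h1
    nlinarith
  have hrp : |w| ^ (-(1 + η)) ≤ (4 * q / |(a : ℝ)|) ^ (1 + η) := by
    rw [rpow_neg hw0.le, ← inv_rpow hw0.le]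
    refine rpow_le_rpow (by positivity) ?_ (by linarith)
    rw [inv_le_comm₀ hw0 (by positivity), inv_div]
    exact hwa
  have hmain : ENNReal.ofReal (|w| ^ (-(1 + η)))
        * ‖∑' n : Fin d → ℤ, gauss b (fun k => A k - 2 * π * w * Complex.I) 0 (latticePoint n)‖ₑ
      ≤ ENNReal.ofReal ((4 * q / |(a : ℝ)|) ^ (1 + η) * (minorConst ^ d * L ^ d * R ^ (d - 2)))
        * ENNReal.ofReal (((q : ℝ) ^ 2 / R ^ 2 + R ^ 2 * (2 * w * q - a) ^ 2)⁻¹) := by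
    rw [← ofReal_norm, ← ENNReal.ofReal_mul (by positivity), ← ENNReal.ofReal_mul (by positivity)]
    refine ENNReal.ofReal_le_ofReal ?_
    have := mul_le_mul hrp hbound (norm_nonneg _) (by positivity)
    rwa [← mul_assoc] at this
  -- The pair `(q, a)` depends on `w`; passing to the sum over all pairs of nonnegative terms
  -- removes this dependence before integration. The term `a = 0` is zero, since division by zero
  -- gives zero.
  refine hmain.trans ?_
  refine le_trans ?_ (Finset.single_le_sum (f := fun q : ℕ => ∑' a : ℤ,
        ENNReal.ofReal ((4 * q / |(a : ℝ)|) ^ (1 + η) * (minorConst ^ d * L ^ d * R ^ (d - 2)))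
        * ENNReal.ofReal (((q : ℝ) ^ 2 / R ^ 2 + R ^ 2 * (2 * w * q - a) ^ 2)⁻¹))
    (fun _ _ => zero_le) (Finset.mem_Icc.2 ⟨hq1', hqR'⟩))
  exact ENNReal.le_tsum (f := fun a : ℤ =>
    ENNReal.ofReal ((4 * q / |(a : ℝ)|) ^ (1 + η) * (minorConst ^ d * L ^ d * R ^ (d - 2)))
        * ENNReal.ofReal (((q : ℝ) ^ 2 / R ^ 2 + R ^ 2 * (2 * w * q - a) ^ 2)⁻¹)) a

/-- Each term is integrated over the whole line, giving `π/(2q²)`. There remain `∑ |a|^(-1-η)`,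
which converges, and `∑ q^(η-1)` over `q ≤ R`, which costs at most `R^(2η)`. -/
theorem exists_lintegral_minor_le (hd : 4 ≤ d) {η : ℝ} (hη : 0 < η) :
    ∃ C : ℝ, 0 ≤ C ∧ ∀ (A : Fin d → ℝ) (L : ℝ) (R : ℕ), 1 ≤ L → 2 ≤ R →
      (∀ k, 1 / (R : ℝ) ^ 2 ≤ A k) → (∀ k, A k ≤ L / (R : ℝ) ^ 2) →
      ∫⁻ w in {w : ℝ | 1 / (2 * R) < |w|}, ENNReal.ofReal (|w| ^ (-(1 + η)))
        * ‖∑' n : Fin d → ℤ, gauss b (fun k => A k - 2 * π * w * Complex.I) 0 (latticePoint n)‖ₑ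
      ≤ ENNReal.ofReal (C * (L ^ d * (R : ℝ) ^ (d - 2) * (R : ℝ) ^ (2 * η))) := by
  have hM := one_le_minorConst
  have hs := Real.summable_abs_int_rpow (b := 1 + η) (by linarith)
  have hs' : Summable fun n : ℕ => (n : ℝ) ^ (-(1 + η)) :=
    Real.summable_nat_rpow.2 (by linarith)
  set S := ∑' a : ℤ, |(a : ℝ)| ^ (-(1 + η)) with hS
  set S' := ∑' n : ℕ, (n : ℝ) ^ (-(1 + η)) with hS'
  have hS0 : 0 ≤ S := tsum_nonneg fun _ => by positivity
  have hS0' : 0 ≤ S' := tsum_nonneg fun _ => by positivity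
  refine ⟨4 ^ (1 + η) * (π / 2) * minorConst ^ d * S * S', by positivity,
    fun A L R hL hR hA hΛ => ?_⟩
  have hR0 : (1 : ℝ) ≤ R := by exact_mod_cast (by omega : 1 ≤ R)
  set B : ℝ := minorConst ^ d * L ^ d * (R : ℝ) ^ (d - 2) with hB
  have hB0 : 0 ≤ B := by positivity
  calc _ ≤ ∫⁻ w in {w : ℝ | 1 / (2 * R) < |w|}, ∑ q ∈ Finset.Icc 1 R, ∑' a : ℤ,
        ENNReal.ofReal ((4 * q / |(a : ℝ)|) ^ (1 + η) * B)
        * ENNReal.ofReal (((q : ℝ) ^ 2 / R ^ 2 + R ^ 2 * (2 * w * q - a) ^ 2)⁻¹) :=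
        setLIntegral_mono' (measurableSet_lt measurable_const measurable_id.abs) fun w hw =>
          rpow_mul_enorm_tsum_gauss_le b hd hη hL hR hA hΛ hw
    _ ≤ ∫⁻ w, ∑ q ∈ Finset.Icc 1 R, ∑' a : ℤ,
        ENNReal.ofReal ((4 * q / |(a : ℝ)|) ^ (1 + η) * B)
        * ENNReal.ofReal (((q : ℝ) ^ 2 / R ^ 2 + R ^ 2 * (2 * w * q - a) ^ 2)⁻¹) :=
        setLIntegral_le_lintegral _ _
    _ = ∑ q ∈ Finset.Icc 1 R, ∑' a : ℤ,
        ENNReal.ofReal ((4 * q / |(a : ℝ)|) ^ (1 + η) * B)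
        * ENNReal.ofReal (π / (2 * (q : ℝ) ^ 2)) := by
        rw [lintegral_finsetSum]
        swap
        · exact fun q _ => .tsum fun a => by fun_prop
        refine Finset.sum_congr rfl fun q hq => ?_
        rw [lintegral_tsum fun a => by fun_prop]
        refine tsum_congr fun a => ?_
        rw [lintegral_const_mul _ (by fun_prop), lintegral_inv_arc (by linarith)
          (by exact_mod_cast (Finset.mem_Icc.1 hq).1)]
    _ ≤ ∑ q ∈ Finset.Icc 1 R, ENNReal.ofReal
        (4 ^ (1 + η) * (π / 2) * B * S * (R : ℝ) ^ (2 * η) * (q : ℝ) ^ (-(1 + η))) := by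
        refine Finset.sum_le_sum fun q hq => ?_
        have hq1 : (1 : ℝ) ≤ q := by exact_mod_cast (Finset.mem_Icc.1 hq).1
        have hqR : (q : ℝ) ≤ R := by exact_mod_cast (Finset.mem_Icc.1 hq).2
        have e : ∀ a : ℤ, ENNReal.ofReal ((4 * q / |(a : ℝ)|) ^ (1 + η) * B)
            * ENNReal.ofReal (π / (2 * (q : ℝ) ^ 2))
            = ENNReal.ofReal ((4 * q) ^ (1 + η) * B * (π / (2 * (q : ℝ) ^ 2)))
              * ENNReal.ofReal (|(a : ℝ)| ^ (-(1 + η))) := fun a => by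
          rw [← ENNReal.ofReal_mul (by positivity), ← ENNReal.ofReal_mul (by positivity),
            div_rpow (by positivity) (by positivity), rpow_neg (abs_nonneg _)]
          congr 1
          ring
        simp_rw [e]
        rw [ENNReal.tsum_mul_left, ← ENNReal.ofReal_tsum_of_nonneg (fun _ => by positivity) hs,
          ← ENNReal.ofReal_mul (by positivity)]
        apply ENNReal.ofReal_le_ofReal
        -- Splitting `q^(η-1) = q^(2η) q^(-1-η)` leaves a convergent series in `q`.
        have h1 : (q : ℝ) ^ (1 + η) / (q : ℝ) ^ 2 ≤ (R : ℝ) ^ (2 * η) * (q : ℝ) ^ (-(1 + η)) := by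
          have : (q : ℝ) ^ (1 + η) / (q : ℝ) ^ 2 = (q : ℝ) ^ (2 * η) * (q : ℝ) ^ (-(1 + η)) := by
            rw [← rpow_natCast, ← rpow_sub (by linarith), ← rpow_add (by linarith)]
            congr 1
            push_cast
            ring
          rw [this]
          gcongr
        calc (4 * (q : ℝ)) ^ (1 + η) * B * (π / (2 * (q : ℝ) ^ 2)) * S
            = 4 ^ (1 + η) * (π / 2) * B * S * ((q : ℝ) ^ (1 + η) / (q : ℝ) ^ 2) := by
              rw [mul_rpow (by norm_num) (by positivity)]
              ring
          _ ≤ 4 ^ (1 + η) * (π / 2) * B * S * ((R : ℝ) ^ (2 * η) * (q : ℝ) ^ (-(1 + η))) := by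
              gcongr
          _ = _ := by ring
    _ = ENNReal.ofReal (4 ^ (1 + η) * (π / 2) * B * S * (R : ℝ) ^ (2 * η)
        * ∑ q ∈ Finset.Icc 1 R, (q : ℝ) ^ (-(1 + η))) := by
        rw [Finset.mul_sum, ENNReal.ofReal_sum_of_nonneg fun _ _ => by positivity]
    _ ≤ _ := by
        apply ENNReal.ofReal_le_ofReal
        have h2 : ∑ q ∈ Finset.Icc 1 R, (q : ℝ) ^ (-(1 + η)) ≤ S' :=
          hs'.sum_le_tsum _ fun _ _ => by positivity
        calc _ ≤ 4 ^ (1 + η) * (π / 2) * B * S * (R : ℝ) ^ (2 * η) * S' := by gcongr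
          _ = _ := by rw [hB]; ring

end MinorIntegral

/-! ### A continuous cutoff and its Fourier transform. -/

section Kernel

/-- An exponential restricted to a half-open interval. -/
def expBox (δ p q : ℝ) : ℝ → ℂ := (Set.Ico p q).indicator fun s => Complex.exp (δ * s)

theorem integrable_expBox (δ p q : ℝ) : Integrable (expBox δ p q) := by
  refine IntegrableOn.integrable_indicator ?_ measurableSet_Ico
  refine (Continuous.integrableOn_Icc ?_).mono_set Set.Ico_subset_Icc_self
  fun_prop

theorem norm_expBox_le {δ p q : ℝ} (hδ : 0 ≤ δ) (s : ℝ) : ‖expBox δ p q s‖ ≤ exp (δ * q) := by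
  unfold expBox
  by_cases hs : s ∈ Set.Ico p q
  · rw [Set.indicator_of_mem hs, Complex.norm_exp]
    simp only [Complex.mul_re, Complex.ofReal_re, Complex.ofReal_im, mul_zero, sub_zero]
    gcongr
    exact hs.2.le
  · rw [Set.indicator_of_notMem hs, norm_zero]
    positivity

theorem fourier_expBox {p q : ℝ} (hpq : p ≤ q) (δ w : ℝ) :
    𝓕 (expBox δ p q) w = ∫ s in p..q, Complex.exp ((δ - 2 * π * w * Complex.I) * s) := by
  rw [Real.fourier_real_eq_integral_exp_smul, intervalIntegral.integral_of_le hpq,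
    ← integral_Ico_eq_integral_Ioc, ← integral_indicator measurableSet_Ico]
  refine integral_congr_ae (Eventually.of_forall fun s => ?_)
  unfold expBox
  by_cases hs : s ∈ Set.Ico p q
  · simp only [Set.indicator_of_mem hs, smul_eq_mul, ← Complex.exp_add]
    congr 1
    push_cast
    ring
  · simp only [Set.indicator_of_notMem hs, smul_zero]

theorem norm_exp_sub_mul {δ q : ℝ} (hδ : 0 ≤ δ) {s : ℝ} (hs : s ≤ q) (w : ℝ) :
    ‖Complex.exp ((δ - 2 * π * w * Complex.I) * s)‖ ≤ exp (δ * q) := by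
  rw [Complex.norm_exp]
  simp only [Complex.sub_re, Complex.mul_re, Complex.ofReal_re, Complex.ofReal_im, Complex.I_re,
    Complex.I_im, Complex.re_ofNat, Complex.im_ofNat, Complex.mul_im, Complex.sub_im]
  ring_nf
  gcongr

theorem norm_fourier_expBox_le {δ p q : ℝ} (hδ : 0 ≤ δ) (hpq : p ≤ q) (w : ℝ) :
    ‖𝓕 (expBox δ p q) w‖ ≤ exp (δ * q) * (q - p) := by
  rw [fourier_expBox hpq]
  refine (intervalIntegral.norm_integral_le_of_norm_le_const (C := exp (δ * q))
    fun s hs => ?_).trans ?_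
  · rw [Set.uIoc_of_le hpq] at hs
    exact norm_exp_sub_mul hδ hs.2 w
  · rw [abs_of_nonneg (by linarith)]

theorem norm_fourier_expBox_le_div {δ p q : ℝ} (hδ : 0 ≤ δ) (hpq : p ≤ q) {w : ℝ} (hw : w ≠ 0) :
    ‖𝓕 (expBox δ p q) w‖ ≤ exp (δ * q) / |w| := by
  have him : (δ - 2 * π * w * Complex.I : ℂ).im = -(2 * π * w) := by simp
  have hne : (δ - 2 * π * w * Complex.I : ℂ) ≠ 0 := fun h => by
    rw [h] at him
    have := pi_pos
    simp only [Complex.zero_im, zero_eq_neg, mul_eq_zero] at him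
    rcases him with (h | h) | h
    · norm_num at h
    · linarith
    · exact hw h
  rw [fourier_expBox hpq, integral_exp_mul_complex hne, norm_div]
  have h1 : 2 * |w| ≤ ‖(δ - 2 * π * w * Complex.I : ℂ)‖ := by
    refine le_trans ?_ (Complex.abs_im_le_norm _)
    rw [him, abs_neg, abs_mul, abs_of_pos (by positivity : 0 < 2 * π)]
    gcongr
    linarith [pi_gt_three]
  have hw0 : 0 < |w| := abs_pos.2 hw
  calc _ ≤ (exp (δ * q) + exp (δ * q)) / (2 * |w|) := by
        gcongr
        exact (norm_sub_le _ _).trans (add_le_add (norm_exp_sub_mul hδ le_rfl w)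
          (norm_exp_sub_mul hδ hpq w))
    _ = _ := by field_simp; ring

/-- A continuous kernel, exponential on `[0, m]` and vanishing on `[m + 1, ∞)`, whose Fourier
transform decays quadratically. -/
def cutoffKernel (δ : ℝ) (m : ℕ) : ℝ → ℂ :=
  convolution (expBox 0 (-1 / 2) (1 / 2)) (expBox δ (-1 / 2) (m + 1 / 2))
    (ContinuousLinearMap.mul ℂ ℂ) volume

theorem cutoffKernel_eq (δ : ℝ) (m : ℕ) (t : ℝ) :
    cutoffKernel δ m t
      = ∫ y in (-1 / 2 : ℝ)..(1 / 2), expBox δ (-1 / 2) (m + 1 / 2) (t - y) := by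
  rw [cutoffKernel, convolution, intervalIntegral.integral_of_le (by norm_num),
    ← integral_Ico_eq_integral_Ioc, ← integral_indicator measurableSet_Ico]
  refine integral_congr_ae (Eventually.of_forall fun s => ?_)
  beta_reduce
  by_cases hs : s ∈ Set.Ico (-1 / 2 : ℝ) (1 / 2)
  · rw [expBox, Set.indicator_of_mem hs, Set.indicator_of_mem hs]
    simp
  · rw [expBox, Set.indicator_of_notMem hs, Set.indicator_of_notMem hs]
    simp

/-- Averaging over a unit interval writes the kernel as a difference of two primitives of an
integrable function. -/
theorem continuous_cutoffKernel (δ : ℝ) (m : ℕ) : Continuous (cutoffKernel δ m) := by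
  have hi : ∀ x y, IntervalIntegrable (expBox δ (-1 / 2) (m + 1 / 2)) volume x y := fun x y =>
    (integrable_expBox _ _ _).intervalIntegrable
  have : cutoffKernel δ m = fun t => (∫ s in (0 : ℝ)..(t - -1 / 2), expBox δ (-1 / 2) (m + 1 / 2) s)
      - ∫ s in (0 : ℝ)..(t - 1 / 2), expBox δ (-1 / 2) (m + 1 / 2) s := by
    funext t
    rw [cutoffKernel_eq, intervalIntegral.integral_comp_sub_left,
      intervalIntegral.integral_interval_sub_left (hi _ _) (hi _ _)]
  rw [this]
  have hp := intervalIntegral.continuous_primitive hi 0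
  exact (hp.comp (continuous_id.sub continuous_const)).sub
    (hp.comp (continuous_id.sub continuous_const))

theorem integrable_cutoffKernel (δ : ℝ) (m : ℕ) : Integrable (cutoffKernel δ m) :=
  (integrable_expBox _ _ _).integrable_convolution _ (integrable_expBox _ _ _)

theorem norm_cutoffKernel_le {δ : ℝ} (hδ : 0 ≤ δ) (m : ℕ) (t : ℝ) :
    ‖cutoffKernel δ m t‖ ≤ exp (δ * (m + 1 / 2)) := by
  rw [cutoffKernel_eq]
  refine (intervalIntegral.norm_integral_le_of_norm_le_const
    fun s _ => norm_expBox_le hδ _).trans ?_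
  norm_num

theorem cutoffKernel_eq_zero (δ : ℝ) (m : ℕ) {t : ℝ} (ht : (m : ℝ) + 1 ≤ t) :
    cutoffKernel δ m t = 0 := by
  rw [cutoffKernel_eq]
  refine intervalIntegral.integral_zero_ae (Eventually.of_forall fun y hy => ?_)
  rw [Set.uIoc_of_le (by norm_num)] at hy
  refine Set.indicator_of_notMem (fun h => ?_) _
  have := h.2
  linarith [hy.2]

/-- The normalizing constant of `cutoffKernel`. -/
def cutoffConst (δ : ℝ) : ℝ := ∫ y in (-1 / 2 : ℝ)..(1 / 2), exp (-(δ * y))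

theorem cutoffKernel_eq_exp (δ : ℝ) (m : ℕ) {t : ℝ} (ht : 0 ≤ t) (htm : t ≤ m) :
    cutoffKernel δ m t = cutoffConst δ * exp (δ * t) := by
  rw [cutoffKernel_eq, cutoffConst, mul_comm, ← intervalIntegral.integral_ofReal,
    ← intervalIntegral.integral_const_mul]
  refine intervalIntegral.integral_congr_ae (Eventually.of_forall fun y hy => ?_)
  rw [Set.uIoc_of_le (by norm_num)] at hy
  -- The half-open box includes `-1/2` and excludes `m + 1/2`; this makes the formula exact on all
  -- of `[0, m]`, and the kernel zero from `m + 1` on.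
  have hm : t - y ∈ Set.Ico (-1 / 2 : ℝ) (m + 1 / 2) := ⟨by linarith [hy.2], by linarith [hy.1]⟩
  rw [expBox, Set.indicator_of_mem hm, Complex.ofReal_exp, Complex.ofReal_exp, ← Complex.exp_add]
  push_cast
  congr 1
  ring

theorem le_cutoffConst {δ : ℝ} (hδ : 0 ≤ δ) : exp (-δ) ≤ cutoffConst δ := by
  have h : ∫ _y in (-1 / 2 : ℝ)..(1 / 2), exp (-δ) ≤ cutoffConst δ := by
    refine intervalIntegral.integral_mono_on (by norm_num) (by simp)
      (Continuous.intervalIntegrable (by fun_prop) _ _) fun y hy => ?_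
    refine exp_le_exp.2 ?_
    nlinarith [hy.2]
  refine le_trans (le_of_eq ?_) h
  norm_num

theorem fourier_cutoffKernel (δ : ℝ) (m : ℕ) (w : ℝ) :
    𝓕 (cutoffKernel δ m) w
      = 𝓕 (expBox 0 (-1 / 2) (1 / 2)) w * 𝓕 (expBox δ (-1 / 2) (m + 1 / 2)) w :=
  Real.fourier_mul_convolution_eq (integrable_expBox _ _ _) (integrable_expBox _ _ _) w

theorem norm_fourier_cutoffKernel_le {δ : ℝ} (hδ : 0 ≤ δ) (m : ℕ) (w : ℝ) :
    ‖𝓕 (cutoffKernel δ m) w‖ ≤ exp (δ * (m + 1 / 2)) * (m + 1) := by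
  rw [fourier_cutoffKernel, norm_mul]
  have h1 := norm_fourier_expBox_le le_rfl (by norm_num : (-1 / 2 : ℝ) ≤ 1 / 2) w
  have hm : (0 : ℝ) ≤ m := m.cast_nonneg
  have h2 := norm_fourier_expBox_le hδ (by linarith : (-1 / 2 : ℝ) ≤ m + 1 / 2) w
  rw [zero_mul, exp_zero, one_mul, show (1 / 2 : ℝ) - -1 / 2 = 1 by norm_num] at h1
  calc _ ≤ 1 * (exp (δ * (m + 1 / 2)) * (m + 1 / 2 - -1 / 2)) := by gcongr
    _ = _ := by ring

theorem norm_fourier_cutoffKernel_le_div {δ : ℝ} (hδ : 0 ≤ δ) (m : ℕ) {w : ℝ} (hw : w ≠ 0) :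
    ‖𝓕 (cutoffKernel δ m) w‖ ≤ exp (δ * (m + 1 / 2)) / |w| := by
  rw [fourier_cutoffKernel, norm_mul]
  have h1 := norm_fourier_expBox_le le_rfl (by norm_num : (-1 / 2 : ℝ) ≤ 1 / 2) w
  have hm : (0 : ℝ) ≤ m := m.cast_nonneg
  have h2 := norm_fourier_expBox_le_div hδ (by linarith : (-1 / 2 : ℝ) ≤ m + 1 / 2) hw
  rw [zero_mul, exp_zero, one_mul, show (1 / 2 : ℝ) - -1 / 2 = 1 by norm_num] at h1
  calc _ ≤ 1 * (exp (δ * (m + 1 / 2)) / |w|) := by gcongr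
    _ = _ := by ring

theorem norm_fourier_cutoffKernel_le_div_sq {δ : ℝ} (hδ : 0 ≤ δ) (m : ℕ) {w : ℝ} (hw : w ≠ 0) :
    ‖𝓕 (cutoffKernel δ m) w‖ ≤ exp (δ * (m + 1 / 2)) / |w| ^ 2 := by
  rw [fourier_cutoffKernel, norm_mul]
  have h1 := norm_fourier_expBox_le_div le_rfl (by norm_num : (-1 / 2 : ℝ) ≤ 1 / 2) hw
  have hm : (0 : ℝ) ≤ m := m.cast_nonneg
  have h2 := norm_fourier_expBox_le_div hδ (by linarith : (-1 / 2 : ℝ) ≤ m + 1 / 2) hw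
  rw [zero_mul, exp_zero] at h1
  calc _ ≤ 1 / |w| * (exp (δ * (m + 1 / 2)) / |w|) := by gcongr
    _ = _ := by ring

/-- Interpolation: decay `1/|w|` for `|w| ≤ 1` and `1/|w|²` beyond. Unlike the trivial bound,
neither has the factor `m + 1`; the exponent `1 + η` is what makes the sum over `a` on the minor
arcs converge. -/
theorem norm_fourier_cutoffKernel_le_rpow {δ : ℝ} (hδ : 0 ≤ δ) (m : ℕ) {w : ℝ} (hw : w ≠ 0)
    {η : ℝ} (hη0 : 0 ≤ η) (hη1 : η ≤ 1) :
    ‖𝓕 (cutoffKernel δ m) w‖ ≤ exp (δ * (m + 1 / 2)) * |w| ^ (-(1 + η)) := by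
  have hw0 : 0 < |w| := abs_pos.2 hw
  rcases le_total |w| 1 with h | h
  · refine (norm_fourier_cutoffKernel_le_div hδ m hw).trans ?_
    rw [div_eq_mul_inv, ← rpow_neg_one]
    gcongr 1
    exact rpow_le_rpow_of_exponent_ge hw0 h (by linarith)
  · refine (norm_fourier_cutoffKernel_le_div_sq hδ m hw).trans ?_
    rw [div_eq_mul_inv, ← rpow_natCast, ← rpow_neg hw0.le]
    gcongr 1
    exact rpow_le_rpow_of_exponent_le h (by push_cast; linarith)

theorem continuous_fourier_of_integrable {f : ℝ → ℂ} (hf : Integrable f) : Continuous (𝓕 f) :=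
  VectorFourier.fourierIntegral_continuous Real.continuous_fourierChar
    (by fun_prop) hf

theorem integrable_fourier_cutoffKernel {δ : ℝ} (hδ : 0 ≤ δ) (m : ℕ) :
    Integrable (𝓕 (cutoffKernel δ m)) := by
  refine ((integrable_inv_one_add_sq).const_mul (exp (δ * (m + 1 / 2)) * (m + 2))).mono'
    (continuous_fourier_of_integrable (integrable_cutoffKernel δ m)).aestronglyMeasurable
    (Eventually.of_forall fun w => ?_)
  have h1 := norm_fourier_cutoffKernel_le hδ m w
  have h2 : w ^ 2 * ‖𝓕 (cutoffKernel δ m) w‖ ≤ exp (δ * (m + 1 / 2)) := by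
    by_cases hw : w = 0
    · rw [hw]; simp; positivity
    · have := norm_fourier_cutoffKernel_le_div_sq hδ m hw
      rwa [le_div_iff₀ (by positivity), sq_abs, mul_comm] at this
  rw [← div_eq_mul_inv, le_div_iff₀ (by positivity)]
  nlinarith

theorem cutoffKernel_eq_integral_fourier {δ : ℝ} (hδ : 0 ≤ δ) (m : ℕ) (t : ℝ) :
    cutoffKernel δ m t
      = ∫ w, 𝓕 (cutoffKernel δ m) w * Complex.exp (2 * π * w * Complex.I * t) := by
  rw [← (integrable_cutoffKernel δ m).fourierInv_fourier_eq (integrable_fourier_cutoffKernel hδ m)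
    (continuous_cutoffKernel δ m).continuousAt (v := t), Real.fourierInv_eq']
  refine integral_congr_ae (Eventually.of_forall fun w => ?_)
  simp only [smul_eq_mul, RCLike.inner_apply, conj_trivial]
  rw [mul_comm]
  congr 2
  push_cast
  ring

end Kernel

/-! ### The circle method identity and the ingredients of the major arc. -/

section Circle

variable {d : ℕ} (b : OrthonormalBasis (Fin d) ℝ (EuclideanSpace ℝ (Fin d)))

/-- The imaginary part is the same in every coordinate, hence is a phase in `‖x‖²`: exactly the
character in the Fourier inversion of a cutoff evaluated at `‖x‖²`. -/
theorem gauss_sub_mul_I (A : Fin d → ℝ) (w : ℝ) (x : EuclideanSpace ℝ (Fin d)) :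
    gauss b (fun k => A k - 2 * π * w * Complex.I) 0 x
      = Complex.exp (2 * π * w * Complex.I * ((‖x‖ ^ 2 : ℝ) : ℂ))
        * gauss b (fun k => (A k : ℂ)) 0 x := by
  rw [gauss, gauss, ← Complex.exp_add, ← sum_repr_sq b]
  congr 1
  push_cast
  simp only [sub_mul, Finset.sum_sub_distrib, Finset.mul_sum, Pi.zero_apply, zero_mul,
    Finset.sum_const_zero]
  ring

theorem norm_exp_mul_I (w t : ℝ) : ‖Complex.exp (2 * π * w * Complex.I * (t : ℂ))‖ = 1 := by
  have : (2 * π * w * Complex.I * (t : ℂ)) = ((2 * π * w * t : ℝ) : ℂ) * Complex.I := by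
    push_cast; ring
  rw [this, Complex.norm_exp_ofReal_mul_I]

theorem norm_gauss_sub_mul_I (A : Fin d → ℝ) (w : ℝ) (x : EuclideanSpace ℝ (Fin d)) :
    ‖gauss b (fun k => A k - 2 * π * w * Complex.I) 0 x‖
      = ‖gauss b (fun k => (A k : ℂ)) 0 x‖ := by
  rw [gauss_sub_mul_I, norm_mul, norm_exp_mul_I, one_mul]

variable {A : Fin d → ℝ}

theorem continuous_tsum_gauss (hA : ∀ k, 0 < A k) : Continuous fun w : ℝ =>
    ∑' n : Fin d → ℤ, gauss b (fun k => A k - 2 * π * w * Complex.I) 0 (latticePoint n) := by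
  refine continuous_tsum (fun n => ?_)
    (summable_gauss b (a := fun k => (A k : ℂ)) (by simpa using hA) 0).norm
    fun n w => (norm_gauss_sub_mul_I b A w _).le
  unfold gauss
  fun_prop

theorem norm_tsum_gauss_le (hA : ∀ k, 0 < A k) (w : ℝ) :
    ‖∑' n : Fin d → ℤ, gauss b (fun k => A k - 2 * π * w * Complex.I) 0 (latticePoint n)‖
      ≤ ∑' n : Fin d → ℤ, ‖gauss b (fun k => (A k : ℂ)) 0 (latticePoint n)‖ :=
  tsum_of_norm_bounded (summable_gauss b (a := fun k => (A k : ℂ)) (by simpa using hA) 0).norm.hasSum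
    fun n => (norm_gauss_sub_mul_I b A w _).le

theorem cutoff_sum_eq_integral {δ : ℝ} (hδ : 0 ≤ δ) (m : ℕ) (hA : ∀ k, 0 < A k) :
    ∑' n : Fin d → ℤ, cutoffKernel δ m (‖latticePoint n‖ ^ 2)
        * gauss b (fun k => (A k : ℂ)) 0 (latticePoint n)
      = ∫ w, 𝓕 (cutoffKernel δ m) w
        * ∑' n : Fin d → ℤ, gauss b (fun k => A k - 2 * π * w * Complex.I) 0 (latticePoint n) := by
  have hk := integrable_fourier_cutoffKernel hδ m
  have h1 : ∀ n : Fin d → ℤ, cutoffKernel δ m (‖latticePoint n‖ ^ 2)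
        * gauss b (fun k => (A k : ℂ)) 0 (latticePoint n)
      = ∫ w, 𝓕 (cutoffKernel δ m) w
        * gauss b (fun k => A k - 2 * π * w * Complex.I) 0 (latticePoint n) := fun n => by
    rw [cutoffKernel_eq_integral_fourier hδ, ← integral_mul_const]
    refine integral_congr_ae (Eventually.of_forall fun w => ?_)
    beta_reduce
    rw [gauss_sub_mul_I, mul_assoc]
  have hn : ∀ (n : Fin d → ℤ) w, ‖𝓕 (cutoffKernel δ m) w
        * gauss b (fun k => A k - 2 * π * w * Complex.I) 0 (latticePoint n)‖
      = ‖𝓕 (cutoffKernel δ m) w‖ * ‖gauss b (fun k => (A k : ℂ)) 0 (latticePoint n)‖ := fun n w => by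
    rw [norm_mul, norm_gauss_sub_mul_I]
  simp_rw [h1]
  rw [integral_tsum_of_summable_integral_norm (fun n => ?_)]
  · simp_rw [tsum_mul_left]
  · simp_rw [hn, integral_mul_const]
    exact (summable_gauss b (a := fun k => (A k : ℂ)) (by simpa using hA) 0).norm.mul_left _
  · refine hk.mul_bdd (c := ‖gauss b (fun k => (A k : ℂ)) 0 (latticePoint n)‖) ?_
      (Eventually.of_forall fun w => (norm_gauss_sub_mul_I b A w _).le)
    refine Continuous.aestronglyMeasurable ?_
    unfold gauss
    fun_prop

theorem integrable_prod_cutoff {δ : ℝ} (hδ : 0 ≤ δ) (m : ℕ) (hA : ∀ k, 0 < A k) :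
    Integrable (fun z : EuclideanSpace ℝ (Fin d) × ℝ => 𝓕 (cutoffKernel δ m) z.2
      * gauss b (fun k => A k - 2 * π * z.2 * Complex.I) 0 z.1) := by
  have h := (integrable_gauss b (a := fun k => (A k : ℂ)) (by simpa using hA) 0).mul_prod
    (integrable_fourier_cutoffKernel hδ m)
  have h2 := h.bdd_mul (c := 1) (f := fun z : EuclideanSpace ℝ (Fin d) × ℝ =>
    Complex.exp (2 * π * z.2 * Complex.I * ((‖z.1‖ ^ 2 : ℝ) : ℂ)))
    (Continuous.aestronglyMeasurable (by fun_prop))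
    (Eventually.of_forall fun z => (norm_exp_mul_I _ _).le)
  refine h2.congr (Eventually.of_forall fun z => ?_)
  simp only [gauss_sub_mul_I]
  ring

theorem cutoff_integral_eq_integral {δ : ℝ} (hδ : 0 ≤ δ) (m : ℕ) (hA : ∀ k, 0 < A k) :
    ∫ x, cutoffKernel δ m (‖x‖ ^ 2) * gauss b (fun k => (A k : ℂ)) 0 x
      = ∫ w, 𝓕 (cutoffKernel δ m) w
        * ∫ x, gauss b (fun k => A k - 2 * π * w * Complex.I) 0 x := by
  have h1 : ∀ x : EuclideanSpace ℝ (Fin d), cutoffKernel δ m (‖x‖ ^ 2)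
        * gauss b (fun k => (A k : ℂ)) 0 x
      = ∫ w, 𝓕 (cutoffKernel δ m) w
        * gauss b (fun k => A k - 2 * π * w * Complex.I) 0 x := fun x => by
    rw [cutoffKernel_eq_integral_fourier hδ, ← integral_mul_const]
    refine integral_congr_ae (Eventually.of_forall fun w => ?_)
    beta_reduce
    rw [gauss_sub_mul_I, mul_assoc]
  simp_rw [h1, ← integral_const_mul]
  exact integral_integral_swap (integrable_prod_cutoff b hδ m hA)

/-- The circle method identity: the difference of the truncated lattice sum and the truncated
integral in terms of theta functions on a vertical line. -/
theorem cutoff_sum_sub_integral {δ : ℝ} (hδ : 0 ≤ δ) (m : ℕ) (hA : ∀ k, 0 < A k) :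
    ∑' n : Fin d → ℤ, cutoffKernel δ m (‖latticePoint n‖ ^ 2)
        * gauss b (fun k => (A k : ℂ)) 0 (latticePoint n)
      - ∫ x, cutoffKernel δ m (‖x‖ ^ 2) * gauss b (fun k => (A k : ℂ)) 0 x
      = ∫ w, 𝓕 (cutoffKernel δ m) w
        * (∑' n : Fin d → ℤ, gauss b (fun k => A k - 2 * π * w * Complex.I) 0 (latticePoint n)
          - ∫ x, gauss b (fun k => A k - 2 * π * w * Complex.I) 0 x) := by
  rw [cutoff_sum_eq_integral b hδ m hA, cutoff_integral_eq_integral b hδ m hA, ← integral_sub]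
  · simp_rw [mul_sub]
  · exact (integrable_fourier_cutoffKernel hδ m).mul_bdd
      (continuous_tsum_gauss b hA).aestronglyMeasurable
      (Eventually.of_forall (norm_tsum_gauss_le b hA))
  · have := (integrable_prod_cutoff b hδ m hA).integral_prod_right
    simpa only [integral_const_mul] using this

/-! ### The major arc -/

theorem prod_le_pow_of_le {f : Fin d → ℝ} {x : ℝ} (h0 : ∀ k, 0 ≤ f k) (h : ∀ k, f k ≤ x) :
    ∏ k, f k ≤ x ^ d := by
  simpa using Finset.prod_le_prod (s := Finset.univ) (fun k _ => h0 k) fun k _ => h k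

theorem prod_sqrt_le {R : ℝ} (hR : 0 < R) (hA : ∀ k, 1 / R ^ 2 ≤ A k) (w : ℝ) :
    ∏ k, √(π / ‖(A k - 2 * π * w * Complex.I : ℂ)‖) ≤ (2 * R) ^ d := by
  refine prod_le_pow_of_le (fun _ => sqrt_nonneg _) fun k => ?_
  have h1 : 1 / R ^ 2 ≤ ‖(A k - 2 * π * w * Complex.I : ℂ)‖ := by
    refine (hA k).trans ((Complex.re_le_norm _).trans' ?_)
    simp
  rw [sqrt_le_left (by positivity)]
  have h0 : 0 < 1 / R ^ 2 := by positivity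
  calc π / ‖(A k - 2 * π * w * Complex.I : ℂ)‖ ≤ π / (1 / R ^ 2) := by gcongr
    _ = π * R ^ 2 := by field_simp
    _ ≤ 4 * R ^ 2 := by gcongr; exact pi_le_four
    _ = _ := by ring

theorem prod_sqrt_le_inv_sqrt (A : Fin d → ℝ) {w : ℝ} (hw : w ≠ 0) :
    ∏ k, √(π / ‖(A k - 2 * π * w * Complex.I : ℂ)‖) ≤ (1 / √|w|) ^ d := by
  refine prod_le_pow_of_le (fun _ => sqrt_nonneg _) fun k => ?_
  have hw0 : 0 < |w| := abs_pos.2 hw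
  have h1 : 2 * π * |w| ≤ ‖(A k - 2 * π * w * Complex.I : ℂ)‖ := by
    refine le_trans (le_of_eq ?_) (Complex.abs_im_le_norm _)
    simp [abs_mul, abs_of_pos pi_pos]
  rw [one_div, ← sqrt_inv]
  apply sqrt_le_sqrt
  calc π / ‖(A k - 2 * π * w * Complex.I : ℂ)‖ ≤ π / (2 * π * |w|) := by gcongr
    _ = 1 / 2 * |w|⁻¹ := by field_simp
    _ ≤ |w|⁻¹ := by
      have : 0 < |w|⁻¹ := by positivity
      linarith

/-- The real part is `A/(A² + 4π²w²)`, with reciprocal `A + 4π²w²/A`; the two summands are bounded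
by `A ≤ L/R²` and `1/A ≤ R²`. -/
theorem le_re_inv {L R A : ℝ} (hR : 0 < R) (hA : 1 / R ^ 2 ≤ A) (hL : A ≤ L / R ^ 2)
    (w : ℝ) : (L / R ^ 2 + 4 * π ^ 2 * R ^ 2 * w ^ 2)⁻¹
      ≤ ((A - 2 * π * w * Complex.I : ℂ)⁻¹).re := by
  have hA0 : 0 < A := lt_of_lt_of_le (by positivity) hA
  have hL0 : 0 < L / R ^ 2 := by linarith
  have h : ((A - 2 * π * w * Complex.I : ℂ)⁻¹).re = A / (A ^ 2 + 4 * π ^ 2 * w ^ 2) := by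
    rw [Complex.inv_re, Complex.normSq_apply]
    simp
    ring
  rw [h, inv_eq_one_div, div_le_div_iff₀ (by positivity) (by positivity)]
  have h1 : 1 ≤ R ^ 2 * A := by
    rw [div_le_iff₀ (by positivity)] at hA
    linarith
  have h2 : 4 * π ^ 2 * w ^ 2 ≤ 4 * π ^ 2 * w ^ 2 * (R ^ 2 * A) :=
    le_mul_of_one_le_right (by positivity) h1
  nlinarith

/-- The exponential is at most `exp(-1/W) ≤ (d+1)! W^(d+1)`, a power large enough to beat the
singular factors in `w` on the major arc; the theta factor costs only `L^d` because `√W ≤ 4L`. -/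
theorem exp_neg_mul_theta_factor_le (d : ℕ) {L W : ℝ} (hL : 1 ≤ L) (hW : 0 < W)
    (hWL : W ≤ 11 * L) :
    exp (-(π ^ 2 * W⁻¹) / 2) * (2 * exp 1 * (1 + 1 / √(π ^ 2 * W⁻¹ / 2))) ^ d
      ≤ (d + 1).factorial * (10 * exp 1) ^ d * L ^ d * W ^ (d + 1) := by
  have hpi : 1 ≤ π ^ 2 / 2 := by nlinarith [pi_gt_three]
  have hWi : 0 < W⁻¹ := by positivity
  have h1 : W⁻¹ ≤ π ^ 2 * W⁻¹ / 2 := by nlinarith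
  have h2 : exp (-(π ^ 2 * W⁻¹) / 2) ≤ (d + 1).factorial * W ^ (d + 1) := by
    have h3 : exp (-(π ^ 2 * W⁻¹) / 2) ≤ (exp W⁻¹)⁻¹ := by
      rw [← exp_neg]
      apply exp_le_exp.2
      linarith
    have h4 := Real.pow_div_factorial_le_exp W⁻¹ hWi.le (d + 1)
    refine h3.trans ?_
    rw [inv_le_comm₀ (exp_pos _) (by positivity)]
    refine le_trans (le_of_eq ?_) h4
    rw [mul_inv, inv_pow]
    ring
  have h5 : 1 / √(π ^ 2 * W⁻¹ / 2) ≤ 4 * L := by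
    have h6 : 1 / √(π ^ 2 * W⁻¹ / 2) ≤ 1 / √(W⁻¹) := by gcongr
    refine h6.trans ?_
    rw [sqrt_inv, one_div, inv_inv, sqrt_le_left (by linarith)]
    nlinarith
  calc _ ≤ ((d + 1).factorial * W ^ (d + 1)) * (2 * exp 1 * (L + 4 * L)) ^ d := by gcongr
    _ = _ := by
      rw [show 2 * exp 1 * (L + 4 * L) = 10 * exp 1 * L by ring, mul_pow _ L]
      ring

end Circle

/-! ### The circle method bound. -/

section CircleBound

variable {d : ℕ} (b : OrthonormalBasis (Fin d) ℝ (EuclideanSpace ℝ (Fin d)))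

/-- A constant for the bound on the major arc. -/
def majorConst (d : ℕ) : ℝ :=
  (d + 1).factorial * (10 * exp 1) ^ d * (2 ^ (d + 1) * (2 ^ d + (4 * π ^ 2) ^ (d + 1)))

theorem majorConst_nonneg (d : ℕ) : 0 ≤ majorConst d := by unfold majorConst; positivity

/-- With `r = √R` and `v = √|w|`, the left side is `(rv)^(4d+4)/v^(d+2)`. As `rv ≤ 1` it is at most
`r^(d+2)`, and `d + 2 ≤ 2(d - 1)` for `d ≥ 4`. -/
theorem pow_div_pow_sqrt_le (hd : 4 ≤ d) {R w : ℝ} (hR : 1 ≤ R) (hw0 : w ≠ 0)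
    (hw : |w| ≤ 1 / (2 * R)) :
    (1 / |w|) * (1 / √|w|) ^ d * (R ^ 2 * w ^ 2) ^ (d + 1) ≤ R ^ (d - 1) := by
  obtain ⟨e, rfl⟩ : ∃ e, d = e + 4 := ⟨d - 4, by omega⟩
  have hR0 : 0 < R := by linarith
  have hwp : 0 < |w| := abs_pos.2 hw0
  set v := √|w| with hv
  set r := √R with hr
  have hv0 : 0 < v := sqrt_pos.2 hwp
  have hr0 : 1 ≤ r := one_le_sqrt.2 hR
  have hv2 : v ^ 2 = |w| := sq_sqrt hwp.le
  have hr2 : r ^ 2 = R := sq_sqrt hR0.le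
  have hz : r * v ≤ 1 := by
    have : (r * v) ^ 2 ≤ 1 := by
      rw [mul_pow, hv2, hr2]
      rw [le_div_iff₀ (by positivity)] at hw
      nlinarith
    exact (sq_le_one_iff₀ (by positivity)).1 this
  have hw2 : w ^ 2 = v ^ 4 := by
    rw [← sq_abs, ← hv2]; ring
  rw [hw2, ← hv2, ← hr2]
  have h1 : (1 / v ^ 2) * (1 / v) ^ (e + 4) * ((r ^ 2) ^ 2 * v ^ 4) ^ (e + 4 + 1)
      = (r * v) ^ (e + 6) * (r * v) ^ (3 * e + 14) / v ^ (e + 6) := by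
    rw [div_pow, one_pow]
    have h2 : 1 / v ^ 2 * (1 / v ^ (e + 4)) = 1 / v ^ (e + 6) := by
      rw [div_mul_div_comm, one_mul, ← pow_add, show 2 + (e + 4) = e + 6 by ring]
    rw [h2]
    field_simp
    ring
  rw [h1]
  calc (r * v) ^ (e + 6) * (r * v) ^ (3 * e + 14) / v ^ (e + 6)
      ≤ (r * v) ^ (e + 6) * 1 / v ^ (e + 6) := by
        gcongr
        exact pow_le_one₀ (by positivity) hz
    _ = r ^ (e + 6) := by rw [mul_pow]; field_simp
    _ ≤ r ^ (2 * (e + 3)) := pow_le_pow_right₀ hr0 (by omega)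
    _ = _ := by rw [pow_mul]; rfl

/-- On the major arc the theta function is close to the Gaussian integral. -/
theorem mul_norm_theta_sub_le (hd : 4 ≤ d) {A : Fin d → ℝ} {L R M K : ℝ} (hL : 1 ≤ L) (hR : 1 ≤ R)
    (hA : ∀ k, 1 / R ^ 2 ≤ A k) (hΛ : ∀ k, A k ≤ L / R ^ 2) {w : ℝ} (hw : |w| ≤ 1 / (2 * R))
    (hM : 0 ≤ M) (hK0 : 0 ≤ K) (hK1 : K ≤ M * R ^ 2) (hK2 : w ≠ 0 → K ≤ M / |w|) :
    K * ‖∑' n : Fin d → ℤ, gauss b (fun k => A k - 2 * π * w * Complex.I) 0 (latticePoint n)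
        - ∫ x, gauss b (fun k => A k - 2 * π * w * Complex.I) 0 x‖
      ≤ M * majorConst d * L ^ (2 * d + 1) * R ^ (d - 1) := by
  have hR0 : 0 < R := by linarith
  have hL0 : 0 < L := by linarith
  have hA0 : ∀ k, 0 < A k := fun k => lt_of_lt_of_le (by positivity) (hA k)
  -- The reciprocal of the lower bound for the real part of `1/a`, hence of the decay rate on the
  -- Fourier side up to `π²`.
  set W : ℝ := L / R ^ 2 + 4 * π ^ 2 * R ^ 2 * w ^ 2 with hW
  have hW0 : 0 < W := by positivity
  have hWL : W ≤ 11 * L := by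
    have h1 : L / R ^ 2 ≤ L := div_le_self hL0.le (one_le_pow₀ hR)
    have h2 : R ^ 2 * w ^ 2 ≤ 1 / 4 := by
      have : R * |w| ≤ 1 / 2 := by
        rw [le_div_iff₀ (by positivity)] at hw
        linarith
      rw [← sq_abs w, ← mul_pow]
      nlinarith [mul_nonneg hR0.le (abs_nonneg w)]
    have h3 : π ^ 2 ≤ 10 := by nlinarith [pi_lt_d2, pi_pos]
    nlinarith [mul_le_mul_of_nonneg_left h2 (by positivity : 0 ≤ 4 * π ^ 2)]
  have hT := norm_tsum_gauss_sub_integral_le b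
    (a := fun k => A k - 2 * π * w * Complex.I) (by simpa using hA0) (inv_pos.2 hW0)
    fun k => le_re_inv hR0 (hA k) (hΛ k) w
  set T := ‖∑' n : Fin d → ℤ, gauss b (fun k => A k - 2 * π * w * Complex.I) 0 (latticePoint n)
        - ∫ x, gauss b (fun k => A k - 2 * π * w * Complex.I) 0 x‖
  set P := ∏ k, √(π / ‖(A k - 2 * π * w * Complex.I : ℂ)‖) with hP
  have hP0 : 0 ≤ P := Finset.prod_nonneg fun _ _ => sqrt_nonneg _
  have hP1 : P ≤ (2 * R) ^ d := prod_sqrt_le hR0 hA w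
  have hP2 : w ≠ 0 → P ≤ (1 / √|w|) ^ d := prod_sqrt_le_inv_sqrt A
  have hS := exp_neg_mul_theta_factor_le d hL hW0 hWL
  set c : ℝ := (d + 1).factorial * (10 * exp 1) ^ d with hc
  have hc0 : 0 ≤ c := by positivity
  have hT2 : T ≤ P * (c * L ^ d * W ^ (d + 1)) := hT.trans (by gcongr)
  have hWK : W ^ (d + 1) ≤ 2 ^ (d + 1)
      * ((L / R ^ 2) ^ (d + 1) + (4 * π ^ 2) ^ (d + 1) * (R ^ 2 * w ^ 2) ^ (d + 1)) := by
    have := add_pow_le (by positivity : 0 ≤ L / R ^ 2)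
      (by positivity : 0 ≤ 4 * π ^ 2 * R ^ 2 * w ^ 2) (d + 1)
    refine this.trans ?_
    have e : (4 * π ^ 2 * R ^ 2 * w ^ 2) ^ (d + 1)
        = (4 * π ^ 2) ^ (d + 1) * (R ^ 2 * w ^ 2) ^ (d + 1) := by
      rw [← mul_pow]; ring
    rw [e]
    gcongr
    · norm_num
    · omega
  have hRd : 1 ≤ R ^ (d - 1) := one_le_pow₀ hR
  have hLd : L ^ d ≤ L ^ (2 * d + 1) := pow_le_pow_right₀ hL (by omega)
  -- The part of `W` independent of `w` is paired with the bounds for `K` and `P` uniform in `w`.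
  have t1 : K * P * (L ^ d * (L / R ^ 2) ^ (d + 1)) ≤ M * 2 ^ d * (L ^ (2 * d + 1) * R ^ (d - 1)) := by
    calc K * P * (L ^ d * (L / R ^ 2) ^ (d + 1))
        ≤ (M * R ^ 2) * (2 * R) ^ d * (L ^ d * (L / R ^ 2) ^ (d + 1)) := by gcongr
      _ = M * 2 ^ d * L ^ (2 * d + 1) * (R ^ (d + 2) / R ^ (2 * d + 2)) := by
          rw [mul_pow, div_pow]
          field_simp
          ring
      _ ≤ M * 2 ^ d * L ^ (2 * d + 1) * 1 := by
          gcongr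
          rw [div_le_one (by positivity)]
          exact pow_le_pow_right₀ hR (by omega)
      _ ≤ M * 2 ^ d * L ^ (2 * d + 1) * R ^ (d - 1) := by gcongr
      _ = _ := by ring
  -- The part of `W` proportional to `w²` is paired with the singular bounds `M/|w|` and
  -- `|w|^(-d/2)`, whose poles it cancels.
  have t2 : K * P * (L ^ d * ((4 * π ^ 2) ^ (d + 1) * (R ^ 2 * w ^ 2) ^ (d + 1)))
      ≤ M * (4 * π ^ 2) ^ (d + 1) * (L ^ (2 * d + 1) * R ^ (d - 1)) := by
    rcases eq_or_ne w 0 with h0 | h0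
    · rw [h0]
      simp only [ne_eq, OfNat.ofNat_ne_zero, not_false_eq_true, zero_pow, mul_zero,
        Nat.add_eq_zero_iff, one_ne_zero, and_false]
      positivity
    · have hwp : 0 < |w| := abs_pos.2 h0
      calc K * P * (L ^ d * ((4 * π ^ 2) ^ (d + 1) * (R ^ 2 * w ^ 2) ^ (d + 1)))
          ≤ (M / |w|) * (1 / √|w|) ^ d * (L ^ (2 * d + 1)
            * ((4 * π ^ 2) ^ (d + 1) * (R ^ 2 * w ^ 2) ^ (d + 1))) := by
            have := hK2 h0
            have := hP2 h0
            gcongr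
        _ = M * (4 * π ^ 2) ^ (d + 1) * L ^ (2 * d + 1)
            * ((1 / |w|) * (1 / √|w|) ^ d * (R ^ 2 * w ^ 2) ^ (d + 1)) := by ring
        _ ≤ M * (4 * π ^ 2) ^ (d + 1) * L ^ (2 * d + 1) * R ^ (d - 1) := by
            gcongr
            exact pow_div_pow_sqrt_le hd hR h0 hw
        _ = _ := by ring
  calc K * T ≤ K * (P * (c * L ^ d * W ^ (d + 1))) := by gcongr
    _ ≤ K * (P * (c * L ^ d * (2 ^ (d + 1)
      * ((L / R ^ 2) ^ (d + 1) + (4 * π ^ 2) ^ (d + 1) * (R ^ 2 * w ^ 2) ^ (d + 1))))) := by gcongr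
    _ = c * 2 ^ (d + 1) * (K * P * (L ^ d * (L / R ^ 2) ^ (d + 1))
      + K * P * (L ^ d * ((4 * π ^ 2) ^ (d + 1) * (R ^ 2 * w ^ 2) ^ (d + 1)))) := by ring
    _ ≤ c * 2 ^ (d + 1) * (M * 2 ^ d * (L ^ (2 * d + 1) * R ^ (d - 1))
      + M * (4 * π ^ 2) ^ (d + 1) * (L ^ (2 * d + 1) * R ^ (d - 1))) := by gcongr
    _ = _ := by rw [majorConst, ← hc]; ring

theorem lintegral_rpow_abs_gt {η c : ℝ} (hη : 0 < η) (hc : 0 < c) :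
    ∫⁻ w in {w : ℝ | c < |w|}, ENNReal.ofReal (|w| ^ (-(1 + η)))
      ≤ ENNReal.ofReal (2 * (c ^ (-η) / η)) := by
  have hpos : ∫⁻ w in Set.Ioi c, ENNReal.ofReal (|w| ^ (-(1 + η)))
      = ENNReal.ofReal (c ^ (-η) / η) := by
    rw [← ofReal_integral_eq_lintegral_ofReal]
    · congr 1
      have := integral_Ioi_rpow_of_lt (a := -(1 + η)) (by linarith) hc
      rw [show -(1 + η) + 1 = -η by ring] at this
      rw [← neg_div_neg_eq, ← this]
      refine setIntegral_congr_fun measurableSet_Ioi fun w hw => ?_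
      have : 0 < w := hc.trans hw
      simp only [abs_of_pos this]
    · refine (integrableOn_Ioi_rpow_of_lt (a := -(1 + η)) (by linarith) hc).congr_fun
        (fun w hw => ?_) measurableSet_Ioi
      have : 0 < w := hc.trans hw
      simp only [abs_of_pos this]
    · exact Eventually.of_forall fun w => by positivity
  have hneg : ∫⁻ w in Set.Iio (-c), ENNReal.ofReal (|w| ^ (-(1 + η)))
      = ENNReal.ofReal (c ^ (-η) / η) := by
    rw [← hpos, ← (Measure.measurePreserving_neg (volume : Measure ℝ)).setLIntegral_comp_preimage_emb
      (MeasurableEquiv.neg ℝ).measurableEmbedding]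
    simp
  have hset : {w : ℝ | c < |w|} ⊆ Set.Ioi c ∪ Set.Iio (-c) := fun w hw => by
    rcases lt_abs.1 (show c < |w| from hw) with h | h
    · exact Or.inl h
    · exact Or.inr (by simp only [Set.mem_Iio]; linarith)
  calc _ ≤ ∫⁻ w in Set.Ioi c ∪ Set.Iio (-c), ENNReal.ofReal (|w| ^ (-(1 + η))) :=
        lintegral_mono_set hset
    _ ≤ _ := lintegral_union_le _ _ _
    _ = _ := by
        rw [hpos, hneg, ← ENNReal.ofReal_add (by positivity) (by positivity), two_mul]

/-- The truncated lattice sum with Gaussian weight approximates the truncated integral. -/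
theorem exists_norm_cutoff_sub_le (hd : 4 ≤ d) {η : ℝ} (hη : 0 < η) (hη1 : η ≤ 1) :
    ∃ C : ℝ, 0 ≤ C ∧ ∀ (A : Fin d → ℝ) (L : ℝ) (R m : ℕ), 1 ≤ L → 2 ≤ R →
      (m : ℝ) + 1 ≤ 5 * (R : ℝ) ^ 2 →
      (∀ k, 1 / (R : ℝ) ^ 2 ≤ A k) → (∀ k, A k ≤ L / (R : ℝ) ^ 2) →
      ‖∑' n : Fin d → ℤ, cutoffKernel (1 / (R : ℝ) ^ 2) m (‖latticePoint n‖ ^ 2)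
          * gauss b (fun k => (A k : ℂ)) 0 (latticePoint n)
        - ∫ x, cutoffKernel (1 / (R : ℝ) ^ 2) m (‖x‖ ^ 2) * gauss b (fun k => (A k : ℂ)) 0 x‖
      ≤ C * (L ^ (2 * d + 1) * (R : ℝ) ^ (d - 2) * (R : ℝ) ^ (2 * η)) := by
  obtain ⟨C₁, hC₁, hminor⟩ := exists_lintegral_minor_le b hd hη
  refine ⟨5 * exp 5 * majorConst d + (exp 5 * C₁ + exp 5 * 2 ^ d * (2 * (2 ^ η / η))),
    by have := majorConst_nonneg d; positivity, fun A L R m hL hR hm hA hΛ => ?_⟩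
  have hR2 : (2 : ℝ) ≤ R := by exact_mod_cast hR
  have hR0 : (0 : ℝ) < R := by linarith
  have hL0 : 0 < L := by linarith
  have hA0 : ∀ k, 0 < A k := fun k => lt_of_lt_of_le (by positivity) (hA k)
  have hδ : 0 ≤ 1 / (R : ℝ) ^ 2 := by positivity
  -- The rate `δ = 1/R²` keeps the growing exponential bounded up to `m + 1 ≤ 5R²`.
  have hexp : exp (1 / (R : ℝ) ^ 2 * (m + 1 / 2)) ≤ exp 5 := by
    apply exp_le_exp.2
    rw [one_div_mul_eq_div, div_le_iff₀ (by positivity)]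
    linarith
  rw [cutoff_sum_sub_integral b hδ m hA0]
  set k := 𝓕 (cutoffKernel (1 / (R : ℝ) ^ 2) m) with hk
  set Θ : ℝ → ℂ := fun w => ∑' n : Fin d → ℤ,
    gauss b (fun k => A k - 2 * π * w * Complex.I) 0 (latticePoint n) with hΘ
  set I : ℝ → ℂ := fun w => ∫ x, gauss b (fun k => A k - 2 * π * w * Complex.I) 0 x with hI
  have hRrp : 1 ≤ (R : ℝ) ^ (2 * η) := one_le_rpow (by linarith) (by linarith)
  set X : ℝ := L ^ (2 * d + 1) * (R : ℝ) ^ (d - 2) * (R : ℝ) ^ (2 * η) with hX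
  have hX0 : 0 ≤ X := by positivity
  set S : Set ℝ := {w : ℝ | 1 / (2 * (R : ℝ)) < |w|} with hS
  have hSm : MeasurableSet S := measurableSet_lt measurable_const measurable_id.abs
  -- The pointwise bound has `R^(d-1)`; the arc has length `1/R`, which saves one power.
  have hmaj : ∫⁻ w in Sᶜ, ‖k w * (Θ w - I w)‖ₑ
      ≤ ENNReal.ofReal (5 * exp 5 * majorConst d * X) := by
    have hpt : ∀ w ∈ Sᶜ, ‖k w * (Θ w - I w)‖ₑ ≤ ENNReal.ofReal
        (5 * exp 5 * majorConst d * L ^ (2 * d + 1) * (R : ℝ) ^ (d - 1)) := fun w hw => by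
      have hw' : |w| ≤ 1 / (2 * (R : ℝ)) := not_lt.1 hw
      rw [← ofReal_norm, norm_mul]
      apply ENNReal.ofReal_le_ofReal
      refine mul_norm_theta_sub_le b hd hL (by linarith) hA hΛ hw' (by positivity)
        (norm_nonneg _) ?_ fun hw0 => ?_
      · refine (norm_fourier_cutoffKernel_le hδ m w).trans ?_
        calc _ ≤ exp 5 * (5 * (R : ℝ) ^ 2) := by gcongr
          _ = _ := by ring
      · refine (norm_fourier_cutoffKernel_le_div hδ m hw0).trans ?_
        have : 0 < |w| := abs_pos.2 hw0
        gcongr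
        have := exp_pos 5
        linarith
    have hSc : Sᶜ ⊆ Set.Icc (-(1 / (2 * (R : ℝ)))) (1 / (2 * (R : ℝ))) := fun w hw =>
      abs_le.1 (not_lt.1 hw)
    have hvol : volume Sᶜ ≤ ENNReal.ofReal (1 / R) := by
      refine (measure_mono hSc).trans ?_
      rw [Real.volume_Icc]
      apply ENNReal.ofReal_le_ofReal
      apply le_of_eq
      field_simp
      norm_num
    refine (setLIntegral_mono' hSm.compl hpt).trans ?_
    rw [setLIntegral_const]
    refine (mul_le_mul_right hvol _).trans ?_
    have := majorConst_nonneg d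
    rw [← ENNReal.ofReal_mul (by positivity)]
    apply ENNReal.ofReal_le_ofReal
    have e : (R : ℝ) ^ (d - 1) = (R : ℝ) ^ (d - 2) * R := by
      rw [← pow_succ]; congr 1; omega
    calc 5 * exp 5 * majorConst d * L ^ (2 * d + 1) * (R : ℝ) ^ (d - 1) * (1 / R)
        = 5 * exp 5 * majorConst d * (L ^ (2 * d + 1) * (R : ℝ) ^ (d - 2) * 1) := by
          rw [e]; field_simp
      _ ≤ _ := by rw [hX]; gcongr
  -- No cancellation is needed here: the theta series and the Gaussian integral are bounded
  -- separately.
  have hmin : ∫⁻ w in S, ‖k w * (Θ w - I w)‖ₑ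
      ≤ ENNReal.ofReal ((exp 5 * C₁ + exp 5 * 2 ^ d * (2 * (2 ^ η / η))) * X) := by
    have hpt : ∀ w ∈ S, ‖k w * (Θ w - I w)‖ₑ
        ≤ ENNReal.ofReal (exp 5) * (ENNReal.ofReal (|w| ^ (-(1 + η))) * ‖Θ w‖ₑ)
          + ENNReal.ofReal (exp 5 * (2 ^ d * (R : ℝ) ^ (d - 2)))
            * ENNReal.ofReal (|w| ^ (-(1 + η))) := fun w hw => by
      have hw0 : w ≠ 0 := by
        rintro rfl
        rw [hS, Set.mem_ofPred_eq, abs_zero] at hw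
        exact absurd hw (not_lt.2 (by positivity))
      have hwp : 0 < |w| := abs_pos.2 hw0
      have hkw : ‖k w‖ₑ ≤ ENNReal.ofReal (exp 5) * ENNReal.ofReal (|w| ^ (-(1 + η))) := by
        rw [← ofReal_norm, ← ENNReal.ofReal_mul (exp_pos _).le]
        apply ENNReal.ofReal_le_ofReal
        refine (norm_fourier_cutoffKernel_le_rpow hδ m hw0 hη.le hη1).trans ?_
        gcongr
      have hIw : ‖I w‖ₑ ≤ ENNReal.ofReal (2 ^ d * (R : ℝ) ^ (d - 2)) := by
        rw [← ofReal_norm]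
        apply ENNReal.ofReal_le_ofReal
        rw [hI]
        simp only
        rw [norm_integral_gauss_zero b (by simpa using hA0)]
        refine (prod_sqrt_le_inv_sqrt A hw0).trans ?_
        have h1 : 1 / √|w| ≤ 2 * √R := by
          rw [hS, Set.mem_ofPred_eq] at hw
          rw [one_div, ← sqrt_inv, sqrt_le_left (by positivity), mul_pow, sq_sqrt hR0.le]
          rw [inv_le_comm₀ hwp (by positivity)]
          refine le_trans ?_ hw.le
          rw [← one_div]
          gcongr
          norm_num
        -- The Gaussian integral is at most `|w|^(-d/2)`, of order `R^(d/2)` here, and `d/2 ≤ d - 2`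
        -- for `d ≥ 4`.
        have h2 : √(R : ℝ) ^ d ≤ (R : ℝ) ^ (d - 2) := by
          calc √(R : ℝ) ^ d ≤ √(R : ℝ) ^ (2 * (d - 2)) :=
                pow_le_pow_right₀ (one_le_sqrt.2 (by linarith)) (by omega)
            _ = _ := by rw [pow_mul, sq_sqrt hR0.le]
        calc (1 / √|w|) ^ d ≤ (2 * √R) ^ d := by gcongr
          _ = 2 ^ d * √R ^ d := mul_pow _ _ _
          _ ≤ _ := by gcongr
      calc ‖k w * (Θ w - I w)‖ₑ = ‖k w‖ₑ * ‖Θ w - I w‖ₑ := enorm_mul _ _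
        _ ≤ ‖k w‖ₑ * (‖Θ w‖ₑ + ‖I w‖ₑ) := by gcongr; exact enorm_sub_le
        _ ≤ (ENNReal.ofReal (exp 5) * ENNReal.ofReal (|w| ^ (-(1 + η))))
            * (‖Θ w‖ₑ + ENNReal.ofReal (2 ^ d * (R : ℝ) ^ (d - 2))) := by gcongr
        _ = _ := by
          rw [ENNReal.ofReal_mul (exp_pos _).le (q := 2 ^ d * (R : ℝ) ^ (d - 2))]
          ring
    refine (setLIntegral_mono' hSm hpt).trans ?_
    rw [lintegral_add_right _ (by fun_prop), lintegral_const_mul' _ _ ENNReal.ofReal_ne_top,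
      lintegral_const_mul' _ _ ENNReal.ofReal_ne_top]
    have hrp := lintegral_rpow_abs_gt hη (by positivity : 0 < 1 / (2 * (R : ℝ)))
    calc _ ≤ ENNReal.ofReal (exp 5)
          * ENNReal.ofReal (C₁ * (L ^ d * (R : ℝ) ^ (d - 2) * (R : ℝ) ^ (2 * η)))
          + ENNReal.ofReal (exp 5 * (2 ^ d * (R : ℝ) ^ (d - 2)))
            * ENNReal.ofReal (2 * ((1 / (2 * (R : ℝ))) ^ (-η) / η)) := by
          gcongr
          exact hminor A L R hL hR hA hΛ
      _ ≤ _ := by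
          rw [← ENNReal.ofReal_mul (by positivity), ← ENNReal.ofReal_mul (by positivity),
            ← ENNReal.ofReal_add (by positivity) (by positivity)]
          apply ENNReal.ofReal_le_ofReal
          have e1 : (1 / (2 * (R : ℝ))) ^ (-η) = 2 ^ η * (R : ℝ) ^ η := by
            rw [one_div, inv_rpow (by positivity), rpow_neg (by positivity), inv_inv,
              mul_rpow (by norm_num) hR0.le]
          have e2 : (R : ℝ) ^ η ≤ (R : ℝ) ^ (2 * η) :=
            rpow_le_rpow_of_exponent_le (by linarith) (by linarith)
          have e3 : L ^ d ≤ L ^ (2 * d + 1) := pow_le_pow_right₀ hL (by omega)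
          have e4 : 1 ≤ L ^ (2 * d + 1) := one_le_pow₀ hL
          rw [e1, add_mul]
          apply add_le_add
          · calc _ = exp 5 * C₁ * (L ^ d * (R : ℝ) ^ (d - 2) * (R : ℝ) ^ (2 * η)) := by ring
              _ ≤ _ := by rw [hX]; gcongr
          · calc _ = exp 5 * 2 ^ d * (2 * (2 ^ η / η))
                  * (1 * (R : ℝ) ^ (d - 2) * (R : ℝ) ^ η) := by ring
              _ ≤ _ := by rw [hX]; gcongr
  have hfin : ENNReal.ofReal ‖∫ w, k w * (Θ w - I w)‖ ≤ ENNReal.ofReal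
      ((5 * exp 5 * majorConst d + (exp 5 * C₁ + exp 5 * 2 ^ d * (2 * (2 ^ η / η)))) * X) := by
    have := majorConst_nonneg d
    rw [ofReal_norm]
    refine (enorm_integral_le_lintegral_enorm _).trans ?_
    rw [← lintegral_add_compl _ hSm, add_mul,
      ENNReal.ofReal_add (by positivity) (by positivity), add_comm]
    exact add_le_add hmaj hmin
  have := majorConst_nonneg d
  exact (ENNReal.ofReal_le_ofReal_iff (by positivity)).1 hfin

end CircleBound

/-! ### Diagonalisation of the quadratic form. -/

section Diagonal

variable {d : ℕ}

/-- A positive definite quadratic form on Euclidean space is diagonal with positive entries in a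
suitable orthonormal basis. -/
theorem exists_orthonormalBasis_diagonal {Q : QuadraticForm ℝ (EuclideanSpace ℝ (Fin d))}
    (hQ : Q.PosDef) : ∃ (b : OrthonormalBasis (Fin d) ℝ (EuclideanSpace ℝ (Fin d)))
      (lam : Fin d → ℝ), (∀ k, 0 < lam k) ∧ ∀ x, Q x = ∑ k, lam k * b.repr x k ^ 2 := by
  let B := QuadraticMap.associated (R := ℝ) Q
  -- The self-adjoint operator representing the polar form of `Q`; its eigenbasis diagonalises `Q`.
  let T : EuclideanSpace ℝ (Fin d) →ₗ[ℝ] EuclideanSpace ℝ (Fin d) :=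
    { toFun := fun x => (InnerProductSpace.toDual ℝ _).symm (LinearMap.toContinuousLinearMap (B x))
      map_add' := fun x y => by simp
      map_smul' := fun c x => by simp }
  have hT : ∀ x y, inner ℝ (T x) y = B x y := fun x y => by
    change inner ℝ ((InnerProductSpace.toDual ℝ _).symm (LinearMap.toContinuousLinearMap (B x))) y
      = B x y
    rw [InnerProductSpace.toDual_symm_apply]
    rfl
  have hB : ∀ x y, B x y = B y x := fun x y => by
    simp only [B, QuadraticMap.associated_apply]
    rw [add_comm x y]
    congr 1
    ring
  have hsym : T.IsSymmetric := fun x y => by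
    rw [hT, hB, ← hT, real_inner_comm]
  have hn : Module.finrank ℝ (EuclideanSpace ℝ (Fin d)) = d := by simp
  let b := hsym.eigenvectorBasis hn
  have hdiag : ∀ x, Q x = ∑ k, hsym.eigenvalues hn k * b.repr x k ^ 2 := fun x => by
    have h1 : Q x = B x x := (QuadraticMap.associated_eq_self_apply ℝ Q x).symm
    rw [h1, ← hT, ← b.repr.inner_map_map, PiLp.inner_apply]
    refine Finset.sum_congr rfl fun k _ => ?_
    have := hsym.eigenvectorBasis_apply_self_apply hn x k
    simp only [RCLike.inner_apply, conj_trivial, b]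
    rw [this]
    simp
    ring
  refine ⟨b, hsym.eigenvalues hn, fun k => ?_, hdiag⟩
  have h := hQ (b k) (b.orthonormal.ne_zero k)
  rw [hdiag] at h
  classical
  simpa [b.repr_self, Finset.sum_eq_single k, Pi.single_apply] using h

/-- The isotropic term `δ‖x‖²` is diagonal in every orthonormal basis. It keeps the Gaussian at
width at most about `R` even when `u` is tiny, and is undone by the factor `exp(δt)` of the cutoff
kernel. -/
theorem gauss_eq_exp {Q : QuadraticForm ℝ (EuclideanSpace ℝ (Fin d))}
    {b : OrthonormalBasis (Fin d) ℝ (EuclideanSpace ℝ (Fin d))} {lam : Fin d → ℝ}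
    (hdiag : ∀ x, Q x = ∑ k, lam k * b.repr x k ^ 2) (u δ : ℝ) (x : EuclideanSpace ℝ (Fin d)) :
    gauss b (fun k => ((u * lam k + δ : ℝ) : ℂ)) 0 x
      = ((exp (-(u * Q x) - δ * ‖x‖ ^ 2) : ℝ) : ℂ) := by
  rw [gauss, Complex.ofReal_exp, hdiag, ← sum_repr_sq b]
  congr 1
  push_cast
  simp only [add_mul, Finset.sum_add_distrib, Finset.mul_sum, Pi.zero_apply, zero_mul,
    Finset.sum_const_zero, mul_assoc]
  ring

theorem exists_bounds_diagonal {lam : Fin d → ℝ} (hlam : ∀ k, 0 < lam k) :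
    ∃ κ Λ : ℝ, 0 < κ ∧ 0 < Λ ∧ (∀ k, κ ≤ lam k) ∧ ∀ k, lam k ≤ Λ := by
  obtain ⟨κ, hκ, h⟩ := exists_pos_le_re (a := fun k => (lam k : ℂ)) (by simpa using hlam)
  refine ⟨κ, 1 + ∑ k, lam k, hκ, ?_, by simpa using h, fun k => ?_⟩
  · have := Finset.sum_nonneg fun k (_ : k ∈ Finset.univ) => (hlam k).le
    linarith
  · have := Finset.single_le_sum (fun k (_ : k ∈ Finset.univ) => (hlam k).le) (Finset.mem_univ k)
    linarith

end Diagonal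

/-! ### Volume of the shell between consecutive integers. -/

section Shell

variable {d : ℕ}

/-- Bernoulli's inequality for `(x/y)^d`. -/
theorem pow_sub_pow_le_mul {x y : ℝ} (hx : 0 ≤ x) (hy : 0 < y) (d : ℕ) (hd : 1 ≤ d) :
    y ^ d - x ^ d ≤ d * y ^ (d - 1) * (y - x) := by
  have h := one_add_mul_le_pow (a := x / y - 1) (by have := div_nonneg hx hy.le; linarith) d
  rw [add_sub_cancel, div_pow, le_div_iff₀ (by positivity)] at h
  obtain ⟨e, rfl⟩ : ∃ e, d = e + 1 := ⟨d - 1, by omega⟩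
  rw [Nat.add_sub_cancel]
  have h2 : (1 + ((e + 1 : ℕ) : ℝ) * (x / y - 1)) * y ^ (e + 1)
      = y ^ (e + 1) - ((e + 1 : ℕ) : ℝ) * y ^ e * (y - x) := by
    field_simp
    ring
  linarith

theorem volume_shell_le (hd : 2 ≤ d) {R m : ℕ} (hR : 1 ≤ R) (hRm : R ^ 2 ≤ m)
    (hm : (m : ℝ) + 1 ≤ 5 * (R : ℝ) ^ 2) :
    volume.real {x : EuclideanSpace ℝ (Fin d) | (m : ℝ) < ‖x‖ ^ 2 ∧ ‖x‖ ^ 2 < m + 1}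
      ≤ volume.real (Metric.ball (0 : EuclideanSpace ℝ (Fin d)) 1)
        * (d * 3 ^ (d - 1)) * (R : ℝ) ^ (d - 2) := by
  have hR0 : (1 : ℝ) ≤ R := by exact_mod_cast hR
  have hRm' : (R : ℝ) ^ 2 ≤ m := by exact_mod_cast hRm
  have hm0 : (0 : ℝ) ≤ m := m.cast_nonneg
  set x := √(m : ℝ) with hx
  set y := √((m : ℝ) + 1) with hy
  have hx2 : x ^ 2 = m := sq_sqrt hm0
  have hy2 : y ^ 2 = m + 1 := sq_sqrt (by linarith)
  have hx0 : (R : ℝ) ≤ x := le_sqrt_of_sq_le hRm'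
  have hy0 : 0 < y := sqrt_pos.2 (by linarith)
  have hxy : x ≤ y := sqrt_le_sqrt (by linarith)
  have hy3 : y ≤ 3 * R := by
    rw [hy, sqrt_le_left (by linarith)]
    nlinarith
  -- Since `(y - x)(y + x) = 1` and `y + x ≥ R`.
  have hyx : y - x ≤ 1 / R := by
    rw [le_div_iff₀ (by linarith)]
    nlinarith
  have hsub : {z : EuclideanSpace ℝ (Fin d) | (m : ℝ) < ‖z‖ ^ 2 ∧ ‖z‖ ^ 2 < m + 1}
      ⊆ Metric.closedBall 0 y \ Metric.closedBall 0 x := fun z hz => by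
    simp only [Set.mem_sdiff, mem_closedBall_zero_iff, not_le]
    exact ⟨le_sqrt_of_sq_le hz.2.le, (sqrt_lt' (lt_of_not_ge fun h => by
      have : ‖z‖ = 0 := le_antisymm h (norm_nonneg _)
      have h1 := hz.1
      rw [this] at h1
      nlinarith)).2 hz.1⟩
  have hfin : volume (Metric.closedBall (0 : EuclideanSpace ℝ (Fin d)) y) ≠ ⊤ :=
    measure_closedBall_lt_top.ne
  refine (measureReal_mono hsub (measure_ne_top_of_subset Set.sdiff_subset hfin)).trans ?_
  rw [measureReal_sdiff (Metric.closedBall_subset_closedBall hxy) measurableSet_closedBall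
    hfin, Measure.addHaar_real_closedBall _ _ hy0.le,
    Measure.addHaar_real_closedBall _ _ (by linarith : 0 ≤ x)]
  simp only [finrank_euclideanSpace, Fintype.card_fin]
  rw [← sub_mul, mul_comm, mul_assoc]
  gcongr
  refine (pow_sub_pow_le_mul (by linarith) hy0 d (by omega)).trans ?_
  calc (d : ℝ) * y ^ (d - 1) * (y - x) ≤ d * (3 * R) ^ (d - 1) * (1 / R) := by gcongr
    _ = d * 3 ^ (d - 1) * (R : ℝ) ^ (d - 2) := by
      rw [mul_pow, show d - 1 = d - 2 + 1 by omega, pow_succ (R : ℝ)]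
      field_simp

end Shell

/-! ### The discrepancy of a Gaussian over a ball. -/

section Discrepancy

variable {d : ℕ}

theorem mem_insert_latticeBall {N : ℝ} (hN : 0 ≤ N) {n : Fin d → ℤ} :
    n ∈ insert 0 (latticeBall d N) ↔ ‖latticePoint n‖ ≤ N := by
  rw [Finset.mem_insert, latticeBall, Set.Finite.mem_toFinset, Set.mem_ofPred_eq]
  constructor
  · rintro (h | h)
    · rw [h, latticePoint_zero, norm_zero]; exact hN
    · exact h.2
  · intro h
    rcases eq_or_ne n 0 with h0 | h0
    · exact Or.inl h0
    · exact Or.inr ⟨norm_pos_iff.2 fun h1 => h0 (latticePoint_eq_zero.1 h1), h⟩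

theorem zero_notMem_latticeBall (N : ℝ) : (0 : Fin d → ℤ) ∉ latticeBall d N := by
  rw [latticeBall, Set.Finite.mem_toFinset, Set.mem_ofPred_eq, latticePoint_zero, norm_zero]
  simp

theorem continuous_quadraticForm (Q : QuadraticForm ℝ (EuclideanSpace ℝ (Fin d))) :
    Continuous fun x => Q x := by
  have h : ∀ x, Q x = QuadraticMap.associated (R := ℝ) Q x x := fun x =>
    (QuadraticMap.associated_eq_self_apply ℝ Q x).symm
  simp_rw [h]
  let L : EuclideanSpace ℝ (Fin d) →ₗ[ℝ] (EuclideanSpace ℝ (Fin d) →L[ℝ] ℝ) :=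
    LinearMap.toContinuousLinearMap.toLinearMap ∘ₗ (QuadraticMap.associated (R := ℝ) Q)
  have hL : Continuous L := L.continuous_of_finiteDimensional
  exact hL.clm_apply continuous_id

/-- The discrepancy between lattice sum and integral of `exp (-u Q)` over the ball of radius `N`. -/
def discrepancy (Q : QuadraticForm ℝ (EuclideanSpace ℝ (Fin d))) (N u : ℝ) : ℝ :=
  ∑ n ∈ insert 0 (latticeBall d N), exp (-(u * Q (latticePoint n)))
    - ∫ x in Metric.closedBall (0 : EuclideanSpace ℝ (Fin d)) N, exp (-(u * Q x))

variable {Q : QuadraticForm ℝ (EuclideanSpace ℝ (Fin d))}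

/-- No lattice point has `‖n‖²` strictly between `⌊N²⌋` and `⌊N²⌋ + 1`, so on the lattice the
continuous kernel acts as the sharp cutoff, and its `exp(δt)` cancels the damping. -/
theorem cutoff_tsum_eq {N : ℝ} (hN : 0 ≤ N) (u δ : ℝ) :
    ∑' n : Fin d → ℤ, cutoffKernel δ ⌊N ^ 2⌋₊ (‖latticePoint n‖ ^ 2)
        * ((exp (-(u * Q (latticePoint n)) - δ * ‖latticePoint n‖ ^ 2) : ℝ) : ℂ)
      = ((cutoffConst δ * ∑ n ∈ insert 0 (latticeBall d N),
        exp (-(u * Q (latticePoint n))) : ℝ) : ℂ) := by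
  rw [tsum_eq_sum (s := insert 0 (latticeBall d N)), Finset.mul_sum, Complex.ofReal_sum]
  · refine Finset.sum_congr rfl fun n hn => ?_
    rw [mem_insert_latticeBall hN] at hn
    have h1 : ‖latticePoint n‖ ^ 2 ≤ N ^ 2 := by gcongr
    have h2 : ‖latticePoint n‖ ^ 2 ≤ (⌊N ^ 2⌋₊ : ℝ) := by
      have h3 := norm_latticePoint_sq_int n
      have hpos : 0 ≤ ∑ i, (n i) ^ 2 := Finset.sum_nonneg fun i _ => sq_nonneg _
      obtain ⟨j, hj⟩ := Int.eq_ofNat_of_zero_le hpos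
      rw [hj, Int.cast_natCast] at h3
      rw [h3] at h1 ⊢
      exact_mod_cast Nat.le_floor h1
    rw [cutoffKernel_eq_exp _ _ (by positivity) h2, ← Complex.ofReal_mul, ← Complex.ofReal_mul,
      mul_assoc, ← exp_add]
    congr 3
    ring
  · intro n hn
    rw [mem_insert_latticeBall hN, not_le] at hn
    have h1 : N ^ 2 < ‖latticePoint n‖ ^ 2 := by gcongr
    have h2 : (⌊N ^ 2⌋₊ : ℝ) + 1 ≤ ‖latticePoint n‖ ^ 2 := by
      have h3 := norm_latticePoint_sq_int n
      have hpos : 0 ≤ ∑ i, (n i) ^ 2 := Finset.sum_nonneg fun i _ => sq_nonneg _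
      obtain ⟨j, hj⟩ := Int.eq_ofNat_of_zero_le hpos
      rw [hj, Int.cast_natCast] at h3
      rw [h3] at h1 ⊢
      exact_mod_cast (Nat.floor_lt (by positivity)).2 h1
    rw [cutoffKernel_eq_zero _ _ h2, zero_mul]

theorem cutoffConst_le {δ : ℝ} (hδ : 0 ≤ δ) : |cutoffConst δ| ≤ exp δ := by
  have h := norm_cutoffKernel_le hδ 0 0
  rw [cutoffKernel_eq_exp δ 0 le_rfl (by simp), mul_zero, exp_zero, Complex.ofReal_one, mul_one,
    Complex.norm_real, norm_eq_abs] at h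
  refine h.trans (exp_le_exp.2 ?_)
  norm_num
  linarith

/-- In the integral the continuous and the sharp cutoff differ only on the shell `⌊N²⌋ < ‖x‖² < ⌊N²⌋
+ 1`, where both integrands are at most `exp 5`. -/
theorem norm_cutoff_integral_sub_le (hQ : Q.PosDef) {N u δ : ℝ} (hN : 0 ≤ N) (hu : 0 ≤ u)
    (hδ : 0 ≤ δ) (hδN : δ * (⌊N ^ 2⌋₊ + 1) ≤ 5) (hi : Integrable fun x =>
      cutoffKernel δ ⌊N ^ 2⌋₊ (‖x‖ ^ 2) * ((exp (-(u * Q x) - δ * ‖x‖ ^ 2) : ℝ) : ℂ)) :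
    ‖(∫ x, cutoffKernel δ ⌊N ^ 2⌋₊ (‖x‖ ^ 2) * ((exp (-(u * Q x) - δ * ‖x‖ ^ 2) : ℝ) : ℂ))
      - ((cutoffConst δ * ∫ x in Metric.closedBall (0 : EuclideanSpace ℝ (Fin d)) N,
        exp (-(u * Q x)) : ℝ) : ℂ)‖
      ≤ 2 * exp 5 * volume.real {x : EuclideanSpace ℝ (Fin d) |
        (⌊N ^ 2⌋₊ : ℝ) < ‖x‖ ^ 2 ∧ ‖x‖ ^ 2 < ⌊N ^ 2⌋₊ + 1} := by
  set m := ⌊N ^ 2⌋₊ with hm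
  have hmN : (m : ℝ) ≤ N ^ 2 := Nat.floor_le (by positivity)
  have hNm : N ^ 2 < m + 1 := Nat.lt_floor_add_one _
  have hm0 : (0 : ℝ) ≤ m := m.cast_nonneg
  have hQ0 : ∀ x, 0 ≤ Q x := fun x => hQ.nonneg x
  have hcont : Continuous fun x => Q x := continuous_quadraticForm Q
  have hi2 : Integrable (fun x => (((Metric.closedBall (0 : EuclideanSpace ℝ (Fin d)) N).indicator
      (fun x => cutoffConst δ * exp (-(u * Q x))) x : ℝ) : ℂ)) := by
    have h : Integrable ((Metric.closedBall (0 : EuclideanSpace ℝ (Fin d)) N).indicator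
        fun x => cutoffConst δ * exp (-(u * Q x))) :=
      (integrable_indicator_iff measurableSet_closedBall).2
        ((Continuous.continuousOn (by fun_prop)).integrableOn_compact (isCompact_closedBall _ _))
    exact h.ofReal
  have h1 : ((cutoffConst δ * ∫ x in Metric.closedBall (0 : EuclideanSpace ℝ (Fin d)) N,
        exp (-(u * Q x)) : ℝ) : ℂ)
      = ∫ x, (((Metric.closedBall (0 : EuclideanSpace ℝ (Fin d)) N).indicator
      (fun x => cutoffConst δ * exp (-(u * Q x))) x : ℝ) : ℂ) := by
    rw [integral_complex_ofReal, integral_indicator measurableSet_closedBall, integral_const_mul]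
  rw [h1, ← integral_sub hi hi2]
  set S := {x : EuclideanSpace ℝ (Fin d) | (m : ℝ) < ‖x‖ ^ 2 ∧ ‖x‖ ^ 2 < m + 1} with hS
  have hS0 : ∀ x ∉ S, cutoffKernel δ m (‖x‖ ^ 2) * ((exp (-(u * Q x) - δ * ‖x‖ ^ 2) : ℝ) : ℂ)
      - (((Metric.closedBall (0 : EuclideanSpace ℝ (Fin d)) N).indicator
      (fun x => cutoffConst δ * exp (-(u * Q x))) x : ℝ) : ℂ) = 0 := fun x hx => by
    rcases le_or_gt (‖x‖ ^ 2) m with h | h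
    · have hmem : x ∈ Metric.closedBall (0 : EuclideanSpace ℝ (Fin d)) N := by
        rw [mem_closedBall_zero_iff]
        exact (sq_le_sq₀ (norm_nonneg _) hN).1 (h.trans hmN)
      rw [Set.indicator_of_mem hmem, cutoffKernel_eq_exp _ _ (by positivity) h,
        ← Complex.ofReal_mul, ← Complex.ofReal_mul, ← Complex.ofReal_sub, mul_assoc, ← exp_add,
        Complex.ofReal_eq_zero, sub_eq_zero]
      congr 2
      ring
    · have h2 : (m : ℝ) + 1 ≤ ‖x‖ ^ 2 := not_lt.1 fun h2 => hx ⟨h, h2⟩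
      have hmem : x ∉ Metric.closedBall (0 : EuclideanSpace ℝ (Fin d)) N := by
        rw [mem_closedBall_zero_iff, not_le]
        exact (sq_lt_sq₀ hN (norm_nonneg _)).1 (hNm.trans_le h2)
      rw [Set.indicator_of_notMem hmem, cutoffKernel_eq_zero _ _ h2]
      simp
  rw [← setIntegral_eq_integral_of_forall_compl_eq_zero hS0]
  have hSfin : volume S < ⊤ := by
    refine lt_of_le_of_lt (measure_mono (t := Metric.closedBall 0 (m + 1)) fun x hx => ?_)
      measure_closedBall_lt_top
    rw [mem_closedBall_zero_iff]
    nlinarith [hx.2, norm_nonneg x]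
  refine norm_setIntegral_le_of_norm_le_const hSfin fun x hx => ?_
  have b1 : ‖cutoffKernel δ m (‖x‖ ^ 2) * ((exp (-(u * Q x) - δ * ‖x‖ ^ 2) : ℝ) : ℂ)‖ ≤ exp 5 := by
    rw [norm_mul, Complex.norm_real, norm_of_nonneg (exp_pos _).le]
    have e1 : exp (-(u * Q x) - δ * ‖x‖ ^ 2) ≤ 1 := by
      rw [exp_le_one_iff]
      nlinarith [mul_nonneg hu (hQ0 x), mul_nonneg hδ (sq_nonneg ‖x‖)]
    have e2 : ‖cutoffKernel δ m (‖x‖ ^ 2)‖ ≤ exp 5 := by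
      refine (norm_cutoffKernel_le hδ m _).trans (exp_le_exp.2 ?_)
      nlinarith
    calc _ ≤ exp 5 * 1 := by gcongr
      _ = _ := mul_one _
  have b2 : ‖(((Metric.closedBall (0 : EuclideanSpace ℝ (Fin d)) N).indicator
      (fun x => cutoffConst δ * exp (-(u * Q x))) x : ℝ) : ℂ)‖ ≤ exp 5 := by
    rw [Complex.norm_real]
    refine (norm_indicator_le_norm_self _ _).trans ?_
    rw [norm_mul, norm_eq_abs, norm_of_nonneg (exp_pos _).le]
    have e1 : exp (-(u * Q x)) ≤ 1 := by
      rw [exp_le_one_iff]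
      nlinarith [mul_nonneg hu (hQ0 x)]
    have e2 : |cutoffConst δ| ≤ exp 5 := by
      refine (cutoffConst_le hδ).trans (exp_le_exp.2 ?_)
      nlinarith
    calc _ ≤ exp 5 * 1 := by gcongr
      _ = _ := mul_one _
  refine (norm_sub_le _ _).trans ?_
  linarith

/-- The discrepancy is of order `N ^ (d - 2 + ε)`, with polynomial dependence on `u N²`. -/
theorem exists_abs_discrepancy_le (hd : 4 ≤ d) (hQ : Q.PosDef) {η : ℝ} (hη : 0 < η)
    (hη1 : η ≤ 1) : ∃ C : ℝ, 0 ≤ C ∧ ∀ N u : ℝ, 2 ≤ N → 0 < u →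
      |discrepancy Q N u| ≤ C * ((1 + u * N ^ 2) ^ (2 * d + 1) * N ^ (d - 2) * N ^ (2 * η)) := by
  obtain ⟨b, lam, hlam, hdiag⟩ := exists_orthonormalBasis_diagonal hQ
  obtain ⟨κ, Λ, hκ, hΛ0, -, hΛ⟩ := exists_bounds_diagonal hlam
  obtain ⟨C, hC, hmain⟩ := exists_norm_cutoff_sub_le b hd hη hη1
  set V := volume.real (Metric.ball (0 : EuclideanSpace ℝ (Fin d)) 1) with hV
  have hV0 : 0 ≤ V := measureReal_nonneg
  refine ⟨exp 1 * (C * (1 + Λ) ^ (2 * d + 1) + 2 * exp 5 * (V * (d * 3 ^ (d - 1)))),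
    by positivity, fun N u hN hu => ?_⟩
  have hN0 : 0 ≤ N := by linarith
  set R := ⌊N⌋₊ with hR
  set m := ⌊N ^ 2⌋₊ with hm
  have hR2 : 2 ≤ R := Nat.le_floor (by exact_mod_cast hN)
  have hR2' : (2 : ℝ) ≤ R := by exact_mod_cast hR2
  have hRN : (R : ℝ) ≤ N := Nat.floor_le hN0
  have hNR : N < R + 1 := Nat.lt_floor_add_one _
  have hmN : (m : ℝ) ≤ N ^ 2 := Nat.floor_le (by positivity)
  have hRm : R ^ 2 ≤ m := Nat.le_floor (by push_cast; gcongr)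
  -- From `N < R + 1` and `2 ≤ R`.
  have hm5 : (m : ℝ) + 1 ≤ 5 * (R : ℝ) ^ 2 := by nlinarith
  set δ : ℝ := 1 / (R : ℝ) ^ 2 with hδ
  have hδ0 : 0 ≤ δ := by positivity
  have hδ1 : δ ≤ 1 := by
    rw [hδ, div_le_one (by positivity)]
    nlinarith
  -- Chosen so that `L/R² = uΛ + δ` bounds all diagonal entries `u lam k + δ`.
  set L : ℝ := 1 + u * Λ * (R : ℝ) ^ 2 with hL
  have hL1 : 1 ≤ L := by
    have : 0 ≤ u * Λ * (R : ℝ) ^ 2 := by positivity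
    linarith
  have hA1 : ∀ k, 1 / (R : ℝ) ^ 2 ≤ u * lam k + δ := fun k => by
    have := mul_pos hu (hlam k)
    linarith
  have hA2 : ∀ k, u * lam k + δ ≤ L / (R : ℝ) ^ 2 := fun k => by
    have : L / (R : ℝ) ^ 2 = u * Λ + δ := by rw [hL, hδ]; field_simp; ring
    rw [this]
    have := hΛ k
    gcongr
  have h1 := hmain (fun k => u * lam k + δ) L R m hL1 hR2 hm5 hA1 hA2
  simp_rw [gauss_eq_exp hdiag] at h1
  rw [cutoff_tsum_eq hN0] at h1
  have hi : Integrable fun x =>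
      cutoffKernel δ m (‖x‖ ^ 2) * ((exp (-(u * Q x) - δ * ‖x‖ ^ 2) : ℝ) : ℂ) := by
    have := integrable_gauss b (a := fun k => ((u * lam k + δ : ℝ) : ℂ)) (fun k => by
      rw [Complex.ofReal_re]
      exact lt_of_lt_of_le (by positivity) (hA1 k)) 0
    simp_rw [show gauss b (fun k => ((u * lam k + δ : ℝ) : ℂ)) 0 = _ from
      funext (gauss_eq_exp hdiag u δ)] at this
    refine this.bdd_mul (c := exp (δ * (m + 1 / 2))) ?_
      (Eventually.of_forall fun x => norm_cutoffKernel_le hδ0 m _)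
    exact ((continuous_cutoffKernel δ m).comp (by fun_prop)).aestronglyMeasurable
  have h2 := norm_cutoff_integral_sub_le hQ hN0 hu.le hδ0 (by
    rw [hδ, one_div_mul_eq_div, div_le_iff₀ (by positivity)]; exact hm5) hi
  have h3 := volume_shell_le (d := d) (by omega) (by omega : 1 ≤ R) hRm hm5
  set c := cutoffConst δ with hc
  have h4 : ‖((c * discrepancy Q N u : ℝ) : ℂ)‖
      ≤ C * (L ^ (2 * d + 1) * (R : ℝ) ^ (d - 2) * (R : ℝ) ^ (2 * η))
        + 2 * exp 5 * (V * (d * 3 ^ (d - 1)) * (R : ℝ) ^ (d - 2)) := by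
    have e : ((c * discrepancy Q N u : ℝ) : ℂ)
        = (((c * ∑ n ∈ insert 0 (latticeBall d N), exp (-(u * Q (latticePoint n))) : ℝ) : ℂ)
          - ∫ x, cutoffKernel δ m (‖x‖ ^ 2) * ((exp (-(u * Q x) - δ * ‖x‖ ^ 2) : ℝ) : ℂ))
        + ((∫ x, cutoffKernel δ m (‖x‖ ^ 2) * ((exp (-(u * Q x) - δ * ‖x‖ ^ 2) : ℝ) : ℂ))
          - ((c * ∫ x in Metric.closedBall (0 : EuclideanSpace ℝ (Fin d)) N,
            exp (-(u * Q x)) : ℝ) : ℂ)) := by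
      rw [discrepancy, mul_sub]
      push_cast
      ring
    rw [e]
    refine (norm_add_le _ _).trans (add_le_add h1 (h2.trans ?_))
    gcongr
  -- The normalizing constant stays above `exp(-1)` and can be divided out.
  have hc1 : 1 ≤ exp 1 * c := by
    have h5 := le_cutoffConst hδ0
    have h6 : exp (-1) ≤ exp (-δ) := exp_le_exp.2 (by linarith)
    calc (1 : ℝ) = exp 1 * exp (-1) := by rw [← exp_add]; simp
      _ ≤ exp 1 * c := by gcongr; exact h6.trans h5
  have hc0 : 0 < c := by
    have := exp_pos 1
    by_contra h
    nlinarith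
  rw [Complex.norm_real, norm_mul, norm_of_nonneg hc0.le, norm_eq_abs] at h4
  have hLu : L ≤ (1 + Λ) * (1 + u * N ^ 2) := by
    have : u * Λ * (R : ℝ) ^ 2 ≤ u * Λ * N ^ 2 := by gcongr
    have h7 : 0 ≤ u * N ^ 2 := by positivity
    nlinarith
  have hu1 : 1 ≤ 1 + u * N ^ 2 := by
    have : 0 ≤ u * N ^ 2 := by positivity
    linarith
  set Y := (1 + u * N ^ 2) ^ (2 * d + 1) * N ^ (d - 2) * N ^ (2 * η) with hY
  have hNη : 1 ≤ N ^ (2 * η) := one_le_rpow (by linarith) (by linarith)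
  have hY1 : L ^ (2 * d + 1) * (R : ℝ) ^ (d - 2) * (R : ℝ) ^ (2 * η)
      ≤ (1 + Λ) ^ (2 * d + 1) * Y := by
    calc _ ≤ ((1 + Λ) * (1 + u * N ^ 2)) ^ (2 * d + 1) * N ^ (d - 2) * N ^ (2 * η) := by gcongr
      _ = _ := by rw [hY, mul_pow]; ring
  have hY2 : (R : ℝ) ^ (d - 2) ≤ Y := by
    calc (R : ℝ) ^ (d - 2) ≤ N ^ (d - 2) := by gcongr
      _ = 1 * N ^ (d - 2) * 1 := by ring
      _ ≤ Y := by
        rw [hY]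
        gcongr
        exact one_le_pow₀ hu1
  calc |discrepancy Q N u| = 1 * |discrepancy Q N u| := (one_mul _).symm
    _ ≤ (exp 1 * c) * |discrepancy Q N u| := by gcongr
    _ = exp 1 * (c * |discrepancy Q N u|) := by ring
    _ ≤ exp 1 * (C * ((1 + Λ) ^ (2 * d + 1) * Y) + 2 * exp 5 * (V * (d * 3 ^ (d - 1)) * Y)) := by
      gcongr
      refine h4.trans ?_
      gcongr
    _ = _ := by ring

end Discrepancy

/-! ### The theta series and its asymptotics. -/

section Theta

variable {d : ℕ}

/-- The theta series of a quadratic form. -/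
def thetaSeries (Q : QuadraticForm ℝ (EuclideanSpace ℝ (Fin d))) (u : ℝ) : ℝ :=
  ∑' n : Fin d → ℤ, exp (-(u * Q (latticePoint n)))

/-- The Gaussian integral of a quadratic form. -/
def gaussIntegral (Q : QuadraticForm ℝ (EuclideanSpace ℝ (Fin d))) (u : ℝ) : ℝ :=
  ∫ x : EuclideanSpace ℝ (Fin d), exp (-(u * Q x))

variable {Q : QuadraticForm ℝ (EuclideanSpace ℝ (Fin d))}

theorem exists_le_quadraticForm (hQ : Q.PosDef) : ∃ κ : ℝ, 0 < κ ∧ ∀ x, κ * ‖x‖ ^ 2 ≤ Q x := by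
  obtain ⟨b, lam, hlam, hdiag⟩ := exists_orthonormalBasis_diagonal hQ
  obtain ⟨κ, -, hκ, -, hk, -⟩ := exists_bounds_diagonal hlam
  refine ⟨κ, hκ, fun x => ?_⟩
  rw [hdiag, ← sum_repr_sq b, Finset.mul_sum]
  exact Finset.sum_le_sum fun k _ => mul_le_mul_of_nonneg_right (hk k) (sq_nonneg _)

variable {κ : ℝ}

theorem exp_neg_le_of_le (hk : ∀ x, κ * ‖x‖ ^ 2 ≤ Q x) {u : ℝ} (hu : 0 < u) (x : EuclideanSpace ℝ (Fin d)) :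
    exp (-(u * Q x)) ≤ exp (-(u * κ) * ‖x‖ ^ 2) := by
  refine exp_le_exp.2 ?_
  nlinarith [mul_le_mul_of_nonneg_left (hk x) hu.le]

theorem summable_exp_neg_form (hκ : 0 < κ) (hk : ∀ x, κ * ‖x‖ ^ 2 ≤ Q x) {u : ℝ} (hu : 0 < u) :
    Summable fun n : Fin d → ℤ => exp (-(u * Q (latticePoint n))) :=
  .of_nonneg_of_le (fun _ => (exp_pos _).le) (fun n => exp_neg_le_of_le hk hu (latticePoint n))
    (summable_exp_neg_norm_sq d (by positivity : 0 < u * κ))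

theorem integrable_exp_neg_norm_sq (d : ℕ) {c : ℝ} (hc : 0 < c) :
    Integrable fun x : EuclideanSpace ℝ (Fin d) => exp (-c * ‖x‖ ^ 2) := by
  have := integrable_of_gaussian_bound (d := d) (f := fun x => ((exp (-c * ‖x‖ ^ 2) : ℝ) : ℂ))
    (C := 1) (by fun_prop) hc (fun x => by
      rw [Complex.norm_real, norm_of_nonneg (exp_pos _).le, one_mul])
  exact this.re

theorem integrable_exp_neg_form (hκ : 0 < κ) (hk : ∀ x, κ * ‖x‖ ^ 2 ≤ Q x) {u : ℝ} (hu : 0 < u) :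
    Integrable fun x : EuclideanSpace ℝ (Fin d) => exp (-(u * Q x)) := by
  have hcont : Continuous fun x => Q x := continuous_quadraticForm Q
  refine (integrable_exp_neg_norm_sq d (by positivity : 0 < u * κ)).mono'
    (Continuous.aestronglyMeasurable (by fun_prop)) (Eventually.of_forall fun x => ?_)
  rw [norm_of_nonneg (exp_pos _).le]
  exact exp_neg_le_of_le hk hu x

theorem tsum_indicator_exp_neg_form_le (hκ : 0 < κ) (hk : ∀ x, κ * ‖x‖ ^ 2 ≤ Q x)
    {u : ℝ} (hu : 0 < u) (S : Set (Fin d → ℤ)) {M : ℝ}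
    (hS : ∀ n ∈ S, M ≤ ‖latticePoint n‖ ^ 2) :
    ∑' n : Fin d → ℤ, S.indicator (fun n => exp (-(u * Q (latticePoint n)))) n
      ≤ exp (-(u * κ) * M / 2) * (2 * exp 1 * (1 + 1 / √(u * κ / 2))) ^ d := by
  have huκ : 0 < u * κ := by positivity
  refine le_trans (Summable.tsum_le_tsum (fun n => ?_)
    ((summable_exp_neg_form hκ hk hu).indicator S)
    ((summable_exp_neg_norm_sq d huκ).indicator S))
    (tsum_indicator_exp_neg_norm_sq_le d huκ S hS)
  exact Set.indicator_le_indicator (exp_neg_le_of_le hk hu _)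

theorem thetaSeries_sub_one_eq (hκ : 0 < κ) (hk : ∀ x, κ * ‖x‖ ^ 2 ≤ Q x)
    {u : ℝ} (hu : 0 < u) : thetaSeries Q u - 1
    = ∑' n : Fin d → ℤ, ({0}ᶜ : Set (Fin d → ℤ)).indicator
      (fun n => exp (-(u * Q (latticePoint n)))) n := by
  classical
  rw [thetaSeries, (summable_exp_neg_form hκ hk hu).tsum_eq_add_tsum_ite 0, latticePoint_zero,
    map_zero, mul_zero, neg_zero, exp_zero, add_sub_cancel_left]
  refine tsum_congr fun n => ?_
  by_cases h : n = 0 <;> simp [h]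

theorem exists_abs_thetaSeries_sub_one_le (hκ : 0 < κ) (hk : ∀ x, κ * ‖x‖ ^ 2 ≤ Q x) :
    ∃ C : ℝ, 0 ≤ C ∧ ∀ u : ℝ, 1 ≤ u →
    |thetaSeries Q u - 1| ≤ C * exp (-(κ / 2) * u) := by
  refine ⟨(2 * exp 1 * (1 + 1 / √(1 * κ / 2))) ^ d, by positivity, fun u hu => ?_⟩
  have hu0 : 0 < u := by linarith
  rw [thetaSeries_sub_one_eq hκ hk hu0, abs_of_nonneg
    (tsum_nonneg fun n => Set.indicator_nonneg (fun _ _ => (exp_pos _).le) _)]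
  refine (tsum_indicator_exp_neg_form_le hκ hk hu0 _ (M := 1)
    fun n hn => one_le_norm_latticePoint_sq (by simpa using hn)).trans ?_
  rw [mul_comm]
  have : exp (-(u * κ) * 1 / 2) = exp (-(κ / 2) * u) := by congr 1; ring
  rw [this]
  gcongr

/-- The tails of the lattice sum and of the integral beyond radius `N`. -/
theorem exists_abs_discrepancy_sub_le (hκ : 0 < κ) (hk : ∀ x, κ * ‖x‖ ^ 2 ≤ Q x) :
    ∃ C : ℝ, 0 ≤ C ∧ ∀ N u : ℝ, 0 ≤ N → 0 < u →
    |discrepancy Q N u - (thetaSeries Q u - gaussIntegral Q u)|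
      ≤ C * (exp (-(κ / 2) * (u * N ^ 2)) * (1 + 1 / √u) ^ d) := by
  set c : ℝ := 1 + 1 / √(κ / 2) with hc
  have hκ2 : 0 < √(κ / 2) := sqrt_pos.2 (by positivity)
  refine ⟨(2 * exp 1 * c) ^ d + (√π * c) ^ d, by positivity, fun N u hN hu => ?_⟩
  have hs := summable_exp_neg_form hκ hk hu
  have hi := integrable_exp_neg_form hκ hk hu
  set B := Metric.closedBall (0 : EuclideanSpace ℝ (Fin d)) N with hB
  set F := insert 0 (latticeBall d N) with hF
  have hsu : 0 < √u := sqrt_pos.2 hu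
  have hsq : √(u * κ / 2) = √u * √(κ / 2) := by
    rw [mul_div_assoc, sqrt_mul hu.le]
  have h1 : 1 / √(u * κ / 2) ≤ c * (1 + 1 / √u) := by
    rw [hsq, hc]
    have e1 : 1 / (√u * √(κ / 2)) = (1 / √(κ / 2)) * (1 / √u) := by field_simp
    rw [e1]
    have p1 : 0 < 1 / √(κ / 2) := by positivity
    have p2 : 0 < 1 / √u := by positivity
    nlinarith
  have h2 : 1 + 1 / √(u * κ / 2) ≤ c * (1 + 1 / √u) := by
    rw [hsq, hc]
    have e1 : 1 / (√u * √(κ / 2)) = (1 / √(κ / 2)) * (1 / √u) := by field_simp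
    rw [e1]
    have p1 : 0 < 1 / √(κ / 2) := by positivity
    have p2 : 0 < 1 / √u := by positivity
    nlinarith
  have hsum : thetaSeries Q u - ∑ n ∈ F, exp (-(u * Q (latticePoint n)))
      = ∑' n : Fin d → ℤ, ((F : Set (Fin d → ℤ))ᶜ).indicator
        (fun n => exp (-(u * Q (latticePoint n)))) n := by
    rw [thetaSeries, ← hs.sum_add_tsum_compl (s := F), add_sub_cancel_left]
    exact tsum_subtype ((F : Set (Fin d → ℤ))ᶜ) fun n => exp (-(u * Q (latticePoint n)))
  have hint : gaussIntegral Q u - ∫ x in B, exp (-(u * Q x)) = ∫ x in Bᶜ, exp (-(u * Q x)) := by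
    rw [gaussIntegral, ← integral_add_compl (s := B) measurableSet_closedBall hi,
      add_sub_cancel_left]
  have e : discrepancy Q N u - (thetaSeries Q u - gaussIntegral Q u)
      = (∫ x in Bᶜ, exp (-(u * Q x))) - ∑' n : Fin d → ℤ, ((F : Set (Fin d → ℤ))ᶜ).indicator
        (fun n => exp (-(u * Q (latticePoint n)))) n := by
    rw [← hsum, ← hint, discrepancy]
    ring
  have hexp : exp (-(u * κ) * N ^ 2 / 2) = exp (-(κ / 2) * (u * N ^ 2)) := by congr 1; ring
  have hA0 : 0 ≤ ∑' n : Fin d → ℤ, ((F : Set (Fin d → ℤ))ᶜ).indicator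
        (fun n => exp (-(u * Q (latticePoint n)))) n :=
    tsum_nonneg fun n => Set.indicator_nonneg (fun _ _ => (exp_pos _).le) _
  have hA : ∑' n : Fin d → ℤ, ((F : Set (Fin d → ℤ))ᶜ).indicator
        (fun n => exp (-(u * Q (latticePoint n)))) n
      ≤ (2 * exp 1 * c) ^ d * (exp (-(κ / 2) * (u * N ^ 2)) * (1 + 1 / √u) ^ d) := by
    refine (tsum_indicator_exp_neg_form_le hκ hk hu _ (M := N ^ 2) fun n hn => ?_).trans ?_
    · rw [Set.mem_compl_iff, Finset.mem_coe, hF, mem_insert_latticeBall hN, not_le] at hn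
      gcongr
    · rw [hexp]
      calc _ ≤ exp (-(κ / 2) * (u * N ^ 2)) * (2 * exp 1 * (c * (1 + 1 / √u))) ^ d := by gcongr
        _ = _ := by rw [← mul_assoc (2 * exp 1) c, mul_pow]; ring
  have hI0 : 0 ≤ ∫ x in Bᶜ, exp (-(u * Q x)) := integral_nonneg fun _ => (exp_pos _).le
  have hI : ∫ x in Bᶜ, exp (-(u * Q x))
      ≤ (√π * c) ^ d * (exp (-(κ / 2) * (u * N ^ 2)) * (1 + 1 / √u) ^ d) := by
    have hg := integrable_exp_neg_norm_sq d (by positivity : 0 < u * κ / 2)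
    calc ∫ x in Bᶜ, exp (-(u * Q x))
        ≤ ∫ x in Bᶜ, exp (-(κ / 2) * (u * N ^ 2)) * exp (-(u * κ / 2) * ‖x‖ ^ 2) := by
          refine setIntegral_mono_on hi.integrableOn (hg.const_mul _).integrableOn
            measurableSet_closedBall.compl fun x hx => ?_
          refine (exp_neg_le_of_le hk hu x).trans ?_
          rw [← exp_add]
          apply exp_le_exp.2
          rw [hB, Set.mem_compl_iff, mem_closedBall_zero_iff, not_le] at hx
          have : N ^ 2 ≤ ‖x‖ ^ 2 := by gcongr
          have := mul_le_mul_of_nonneg_left this (by positivity : 0 ≤ u * κ)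
          linarith
      _ ≤ ∫ x, exp (-(κ / 2) * (u * N ^ 2)) * exp (-(u * κ / 2) * ‖x‖ ^ 2) :=
          setIntegral_le_integral (hg.const_mul _) (Eventually.of_forall fun x => by positivity)
      _ = exp (-(κ / 2) * (u * N ^ 2)) * (√π * (1 / √(u * κ / 2))) ^ d := by
          rw [integral_const_mul, GaussianFourier.integral_rexp_neg_mul_sq_norm (by positivity)]
          congr 1
          rw [finrank_euclideanSpace, Fintype.card_fin, mul_one_div, ← sqrt_div pi_pos.le,
            sqrt_eq_rpow, ← rpow_natCast, ← rpow_mul (by positivity)]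
          congr 1
          ring
      _ ≤ exp (-(κ / 2) * (u * N ^ 2)) * (√π * (c * (1 + 1 / √u))) ^ d := by gcongr
      _ = _ := by rw [← mul_assoc √π c, mul_pow]; ring
  rw [e, add_mul]
  exact abs_le.2 ⟨by linarith [mul_nonneg (by positivity : 0 ≤ (√π * c) ^ d) (by positivity :
    0 ≤ exp (-(κ / 2) * (u * N ^ 2)) * (1 + 1 / √u) ^ d)], by
    linarith [mul_nonneg (by positivity : 0 ≤ (2 * exp 1 * c) ^ d) (by positivity :
    0 ≤ exp (-(κ / 2) * (u * N ^ 2)) * (1 + 1 / √u) ^ d)]⟩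

/-- Scaling `x` by `√u`. -/
theorem gaussIntegral_eq {u : ℝ} (hu : 0 < u) :
    gaussIntegral Q u = gaussIntegral Q 1 * u ^ (-((d : ℝ) / 2)) := by
  have h := Measure.integral_comp_smul (volume : Measure (EuclideanSpace ℝ (Fin d)))
    (fun x => exp (-(1 * Q x))) √u
  have e : ∀ x : EuclideanSpace ℝ (Fin d), Q (√u • x) = u * Q x := fun x => by
    rw [QuadraticMap.map_smul, smul_eq_mul, mul_self_sqrt hu.le]
  simp_rw [e, one_mul] at h
  rw [gaussIntegral, gaussIntegral, h, finrank_euclideanSpace, Fintype.card_fin, smul_eq_mul,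
    abs_of_nonneg (by positivity), mul_comm]
  simp only [one_mul]
  congr 1
  rw [sqrt_eq_rpow, ← rpow_natCast, ← rpow_mul hu.le, ← rpow_neg hu.le]
  congr 1
  ring

/-- The theta series agrees with the Gaussian integral to infinite order as `u → 0`. -/
theorem exists_abs_thetaSeries_sub_gaussIntegral_le (hQ : Q.PosDef) (K : ℕ) :
    ∃ C : ℝ, 0 ≤ C ∧ ∀ u : ℝ, 0 < u → u ≤ 1 →
      |thetaSeries Q u - gaussIntegral Q u| ≤ C * u ^ K := by
  obtain ⟨b, lam, hlam, hdiag⟩ := exists_orthonormalBasis_diagonal hQ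
  obtain ⟨κ, Λ, hκ, hΛ0, hk, hΛ⟩ := exists_bounds_diagonal hlam
  set P : ℝ := (2 * exp 1 * (1 + 1 / √(π ^ 2 * Λ⁻¹ / 2))) ^ d with hP
  refine ⟨√(π / κ) ^ d * ((K + d).factorial / (π ^ 2 * Λ⁻¹ / 2) ^ (K + d) * P), by positivity,
    fun u hu hu1 => ?_⟩
  have hg : ∀ x, gauss b (fun k => ((u * lam k + 0 : ℝ) : ℂ)) 0 x = ((exp (-(u * Q x)) : ℝ) : ℂ) :=
    fun x => by rw [gauss_eq_exp hdiag]; simp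
  have hre : ∀ k, 0 < ((u * lam k + 0 : ℝ) : ℂ).re := fun k => by
    rw [Complex.ofReal_re, add_zero]
    exact mul_pos hu (hlam k)
  have h := norm_tsum_gauss_sub_integral_le b hre (ρ := (u * Λ)⁻¹) (by positivity) fun k => by
    rw [← Complex.ofReal_inv, Complex.ofReal_re, add_zero]
    have := hlam k
    have := hΛ k
    gcongr
  simp_rw [hg] at h
  rw [← Complex.ofReal_tsum, integral_complex_ofReal, ← Complex.ofReal_sub, Complex.norm_real,
    norm_eq_abs] at h
  refine h.trans ?_
  have h1 : ∏ k, √(π / ‖((u * lam k + 0 : ℝ) : ℂ)‖) ≤ (√(π / κ) * u⁻¹) ^ d := by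
    refine prod_le_pow_of_le (fun _ => sqrt_nonneg _) fun k => ?_
    have hkk := hk k
    rw [Complex.norm_real, add_zero, norm_of_nonneg (by have := hlam k; positivity)]
    calc √(π / (u * lam k)) ≤ √(π / κ * (u⁻¹) ^ 2) := by
          apply sqrt_le_sqrt
          calc π / (u * lam k) ≤ π / (u * κ) := by gcongr
            _ = π / κ * (u⁻¹ * 1) := by field_simp
            _ ≤ π / κ * (u⁻¹ * u⁻¹) := by
              gcongr
              exact (one_le_inv₀ hu).2 hu1
            _ = _ := by ring
      _ = _ := by rw [sqrt_mul (by positivity), sqrt_sq (by positivity)]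
  set y : ℝ := π ^ 2 * Λ⁻¹ / 2 with hy
  have hy0 : 0 < y := by positivity
  have hyu : π ^ 2 * (u * Λ)⁻¹ / 2 = y / u := by rw [hy]; field_simp
  -- Of the `K + d` powers of `u`, `d` pay for the crude bound `u^(-d)` on the prefactor of the
  -- transform.
  have h2 : exp (-(π ^ 2 * (u * Λ)⁻¹) / 2) ≤ (K + d).factorial / y ^ (K + d) * u ^ (K + d) := by
    have e : -(π ^ 2 * (u * Λ)⁻¹) / 2 = -(y / u) := by rw [← hyu]; ring
    rw [e, exp_neg, inv_le_comm₀ (exp_pos _) (by positivity)]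
    refine le_trans (le_of_eq ?_) (Real.pow_div_factorial_le_exp (y / u) (by positivity) (K + d))
    clear_value y
    rw [div_pow]
    field_simp
  have h3 : (2 * exp 1 * (1 + 1 / √(π ^ 2 * (u * Λ)⁻¹ / 2))) ^ d ≤ P := by
    rw [hP, hyu]
    gcongr
    rw [le_div_iff₀ hu]
    nlinarith
  calc _ ≤ (√(π / κ) * u⁻¹) ^ d * (((K + d).factorial / y ^ (K + d) * u ^ (K + d)) * P) := by
        gcongr
    _ = √(π / κ) ^ d * ((K + d).factorial / y ^ (K + d) * P) * u ^ K * (u⁻¹ ^ d * u ^ d) := by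
        rw [mul_pow, pow_add u]
        ring
    _ = _ := by
        rw [← mul_pow, inv_mul_cancel₀ hu.ne', one_pow, mul_one]

end Theta

theorem exists_exp_neg_mul_le {a : ℝ} (ha : 0 < a) (m : ℕ) : ∃ C : ℝ, 0 ≤ C ∧ ∀ x : ℝ, 0 ≤ x →
    exp (-a * x) ≤ C * ((1 + x) ^ m)⁻¹ := by
  refine ⟨exp a * (m.factorial / a ^ m), by positivity, fun x hx => ?_⟩
  have h := Real.pow_div_factorial_le_exp (a * (1 + x)) (by positivity) m
  have e : exp (-a * x) = exp a * (exp (a * (1 + x)))⁻¹ := by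
    rw [← exp_neg, ← exp_add]
    congr 1
    ring
  rw [e, mul_assoc]
  gcongr
  rw [inv_le_comm₀ (exp_pos _) (by positivity)]
  refine le_trans (le_of_eq ?_) h
  rw [mul_pow]
  field_simp

/-! ### A discrepancy bound uniform in `u`. -/

section Combined

variable {d : ℕ} {Q : QuadraticForm ℝ (EuclideanSpace ℝ (Fin d))}

/-- The two regimes meet at `u N² = N^ε`. Below, the circle method bound loses only a small power of
`N` from the factors `1 + u N²`; above, the Gaussian tail is smaller than any power of `N`. The
decay in `u N²` makes the Mellin integral converge. -/
theorem exists_abs_discrepancy_sub_theta_le (hd : 4 ≤ d) (hQ : Q.PosDef) (J : ℕ) {η : ℝ}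
    (hη : 0 < η) (hη1 : η ≤ 1) : ∃ C : ℝ, 0 ≤ C ∧ ∀ N u : ℝ, 2 ≤ N → 0 < u →
    |discrepancy Q N u - (thetaSeries Q u - gaussIntegral Q u)|
      ≤ C * (N ^ (d - 2) * N ^ (3 * η) * ((1 + u * N ^ 2) ^ J)⁻¹) := by
  obtain ⟨C₁, hC₁, hmain⟩ := exists_abs_discrepancy_le hd hQ hη hη1
  obtain ⟨C₂, hC₂, htheta⟩ := exists_abs_thetaSeries_sub_gaussIntegral_le hQ 0
  obtain ⟨κ, hκ, hk⟩ := exists_le_quadraticForm hQ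
  obtain ⟨C₃, hC₃, htail⟩ := exists_abs_discrepancy_sub_le hκ hk
  -- The loss `2d + 1` of the circle method plus the wanted decay `J`; with `ε = η/q` one has `(1 +
  -- u N²)^q ≤ 2^q N^η` in the first regime.
  set q : ℕ := 2 * d + 1 + J with hq
  have hq1 : (1 : ℝ) ≤ q := by
    rw [hq]
    push_cast
    have : (0 : ℝ) ≤ d := by positivity
    have : (0 : ℝ) ≤ J := by positivity
    linarith
  set ε : ℝ := η / q with hε
  have hε0 : 0 < ε := by positivity
  have hε1 : ε ≤ 1 := by
    rw [hε, div_le_one (by positivity)]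
    linarith
  -- In the second regime `P` extra powers of `1 + u N² ≥ N^ε` save `N²`, reducing the trivial `N^d`
  -- to `N^(d-2)`.
  obtain ⟨P, hP⟩ := exists_nat_ge (2 / ε)
  rw [div_le_iff₀ hε0] at hP
  obtain ⟨C₄, hC₄, hexp⟩ := exists_exp_neg_mul_le (by positivity : 0 < κ / 2) (J + P)
  refine ⟨(C₁ + C₂) * 2 ^ q + C₃ * (C₄ * 2 ^ d), by positivity, fun N u hN hu => ?_⟩
  have hN0 : 0 < N := by linarith
  have hN1 : 1 ≤ N := by linarith
  have hx0 : 0 < u * N ^ 2 := by positivity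
  rw [add_mul]
  rcases le_or_gt (u * N ^ 2) (N ^ ε) with hx | hx
  · refine le_trans ?_ (le_add_of_nonneg_right (by positivity))
    have hNε : 1 ≤ N ^ ε := one_le_rpow hN1 hε0.le
    have hu1 : u ≤ 1 := by
      have h1 : N ^ ε ≤ N ^ 2 := by
        calc N ^ ε ≤ N ^ (1 : ℝ) := rpow_le_rpow_of_exponent_le hN1 hε1
          _ = N := rpow_one N
          _ ≤ N ^ 2 := by nlinarith
      by_contra! h
      nlinarith [(by positivity : 0 < N ^ 2)]
    have h1 := hmain N u hN hu
    have h2 := htheta u hu hu1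
    rw [pow_zero, mul_one] at h2
    have hB : 1 ≤ (1 + u * N ^ 2) ^ (2 * d + 1) * N ^ (d - 2) * N ^ (2 * η) :=
      one_le_mul_of_one_le_of_one_le (one_le_mul_of_one_le_of_one_le
        (one_le_pow₀ (by linarith)) (one_le_pow₀ hN1)) (one_le_rpow hN1 (by positivity))
    have hpow : (1 + u * N ^ 2) ^ q ≤ 2 ^ q * N ^ η := by
      calc (1 + u * N ^ 2) ^ q ≤ (2 * N ^ ε) ^ q := by gcongr; linarith
        _ = _ := by
          rw [mul_pow, ← rpow_natCast (N ^ ε), ← rpow_mul hN0.le, hε, div_mul_cancel₀]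
          positivity
    calc |discrepancy Q N u - (thetaSeries Q u - gaussIntegral Q u)|
        ≤ |discrepancy Q N u| + |thetaSeries Q u - gaussIntegral Q u| := abs_sub _ _
      _ ≤ C₁ * ((1 + u * N ^ 2) ^ (2 * d + 1) * N ^ (d - 2) * N ^ (2 * η))
          + C₂ * ((1 + u * N ^ 2) ^ (2 * d + 1) * N ^ (d - 2) * N ^ (2 * η)) :=
        add_le_add h1 (h2.trans (le_mul_of_one_le_right hC₂ hB))
      _ = (C₁ + C₂) * ((1 + u * N ^ 2) ^ q * (N ^ (d - 2) * N ^ (2 * η))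
          * ((1 + u * N ^ 2) ^ J)⁻¹) := by
        rw [hq, pow_add _ _ J]
        field_simp
      _ ≤ (C₁ + C₂) * ((2 ^ q * N ^ η) * (N ^ (d - 2) * N ^ (2 * η))
          * ((1 + u * N ^ 2) ^ J)⁻¹) := by gcongr
      _ = _ := by
        have : N ^ (3 * η) = N ^ η * N ^ (2 * η) := by
          rw [← rpow_add hN0]
          congr 1
          ring
        rw [this]
        ring
  · refine le_trans ?_ (le_add_of_nonneg_left (by positivity))
    have hNε : 1 ≤ N ^ ε := one_le_rpow hN1 hε0.le
    -- Here `u N² > N^ε ≥ 1`, so `u` is not below `N⁻²`.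
    have hsu : 1 + 1 / √u ≤ 2 * N := by
      have : 1 / √u ≤ N := by
        rw [one_div_le (sqrt_pos.2 hu) hN0]
        apply le_sqrt_of_sq_le
        rw [div_pow, one_pow, div_le_iff₀ (by positivity)]
        linarith
      linarith
    have hdecay : ((1 + u * N ^ 2) ^ P)⁻¹ ≤ (N ^ 2)⁻¹ := by
      gcongr
      calc N ^ 2 = N ^ (2 : ℝ) := by norm_cast
        _ ≤ N ^ (ε * P) := rpow_le_rpow_of_exponent_le hN1 (by linarith)
        _ = (N ^ ε) ^ P := by rw [rpow_mul hN0.le, rpow_natCast]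
        _ ≤ _ := by gcongr; linarith
    have hdN : (2 * N) ^ d * (N ^ 2)⁻¹ = 2 ^ d * N ^ (d - 2) := by
      obtain ⟨m, rfl⟩ : ∃ m, d = m + 2 := ⟨d - 2, by omega⟩
      rw [Nat.add_sub_cancel, mul_pow, pow_add N]
      field_simp
    calc |discrepancy Q N u - (thetaSeries Q u - gaussIntegral Q u)|
        ≤ C₃ * (exp (-(κ / 2) * (u * N ^ 2)) * (1 + 1 / √u) ^ d) := htail N u hN0.le hu
      _ ≤ C₃ * ((C₄ * ((1 + u * N ^ 2) ^ (J + P))⁻¹) * (2 * N) ^ d) := by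
        gcongr
        exact hexp _ hx0.le
      _ = C₃ * (C₄ * ((2 * N) ^ d * ((1 + u * N ^ 2) ^ P)⁻¹) * ((1 + u * N ^ 2) ^ J)⁻¹) := by
        rw [pow_add]
        field_simp
      _ ≤ C₃ * (C₄ * ((2 * N) ^ d * (N ^ 2)⁻¹) * ((1 + u * N ^ 2) ^ J)⁻¹) := by gcongr
      _ = C₃ * (C₄ * (2 ^ d * (N ^ (d - 2) * 1)) * ((1 + u * N ^ 2) ^ J)⁻¹) := by
        rw [hdN, mul_one]
      _ ≤ C₃ * (C₄ * (2 ^ d * (N ^ (d - 2) * N ^ (3 * η))) * ((1 + u * N ^ 2) ^ J)⁻¹) := by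
        gcongr
        exact one_le_rpow hN1 (by positivity)
      _ = _ := by ring

end Combined

/-! ### Mellin integrals of power decay. -/

section MellinDecay

theorem integrableOn_rpow_mul_inv_one_add_pow {σ : ℝ} (hσ : 0 < σ) {J : ℕ} (hJ : σ < J) :
    IntegrableOn (fun u : ℝ => u ^ (σ - 1) * ((1 + u) ^ J)⁻¹) (Set.Ioi 0) := by
  have hm : ∀ S ⊆ Set.Ioi (0 : ℝ), MeasurableSet S → AEStronglyMeasurable
      (fun u : ℝ => u ^ (σ - 1) * ((1 + u) ^ J)⁻¹) (volume.restrict S) := fun S hS hSm => by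
    refine ContinuousOn.aestronglyMeasurable (fun u hu => ?_) hSm
    have hu0 : (0 : ℝ) < u := hS hu
    refine (ContinuousAt.mul (continuousAt_rpow_const _ _ (Or.inl hu0.ne')) ?_).continuousWithinAt
    exact ContinuousAt.inv₀ (by fun_prop) (by positivity)
  rw [← Set.Ioc_union_Ioi_eq_Ioi zero_le_one]
  refine IntegrableOn.union ?_ ?_
  · have h : IntegrableOn (fun u : ℝ => u ^ (σ - 1)) (Set.Ioc 0 1) :=
      (intervalIntegrable_iff_integrableOn_Ioc_of_le zero_le_one).1
        (intervalIntegral.intervalIntegrable_rpow' (by linarith))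
    refine h.mono' (hm _ (fun u hu => hu.1) measurableSet_Ioc)
      ((ae_restrict_iff' measurableSet_Ioc).2 (Eventually.of_forall fun u hu => ?_))
    have hu0 : 0 < u := hu.1
    rw [norm_of_nonneg (by positivity)]
    exact mul_le_of_le_one_right (by positivity) (inv_le_one_of_one_le₀ (one_le_pow₀ (by linarith)))
  · have h : IntegrableOn (fun u : ℝ => u ^ (σ - 1 - J)) (Set.Ioi 1) :=
      integrableOn_Ioi_rpow_of_lt (by linarith) one_pos
    refine h.mono' (hm _ (fun u (hu : 1 < u) => zero_lt_one.trans hu) measurableSet_Ioi)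
      ((ae_restrict_iff' measurableSet_Ioi).2 (Eventually.of_forall fun u hu => ?_))
    have hu0 : 0 < u := zero_lt_one.trans hu
    rw [norm_of_nonneg (by positivity), rpow_sub hu0 (σ - 1), rpow_natCast, div_eq_mul_inv]
    gcongr
    linarith

theorem integrableOn_rpow_mul_inv_one_add_mul_pow {σ : ℝ} (hσ : 0 < σ) {J : ℕ} (hJ : σ < J)
    {a : ℝ} (ha : 0 < a) :
    IntegrableOn (fun u : ℝ => u ^ (σ - 1) * ((1 + u * a) ^ J)⁻¹) (Set.Ioi 0) := by
  have h := (integrableOn_Ioi_comp_mul_right_iff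
    (fun u : ℝ => u ^ (σ - 1) * ((1 + u) ^ J)⁻¹) 0 ha).2
    (by rw [zero_mul]; exact integrableOn_rpow_mul_inv_one_add_pow hσ hJ)
  refine IntegrableOn.congr_fun (h.const_mul ((a ^ (σ - 1))⁻¹)) (fun u hu => ?_) measurableSet_Ioi
  have : a ^ (σ - 1) ≠ 0 := (rpow_pos_of_pos ha _).ne'
  simp only [mul_rpow (le_of_lt hu) ha.le]
  field_simp

theorem integral_rpow_mul_inv_one_add_mul_pow (σ : ℝ) (J : ℕ) {a : ℝ} (ha : 0 < a) :
    ∫ u in Set.Ioi (0 : ℝ), u ^ (σ - 1) * ((1 + u * a) ^ J)⁻¹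
      = a ^ (-σ) * ∫ u in Set.Ioi (0 : ℝ), u ^ (σ - 1) * ((1 + u) ^ J)⁻¹ := by
  have h := integral_comp_mul_right_Ioi (fun u : ℝ => u ^ (σ - 1) * ((1 + u) ^ J)⁻¹) 0 ha
  rw [zero_mul, smul_eq_mul] at h
  have e : a ^ (-σ) = (a ^ (σ - 1))⁻¹ * a⁻¹ := by
    rw [← rpow_neg ha.le, ← rpow_neg_one a, ← rpow_add ha]
    congr 1
    ring
  rw [e, mul_assoc, ← h, ← integral_const_mul]
  refine setIntegral_congr_fun measurableSet_Ioi fun u hu => ?_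
  have : a ^ (σ - 1) ≠ 0 := (rpow_pos_of_pos ha _).ne'
  simp only [mul_rpow (le_of_lt hu) ha.le]
  field_simp

end MellinDecay

/-! ### Rules for Mellin transforms. -/

section HasMellin

theorem HasMellin.add {f g : ℝ → ℂ} {s a b : ℂ} (hf : HasMellin f s a) (hg : HasMellin g s b) :
    HasMellin (fun u => f u + g u) s (a + b) := by
  rw [← hf.2, ← hg.2]
  exact hasMellin_add hf.1 hg.1

theorem HasMellin.sub {f g : ℝ → ℂ} {s a b : ℂ} (hf : HasMellin f s a) (hg : HasMellin g s b) :
    HasMellin (fun u => f u - g u) s (a - b) := by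
  rw [← hf.2, ← hg.2]
  exact hasMellin_sub hf.1 hg.1

theorem HasMellin.sum {ι : Type*} (F : Finset ι) {f : ι → ℝ → ℂ} {s : ℂ} {a : ι → ℂ}
    (h : ∀ i ∈ F, HasMellin (f i) s (a i)) :
    HasMellin (fun u => ∑ i ∈ F, f i u) s (∑ i ∈ F, a i) := by
  classical
  induction F using Finset.induction_on with
  | empty => simp [HasMellin, MellinConvergent, mellin]
  | insert i F hi ih =>
    simp_rw [Finset.sum_insert hi]
    exact HasMellin.add (h i (Finset.mem_insert_self _ _))
      (ih fun j hj => h j (Finset.mem_insert_of_mem hj))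

theorem HasMellin.congr {f g : ℝ → ℂ} {s a : ℂ} (hf : HasMellin f s a)
    (h : ∀ u : ℝ, 0 < u → f u = g u) : HasMellin g s a := by
  have e : Set.EqOn (fun t : ℝ => (t : ℂ) ^ (s - 1) • f t) (fun t : ℝ => (t : ℂ) ^ (s - 1) • g t)
    (Set.Ioi 0) := fun t ht => by simp only [h t ht]
  refine ⟨IntegrableOn.congr_fun hf.1 e measurableSet_Ioi, ?_⟩
  rw [← hf.2]
  exact (setIntegral_congr_fun measurableSet_Ioi e).symm

theorem HasMellin.norm_le {f : ℝ → ℝ} {s a : ℂ} (hf : HasMellin (fun u => (f u : ℂ)) s a)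
    {g : ℝ → ℝ} (hg : IntegrableOn (fun u => u ^ (s.re - 1) * g u) (Set.Ioi 0))
    (h : ∀ u : ℝ, 0 < u → |f u| ≤ g u) :
    ‖a‖ ≤ ∫ u in Set.Ioi (0 : ℝ), u ^ (s.re - 1) * g u := by
  rw [← hf.2]
  refine norm_integral_le_of_norm_le hg
    ((ae_restrict_iff' measurableSet_Ioi).2 (Eventually.of_forall fun u (hu : 0 < u) => ?_))
  rw [norm_smul, Complex.norm_cpow_eq_rpow_re_of_pos hu, Complex.sub_re, Complex.one_re,
    Complex.norm_real]
  exact mul_le_mul_of_nonneg_left (h u hu) (by positivity)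

theorem one_div_ofReal_cpow {q : ℝ} (hq : 0 ≤ q) (s : ℂ) : (1 / (q : ℂ)) ^ s = 1 / (q : ℂ) ^ s := by
  rw [one_div, one_div, Complex.inv_cpow]
  rw [Complex.arg_ofReal_of_nonneg hq]
  exact pi_pos.ne

theorem integrableOn_rpow_mul_exp_neg_mul {σ : ℝ} (hσ : 0 < σ) {q : ℝ} (hq : 0 < q) :
    IntegrableOn (fun u : ℝ => u ^ (σ - 1) * exp (-(u * q))) (Set.Ioi 0) := by
  have := integrableOn_rpow_mul_exp_neg_mul_rpow (by linarith : -1 < σ - 1) one_pos hq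
  simp_rw [rpow_one] at this
  refine this.congr_fun (fun u _ => ?_) measurableSet_Ioi
  simp only
  congr 2
  ring

theorem hasMellin_exp_neg_mul {s : ℂ} (hs : 0 < s.re) {q : ℝ} (hq : 0 < q) :
    HasMellin (fun u => ((exp (-(u * q)) : ℝ) : ℂ)) s (Complex.Gamma s * (1 / (q : ℂ) ^ s)) := by
  constructor
  · rw [MellinConvergent, mellin_convergent_iff_norm subset_rfl measurableSet_Ioi
      (Continuous.aestronglyMeasurable (by fun_prop))]
    simp_rw [Complex.norm_real, norm_of_nonneg (exp_pos _).le]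
    exact integrableOn_rpow_mul_exp_neg_mul hs hq
  · rw [← one_div_ofReal_cpow hq.le, mul_comm, ← Complex.integral_cpow_mul_exp_neg_mul_Ioi hs hq,
      mellin]
    refine setIntegral_congr_fun measurableSet_Ioi fun u _ => ?_
    simp only [smul_eq_mul]
    push_cast
    rw [mul_comm (u : ℂ) q]

end HasMellin

/-! ### Mellin transforms of the truncated integral and sum. -/

section BallIntegral

variable {d : ℕ} {Q : QuadraticForm ℝ (EuclideanSpace ℝ (Fin d))}

theorem quadraticForm_pos (hQ : Q.PosDef) {x : EuclideanSpace ℝ (Fin d)} (hx : x ≠ 0) : 0 < Q x :=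
  hQ x hx

theorem quadraticForm_nonneg (hQ : Q.PosDef) (x : EuclideanSpace ℝ (Fin d)) : 0 ≤ Q x :=
  hQ.nonneg x

/-- The integral of a Gaussian over a ball. -/
def ballIntegral (Q : QuadraticForm ℝ (EuclideanSpace ℝ (Fin d))) (N u : ℝ) : ℝ :=
  ∫ x in Metric.closedBall (0 : EuclideanSpace ℝ (Fin d)) N, exp (-(u * Q x))

/-- At `u → 0` the ball integral is bounded by the volume, which requires `σ > 0`; at infinity it is
at most the full Gaussian integral, of order `u^(-d/2)`, which requires `σ < d/2`. -/
theorem integrableOn_rpow_mul_ballIntegral (hQ : Q.PosDef) (N : ℝ) {σ : ℝ} (hσ : 0 < σ)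
    (hσd : σ < (d : ℝ) / 2) :
    IntegrableOn (fun u : ℝ => u ^ (σ - 1) * ballIntegral Q N u) (Set.Ioi 0) := by
  have hQc : Continuous fun x => Q x := continuous_quadraticForm Q
  obtain ⟨κ, hκ, hk⟩ := exists_le_quadraticForm hQ
  set B := Metric.closedBall (0 : EuclideanSpace ℝ (Fin d)) N
  have hG0 : ∀ u, 0 ≤ ballIntegral Q N u := fun u => integral_nonneg fun _ => (exp_pos _).le
  have hGm : StronglyMeasurable fun u => ballIntegral Q N u :=
    StronglyMeasurable.integral_prod_left' (μ := volume.restrict B)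
      (f := fun p : EuclideanSpace ℝ (Fin d) × ℝ => exp (-(p.2 * Q p.1)))
      (Continuous.stronglyMeasurable (by fun_prop))
  have hm : ∀ S : Set ℝ, AEStronglyMeasurable (fun u : ℝ => u ^ (σ - 1) * ballIntegral Q N u)
      (volume.restrict S) := fun S =>
    ((measurable_id.pow_const _).aestronglyMeasurable).mul hGm.aestronglyMeasurable
  rw [← Set.Ioc_union_Ioi_eq_Ioi zero_le_one]
  refine IntegrableOn.union ?_ ?_
  · have h : IntegrableOn (fun u : ℝ => u ^ (σ - 1)) (Set.Ioc 0 1) :=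
      (intervalIntegrable_iff_integrableOn_Ioc_of_le zero_le_one).1
        (intervalIntegral.intervalIntegrable_rpow' (by linarith))
    refine (h.mul_const (volume.real B)).mono' (hm _)
      ((ae_restrict_iff' measurableSet_Ioc).2 (Eventually.of_forall fun u hu => ?_))
    have hu0 : 0 < u := hu.1
    rw [norm_of_nonneg (mul_nonneg (by positivity) (hG0 u))]
    gcongr
    have : ∫ _ in B, (1 : ℝ) = volume.real B := by simp
    rw [← this]
    refine setIntegral_mono (integrable_exp_neg_form hκ hk hu0).integrableOn ?_ fun x => ?_
    · exact integrableOn_const (isCompact_closedBall _ _).measure_lt_top.ne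
    · exact exp_le_one_iff.2 (by have := quadraticForm_nonneg hQ x; simp; positivity)
  · have h : IntegrableOn (fun u : ℝ => u ^ (σ - 1 - (d : ℝ) / 2)) (Set.Ioi 1) :=
      integrableOn_Ioi_rpow_of_lt (by linarith) one_pos
    refine (h.mul_const (gaussIntegral Q 1)).mono' (hm _)
      ((ae_restrict_iff' measurableSet_Ioi).2 (Eventually.of_forall fun u hu => ?_))
    have hu0 : 0 < u := zero_lt_one.trans hu
    rw [norm_of_nonneg (mul_nonneg (by positivity) (hG0 u)), sub_eq_add_neg (σ - 1), rpow_add hu0,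
      mul_assoc]
    gcongr
    rw [mul_comm, ← gaussIntegral_eq hu0]
    exact setIntegral_le_integral (integrable_exp_neg_form hκ hk hu0)
      (Eventually.of_forall fun x => (exp_pos _).le)

theorem integrable_prod_cpow_mul_exp_neg (hQ : Q.PosDef) (N : ℝ) {s : ℂ} (hs : 0 < s.re)
    (hsd : s.re < (d : ℝ) / 2) :
    Integrable (Function.uncurry fun (x : EuclideanSpace ℝ (Fin d)) (u : ℝ) =>
      (u : ℂ) ^ (s - 1) * ((exp (-(u * Q x)) : ℝ) : ℂ))
      ((volume.restrict (Metric.closedBall 0 N)).prod (volume.restrict (Set.Ioi 0))) := by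
  have hQc : Continuous fun x => Q x := continuous_quadraticForm Q
  obtain ⟨κ, hκ, hk⟩ := exists_le_quadraticForm hQ
  have hmeas : Measurable (Function.uncurry fun (x : EuclideanSpace ℝ (Fin d)) (u : ℝ) =>
      (u : ℂ) ^ (s - 1) * ((exp (-(u * Q x)) : ℝ) : ℂ)) := by
    refine Measurable.mul ?_ (Continuous.measurable (by fun_prop))
    exact (Complex.measurable_ofReal.comp measurable_snd).pow_const _
  refine (integrable_prod_iff' hmeas.aestronglyMeasurable).2 ⟨?_, ?_⟩
  · refine (ae_restrict_iff' measurableSet_Ioi).2 (Eventually.of_forall fun u hu => ?_)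
    have h : Integrable (fun x => ((exp (-(u * Q x)) : ℝ) : ℂ))
        (volume.restrict (Metric.closedBall 0 N)) :=
      Integrable.ofReal (integrable_exp_neg_form hκ hk hu).integrableOn
    exact h.const_mul ((u : ℂ) ^ (s - 1))
  · refine IntegrableOn.congr_fun (integrableOn_rpow_mul_ballIntegral hQ N hs hsd)
      (fun u (hu : 0 < u) => ?_) measurableSet_Ioi
    simp only [Function.uncurry_apply_pair, norm_mul, Complex.norm_real,
      norm_of_nonneg (exp_pos _).le]
    rw [integral_const_mul, Complex.norm_cpow_eq_rpow_re_of_pos hu, Complex.sub_re, Complex.one_re]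
    rfl

/-- Fubini applied to `u^(s-1) exp(-u Q(x))`: integrating first over `u` gives `Γ(s) Q(x)^(-s)`, so
integrability over the ball and the Mellin transform come out together. -/
theorem integrableOn_and_hasMellin_ballIntegral (hQ : Q.PosDef) (N : ℝ) {s : ℂ} (hs : 0 < s.re)
    (hsd : s.re < (d : ℝ) / 2) :
    IntegrableOn (fun x : EuclideanSpace ℝ (Fin d) => 1 / (Q x : ℂ) ^ s) (Metric.closedBall 0 N) ∧
      HasMellin (fun u => (ballIntegral Q N u : ℂ)) s (Complex.Gamma s * betaHat Q N s) := by
  have hprod := integrable_prod_cpow_mul_exp_neg hQ N hs hsd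
  have hd0 : 0 < d := by
    rcases Nat.eq_zero_or_pos d with rfl | h
    · norm_num at hsd
      linarith
    · exact h
  have : Nonempty (Fin d) := ⟨⟨0, hd0⟩⟩
  set B := Metric.closedBall (0 : EuclideanSpace ℝ (Fin d)) N
  have hΓ : Complex.Gamma s ≠ 0 := Complex.Gamma_ne_zero_of_re_pos hs
  have hae : ∀ᵐ x ∂(volume.restrict B), (∫ u in Set.Ioi (0 : ℝ),
      (u : ℂ) ^ (s - 1) * ((exp (-(u * Q x)) : ℝ) : ℂ)) = Complex.Gamma s * (1 / (Q x : ℂ) ^ s) := by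
    -- The Gamma integral fails only at the origin, a null set since `d > 0`.
    filter_upwards [ae_restrict_of_ae (Measure.ae_ne volume 0)] with x hx
    exact (hasMellin_exp_neg_mul hs (quadraticForm_pos hQ hx)).2
  refine ⟨?_, ?_, ?_⟩
  · have h := (hprod.integral_prod_left.congr hae).const_mul (Complex.Gamma s)⁻¹
    simp_rw [inv_mul_cancel_left₀ hΓ] at h
    exact h
  · have h := hprod.integral_prod_right
    refine Integrable.congr h (Eventually.of_forall fun u => ?_)
    simp only [Function.uncurry_apply_pair, smul_eq_mul]
    rw [integral_const_mul, integral_complex_ofReal]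
    rfl
  · rw [betaHat, ← integral_const_mul, ← integral_congr_ae hae, integral_integral_swap hprod, mellin]
    refine setIntegral_congr_fun measurableSet_Ioi fun u _ => ?_
    simp only [smul_eq_mul]
    rw [integral_const_mul, integral_complex_ofReal]
    rfl

/-- The `1` removes the term `n = 0`, which the discrepancy includes and whose Mellin integral
diverges. -/
theorem hasMellin_discrepancy_sub_one (hQ : Q.PosDef) (N : ℝ) {s : ℂ} (hs : 0 < s.re)
    (hsd : s.re < (d : ℝ) / 2) :
    HasMellin (fun u => ((discrepancy Q N u - 1 : ℝ) : ℂ)) s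
      (Complex.Gamma s * (alphaHat Q N s - betaHat Q N s)) := by
  have h0 : ∀ n ∈ latticeBall d N, latticePoint n ≠ 0 := fun n hn h => by
    rw [latticePoint_eq_zero] at h
    exact zero_notMem_latticeBall N (h ▸ hn)
  have h := HasMellin.sub (HasMellin.sum (latticeBall d N) fun n hn =>
      hasMellin_exp_neg_mul hs (quadraticForm_pos hQ (h0 n hn)))
    (integrableOn_and_hasMellin_ballIntegral hQ N hs hsd).2
  rw [← Finset.mul_sum, ← mul_sub] at h
  refine HasMellin.congr h fun u _ => ?_
  rw [discrepancy, Finset.sum_insert (zero_notMem_latticeBall N), latticePoint_zero, map_zero, mul_zero,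
    neg_zero, exp_zero, ballIntegral]
  push_cast
  ring

end BallIntegral

section Lattice

theorem summable_norm_latticePoint_rpow (d : ℕ) {r : ℝ} (hr : r < -d) :
    Summable fun n : Fin d → ℤ => ‖latticePoint n‖ ^ r := by
  obtain ⟨b, hb⟩ : ∃ b : Module.Basis (Fin d) ℝ (EuclideanSpace ℝ (Fin d)),
      ∀ x i, b.repr x i = x i := ⟨(EuclideanSpace.basisFun (Fin d) ℝ).toBasis, fun _ _ => by simp⟩
  have hmem : ∀ n : Fin d → ℤ, latticePoint n ∈ Submodule.span ℤ (Set.range b) := fun n => by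
    rw [Module.Basis.mem_span_iff_repr_mem]
    exact fun i => ⟨n i, by rw [hb]; rfl⟩
  have h := ZLattice.summable_norm_rpow (Submodule.span ℤ (Set.range b)) r (by
    rw [ZLattice.rank ℝ, finrank_euclideanSpace, Fintype.card_fin]
    exact hr)
  have hinj : Function.Injective fun n : Fin d → ℤ =>
      (⟨latticePoint n, hmem n⟩ : Submodule.span ℤ (Set.range b)) := fun n m hnm => by
    have h1 : latticePoint n = latticePoint m := congrArg Subtype.val hnm
    ext i
    have h2 := congrArg (fun x : EuclideanSpace ℝ (Fin d) => x i) h1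
    simpa only [latticePoint_apply, Int.cast_inj] using h2
  have h2 := h.comp_injective hinj
  simp only [Function.comp_def, Submodule.coe_norm] at h2
  exact h2

end Lattice

/-! ### Meromorphic continuation of the Epstein zeta function. -/

section Continuation

variable {d : ℕ} {Q : QuadraticForm ℝ (EuclideanSpace ℝ (Fin d))}

theorem continuousOn_thetaSeries (hQ : Q.PosDef) : ContinuousOn (thetaSeries Q) (Set.Ioi 0) := by
  obtain ⟨κ, hκ, hk⟩ := exists_le_quadraticForm hQ
  intro u hu
  have hu : 0 < u := hu
  have h : ContinuousOn (thetaSeries Q) (Set.Ici (u / 2)) := by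
    refine continuousOn_tsum (fun n => by fun_prop)
      (summable_exp_neg_form hκ hk (by positivity : 0 < u / 2)) fun n v hv => ?_
    rw [norm_of_nonneg (exp_pos _).le]
    have := quadraticForm_nonneg hQ (latticePoint n)
    have hv : u / 2 ≤ v := hv
    gcongr
  exact (h.continuousAt (Ici_mem_nhds (by linarith))).continuousWithinAt

theorem continuousOn_gaussIntegral : ContinuousOn (gaussIntegral Q) (Set.Ioi 0) := by
  refine ContinuousOn.congr (f := fun u => gaussIntegral Q 1 * u ^ (-((d : ℝ) / 2))) ?_
    fun u hu => gaussIntegral_eq hu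
  exact continuousOn_const.mul fun u hu =>
    (continuousAt_rpow_const _ _ (Or.inl (ne_of_gt hu))).continuousWithinAt

/-- The part of the theta integrand beyond `1`. -/
def thetaUpper (Q : QuadraticForm ℝ (EuclideanSpace ℝ (Fin d))) (u : ℝ) : ℂ :=
  (Set.Ioi 1).indicator (fun u => ((thetaSeries Q u - 1 : ℝ) : ℂ)) u

/-- The regularised part of the theta integrand below `1`. -/
def thetaLower (Q : QuadraticForm ℝ (EuclideanSpace ℝ (Fin d))) (u : ℝ) : ℂ :=
  (Set.Ioc 0 1).indicator (fun u => ((thetaSeries Q u - gaussIntegral Q u : ℝ) : ℂ)) u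

theorem locallyIntegrableOn_indicator {f : ℝ → ℂ} {S : Set ℝ} (hS : MeasurableSet S)
    (hf : ContinuousOn f (Set.Ioi 0)) : LocallyIntegrableOn (S.indicator f) (Set.Ioi 0) := by
  intro x hx
  obtain ⟨U, hU, h⟩ := hf.locallyIntegrableOn (μ := volume) measurableSet_Ioi x hx
  exact ⟨U, hU, h.indicator hS⟩

theorem locallyIntegrableOn_thetaUpper (hQ : Q.PosDef) :
    LocallyIntegrableOn (thetaUpper Q) (Set.Ioi 0) :=
  locallyIntegrableOn_indicator measurableSet_Ioi
    (Complex.continuous_ofReal.comp_continuousOn ((continuousOn_thetaSeries hQ).sub continuousOn_const))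

theorem locallyIntegrableOn_thetaLower (hQ : Q.PosDef) :
    LocallyIntegrableOn (thetaLower Q) (Set.Ioi 0) :=
  locallyIntegrableOn_indicator measurableSet_Ioc
    (Complex.continuous_ofReal.comp_continuousOn
      ((continuousOn_thetaSeries hQ).sub continuousOn_gaussIntegral))

theorem exists_thetaUpper_isBigO (hQ : Q.PosDef) : ∃ a : ℝ, 0 < a ∧
    thetaUpper Q =O[atTop] fun u => exp (-a * u) := by
  obtain ⟨κ, hκ, hk⟩ := exists_le_quadraticForm hQ
  obtain ⟨C, -, hC⟩ := exists_abs_thetaSeries_sub_one_le hκ hk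
  refine ⟨κ / 2, by positivity, Asymptotics.IsBigO.of_bound C ?_⟩
  filter_upwards [eventually_gt_atTop 1] with u hu
  rw [thetaUpper, Set.indicator_of_mem (Set.mem_Ioi.2 hu), Complex.norm_real, norm_of_nonneg (exp_pos _).le]
  exact hC u (le_of_lt hu)

theorem thetaUpper_isBigO_zero (b : ℝ) : thetaUpper Q =O[𝓝[>] 0] fun u => u ^ (-b) := by
  refine Asymptotics.IsBigO.of_bound 1 ?_
  filter_upwards [Ioo_mem_nhdsGT (zero_lt_one' ℝ)] with u hu
  rw [thetaUpper, Set.indicator_of_notMem (by simpa using hu.2.le), norm_zero]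
  positivity

theorem thetaLower_isBigO_atTop : thetaLower Q =O[atTop] fun u => exp (-1 * u) := by
  refine Asymptotics.IsBigO.of_bound 1 ?_
  filter_upwards [eventually_gt_atTop 1] with u hu
  rw [thetaLower, Set.indicator_of_notMem (by simp [hu]), norm_zero]
  positivity

theorem thetaLower_isBigO_zero (hQ : Q.PosDef) (K : ℕ) :
    thetaLower Q =O[𝓝[>] 0] fun u => u ^ (-(-(K : ℝ))) := by
  obtain ⟨C, -, hC⟩ := exists_abs_thetaSeries_sub_gaussIntegral_le hQ K
  refine Asymptotics.IsBigO.of_bound C ?_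
  filter_upwards [Ioo_mem_nhdsGT (zero_lt_one' ℝ)] with u hu
  rw [thetaLower, Set.indicator_of_mem (Set.mem_Ioc.2 ⟨hu.1, hu.2.le⟩), Complex.norm_real, neg_neg, rpow_natCast,
    norm_of_nonneg (pow_nonneg hu.1.le K)]
  exact hC u hu.1 hu.2.le

theorem hasMellin_thetaUpper (hQ : Q.PosDef) (s : ℂ) :
    HasMellin (thetaUpper Q) s (mellin (thetaUpper Q) s) := by
  obtain ⟨a, ha, h⟩ := exists_thetaUpper_isBigO hQ
  exact ⟨mellinConvergent_of_isBigO_rpow_exp ha (locallyIntegrableOn_thetaUpper hQ) h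
    (thetaUpper_isBigO_zero (s.re - 1)) (by linarith), rfl⟩

theorem hasMellin_thetaLower (hQ : Q.PosDef) (s : ℂ) :
    HasMellin (thetaLower Q) s (mellin (thetaLower Q) s) := by
  obtain ⟨K, hK⟩ := exists_nat_gt (-s.re)
  exact ⟨mellinConvergent_of_isBigO_rpow_exp one_pos (locallyIntegrableOn_thetaLower hQ)
    thetaLower_isBigO_atTop (thetaLower_isBigO_zero hQ K) (by linarith), rfl⟩

theorem differentiable_mellin_thetaUpper (hQ : Q.PosDef) :
    Differentiable ℂ (mellin (thetaUpper Q)) := fun s => by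
  obtain ⟨a, ha, h⟩ := exists_thetaUpper_isBigO hQ
  exact mellin_differentiableAt_of_isBigO_rpow_exp ha (locallyIntegrableOn_thetaUpper hQ) h
    (thetaUpper_isBigO_zero (s.re - 1)) (by linarith)

theorem differentiable_mellin_thetaLower (hQ : Q.PosDef) :
    Differentiable ℂ (mellin (thetaLower Q)) := fun s => by
  obtain ⟨K, hK⟩ := exists_nat_gt (-s.re)
  exact mellin_differentiableAt_of_isBigO_rpow_exp one_pos (locallyIntegrableOn_thetaLower hQ)
    thetaLower_isBigO_atTop (thetaLower_isBigO_zero hQ K) (by linarith)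

/-- The completed Epstein zeta function, in its symmetric decomposition. -/
def completedZeta (Q : QuadraticForm ℝ (EuclideanSpace ℝ (Fin d))) (s : ℂ) : ℂ :=
  mellin (thetaUpper Q) s + mellin (thetaLower Q) s + gaussIntegral Q 1 / (s - (d : ℂ) / 2)

/-- The Epstein zeta function. -/
def epsteinZeta (Q : QuadraticForm ℝ (EuclideanSpace ℝ (Fin d))) (s : ℂ) : ℂ :=
  (Complex.Gamma s)⁻¹ * completedZeta Q s - (Complex.Gamma (s + 1))⁻¹

/-- The term `1/s` appears in `epsteinZeta` as `1/Γ(s+1)`, which is entire, so the origin needs no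
separate treatment. -/
theorem Gamma_mul_epsteinZeta {s : ℂ} (hs : 0 < s.re) :
    Complex.Gamma s * epsteinZeta Q s = completedZeta Q s - 1 / s := by
  have h0 : s ≠ 0 := fun h => by simp [h] at hs
  have hΓ : Complex.Gamma s ≠ 0 := Complex.Gamma_ne_zero_of_re_pos hs
  rw [epsteinZeta, Complex.Gamma_add_one s h0]
  field_simp

theorem hasMellin_const_mul {f : ℝ → ℂ} {s a : ℂ} (hf : HasMellin f s a) (c : ℂ) :
    HasMellin (fun u => c * f u) s (c * a) := by
  rw [← hf.2]
  exact hasMellin_const_smul hf.1 c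

theorem hasMellin_cpow_Ioi {a s : ℂ} (h : s.re + a.re < 0) :
    HasMellin ((Set.Ioi 1).indicator fun u : ℝ => (u : ℂ) ^ a) s (-(1 / (s + a))) := by
  have e : ∀ u ∈ Set.Ioi (1 : ℝ), (u : ℂ) ^ (s - 1) • (u : ℂ) ^ a = (u : ℂ) ^ (s + a - 1) :=
    fun u hu => by
      have hu0 : (u : ℂ) ≠ 0 := by
        have : (0 : ℝ) < u := zero_lt_one.trans hu
        exact_mod_cast this.ne'
      rw [smul_eq_mul, ← Complex.cpow_add _ _ hu0]
      congr 1
      ring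
  have hre : (s + a - 1).re < -1 := by
    rw [Complex.sub_re, Complex.add_re, Complex.one_re]
    linarith
  have hsub : Set.Ioi (1 : ℝ) ⊆ Set.Ioi 0 := Set.Ioi_subset_Ioi zero_le_one
  have hi : (fun u : ℝ => (u : ℂ) ^ (s - 1) • (Set.Ioi 1).indicator (fun u : ℝ => (u : ℂ) ^ a) u)
      = (Set.Ioi 1).indicator fun u : ℝ => (u : ℂ) ^ (s - 1) • (u : ℂ) ^ a := by
    ext u
    by_cases hu : u ∈ Set.Ioi (1 : ℝ)
    · simp only [Set.indicator_of_mem hu]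
    · simp only [Set.indicator_of_notMem hu, smul_zero]
  constructor
  · rw [MellinConvergent, hi, integrableOn_indicator_iff measurableSet_Ioi,
      Set.inter_eq_left.2 hsub]
    exact (integrableOn_Ioi_cpow_of_lt hre one_pos).congr_fun (fun u hu => (e u hu).symm)
      measurableSet_Ioi
  · rw [mellin, hi, setIntegral_indicator measurableSet_Ioi, Set.inter_eq_right.2 hsub,
      setIntegral_congr_fun measurableSet_Ioi e, integral_Ioi_cpow_of_lt hre one_pos]
    rw [Complex.ofReal_one, Complex.one_cpow, sub_add_cancel, neg_div]

theorem gaussIntegral_eq_cpow {u : ℝ} (hu : 0 < u) :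
    (gaussIntegral Q u : ℂ) = gaussIntegral Q 1 * (u : ℂ) ^ (-((d : ℂ) / 2)) := by
  rw [gaussIntegral_eq hu]
  push_cast [Complex.ofReal_cpow hu.le]
  rfl

/-- To the left of `d/2` the term `G(1)/(s - d/2)` is the Mellin transform of `-G` on `(1, ∞)`, and
`-1/s` is that of `-1` on `(0, 1]`. With the two regularised halves these assemble to `θ - G - 1`.
-/
theorem hasMellin_theta_sub_gaussIntegral (hQ : Q.PosDef) {s : ℂ} (hs : 0 < s.re)
    (hsd : s.re < (d : ℝ) / 2) :
    HasMellin (fun u => ((thetaSeries Q u - gaussIntegral Q u - 1 : ℝ) : ℂ)) s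
      (Complex.Gamma s * epsteinZeta Q s) := by
  have h := HasMellin.sub (HasMellin.sub (HasMellin.add (hasMellin_thetaUpper hQ s)
    (hasMellin_thetaLower hQ s)) (hasMellin_const_mul (hasMellin_cpow_Ioi (a := -((d : ℂ) / 2))
      (s := s) (by simpa using hsd)) (gaussIntegral Q 1))) (hasMellin_one_Ioc hs)
  rw [Gamma_mul_epsteinZeta hs, completedZeta]
  refine HasMellin.congr (a := _) (by
    convert h using 1
    ring) fun u hu => ?_
  rw [thetaUpper, thetaLower]
  rcases le_or_gt u 1 with h1 | h1
  · have m1 : u ∉ Set.Ioi (1 : ℝ) := by simpa using h1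
    have m2 : u ∈ Set.Ioc (0 : ℝ) 1 := ⟨hu, h1⟩
    simp only [Set.indicator_of_notMem m1, Set.indicator_of_mem m2]
    push_cast
    ring
  · have m1 : u ∈ Set.Ioi (1 : ℝ) := h1
    have m2 : u ∉ Set.Ioc (0 : ℝ) 1 := fun h => absurd h.2 (not_le.2 h1)
    simp only [Set.indicator_of_notMem m2, Set.indicator_of_mem m1]
    push_cast
    rw [gaussIntegral_eq_cpow hu]
    ring

/-- To the right of `d/2` the same term `G(1)/(s - d/2)` is instead the transform of `+G` on `(0,
1]`, so the same function represents `θ - 1`. -/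
theorem hasMellin_theta_sub_one (hQ : Q.PosDef) {s : ℂ} (hs : (d : ℝ) / 2 < s.re) :
    HasMellin (fun u => ((thetaSeries Q u - 1 : ℝ) : ℂ)) s
      (Complex.Gamma s * epsteinZeta Q s) := by
  have hs0 : 0 < s.re := lt_of_le_of_lt (by positivity) hs
  have h := HasMellin.sub (HasMellin.add (HasMellin.add (hasMellin_thetaUpper hQ s)
    (hasMellin_thetaLower hQ s)) (hasMellin_const_mul (hasMellin_cpow_Ioc (-((d : ℂ) / 2))
      (s := s) (by simpa using hs)) (gaussIntegral Q 1))) (hasMellin_one_Ioc hs0)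
  rw [Gamma_mul_epsteinZeta hs0, completedZeta]
  refine HasMellin.congr (a := _) (by
    convert h using 1
    ring) fun u hu => ?_
  rw [thetaUpper, thetaLower]
  rcases le_or_gt u 1 with h1 | h1
  · have m1 : u ∉ Set.Ioi (1 : ℝ) := by simpa using h1
    have m2 : u ∈ Set.Ioc (0 : ℝ) 1 := ⟨hu, h1⟩
    simp only [Set.indicator_of_notMem m1, Set.indicator_of_mem m2]
    push_cast
    rw [gaussIntegral_eq_cpow hu]
    ring
  · have m1 : u ∈ Set.Ioi (1 : ℝ) := h1
    have m2 : u ∉ Set.Ioc (0 : ℝ) 1 := fun h => absurd h.2 (not_le.2 h1)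
    simp only [Set.indicator_of_notMem m2, Set.indicator_of_mem m1]
    push_cast
    ring

theorem hasSum_exp_neg_form (hQ : Q.PosDef) {u : ℝ} (hu : 0 < u) :
    HasSum (fun n : {n : Fin d → ℤ // n ≠ 0} => exp (-(u * Q (latticePoint n.1))))
      (thetaSeries Q u - 1) := by
  obtain ⟨κ, hκ, hk⟩ := exists_le_quadraticForm hQ
  rw [thetaSeries_sub_one_eq hκ hk hu]
  exact hasSum_subtype_iff_indicator.2 ((summable_exp_neg_form hκ hk hu).indicator _).hasSum

theorem summable_inv_quadraticForm_rpow (hQ : Q.PosDef) {σ : ℝ} (hσ : (d : ℝ) / 2 < σ) :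
    Summable fun n : {n : Fin d → ℤ // n ≠ 0} => 1 / Q (latticePoint n.1) ^ σ := by
  obtain ⟨κ, hκ, hk⟩ := exists_le_quadraticForm hQ
  have hσ0 : 0 < σ := lt_of_le_of_lt (by positivity) hσ
  have h := ((summable_norm_latticePoint_rpow d (r := -(2 * σ)) (by linarith)).comp_injective
    (Subtype.val_injective (p := fun n : Fin d → ℤ => n ≠ 0))).mul_left (κ ^ (-σ))
  refine h.of_nonneg_of_le (fun n => ?_) fun n => ?_
  · have := quadraticForm_nonneg hQ (latticePoint n.1)
    positivity
  · have hn : 0 < ‖latticePoint n.1‖ := norm_pos_iff.2 fun h => n.2 (latticePoint_eq_zero.1 h)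
    have e : κ ^ (-σ) * ‖latticePoint n.1‖ ^ (-(2 * σ)) = 1 / (κ * ‖latticePoint n.1‖ ^ 2) ^ σ := by
      rw [mul_rpow hκ.le (by positivity), ← rpow_natCast, ← rpow_mul hn.le, rpow_neg hκ.le,
        rpow_neg hn.le]
      push_cast
      field_simp
    rw [Function.comp_apply, e]
    have := hk (latticePoint n.1)
    gcongr

/-- Termwise Mellin transform of `θ - 1`, divided by `Γ(s)`. -/
theorem hasSum_epsteinZeta (hQ : Q.PosDef) {s : ℂ} (hs : (d : ℝ) / 2 < s.re) :
    HasSum (fun n : {n : Fin d → ℤ // n ≠ 0} => 1 / (Q (latticePoint n.1) : ℂ) ^ s)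
      (epsteinZeta Q s) := by
  have hs0 : 0 < s.re := lt_of_le_of_lt (by positivity) hs
  have hΓ : Complex.Gamma s ≠ 0 := Complex.Gamma_ne_zero_of_re_pos hs0
  have h := hasSum_mellin (a := fun _ : {n : Fin d → ℤ // n ≠ 0} => 1)
    (p := fun n => Q (latticePoint n.1)) (F := fun u => ((thetaSeries Q u - 1 : ℝ) : ℂ))
    (fun n => Or.inr (quadraticForm_pos hQ fun h => n.2 (latticePoint_eq_zero.1 h))) hs0
    (fun u hu => by
      have := Complex.hasSum_ofReal.2 (hasSum_exp_neg_form hQ hu)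
      refine this.congr_fun fun n => ?_
      rw [one_mul]
      congr 2
      ring)
    (by simpa using summable_inv_quadraticForm_rpow hQ hs)
  rw [(hasMellin_theta_sub_one hQ hs).2] at h
  have h2 := h.mul_left (Complex.Gamma s)⁻¹
  rw [inv_mul_cancel_left₀ hΓ] at h2
  refine h2.congr_fun fun n => ?_
  rw [mul_div_assoc, inv_mul_cancel_left₀ hΓ]

theorem isEpsteinContinuation_epsteinZeta (hQ : Q.PosDef) :
    IsEpsteinContinuation Q (epsteinZeta Q) := by
  have hU := differentiable_mellin_thetaUpper hQ
  have hL := differentiable_mellin_thetaLower hQ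
  have hG := Complex.differentiable_one_div_Gamma
  have hG1 : Differentiable ℂ fun s : ℂ => (Complex.Gamma (s + 1))⁻¹ :=
    hG.comp (differentiable_id.add_const 1)
  refine ⟨fun s hs => ?_, ?_, fun s hs => hasSum_epsteinZeta hQ hs⟩
  · have hs : s - (d : ℂ) / 2 ≠ 0 := sub_ne_zero.2 hs
    have hq : DifferentiableAt ℂ (fun s : ℂ => (gaussIntegral Q 1 : ℂ) / (s - (d : ℂ) / 2)) s :=
      (differentiableAt_const _).div (by fun_prop) hs
    exact (((hG s).mul (((hU s).add (hL s)).add hq)).sub (hG1 s)).differentiableWithinAt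
  · have hq : MeromorphicAt (fun s : ℂ => (gaussIntegral Q 1 : ℂ) / (s - (d : ℂ) / 2))
        ((d : ℂ) / 2) :=
      (MeromorphicAt.const _ _).div ((MeromorphicAt.id _).sub (MeromorphicAt.const _ _))
    exact ((hG.analyticAt _).meromorphicAt.mul (((hU.analyticAt _).meromorphicAt.add
      (hL.analyticAt _).meromorphicAt).add hq)).sub (hG1.analyticAt _).meromorphicAt

/-- Identity theorem on the connected punctured plane: near `d/2 + 1` both functions are the sum of
the same series. -/
theorem IsEpsteinContinuation.eqOn {Z W : ℂ → ℂ} (hZ : IsEpsteinContinuation Q Z)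
    (hW : IsEpsteinContinuation Q W) : Set.EqOn Z W {(d : ℂ) / 2}ᶜ := by
  have hopen : IsOpen ({(d : ℂ) / 2}ᶜ : Set ℂ) := isOpen_compl_singleton
  have hre : ((d : ℂ) / 2).re = (d : ℝ) / 2 := by
    rw [show ((d : ℂ) / 2) = (((d : ℝ) / 2 : ℝ) : ℂ) by push_cast; rfl, Complex.ofReal_re]
  refine (hZ.differentiableOn.analyticOnNhd hopen).eqOn_of_preconnected_of_eventuallyEq
    (hW.differentiableOn.analyticOnNhd hopen) ?_ (z₀ := (d : ℂ) / 2 + 1) (by simp) ?_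
  · exact (isConnected_compl_singleton_of_one_lt_rank (by simp) _).isPreconnected
  · have h : {s : ℂ | (d : ℝ) / 2 < s.re} ∈ 𝓝 ((d : ℂ) / 2 + 1) :=
      (isOpen_lt continuous_const Complex.continuous_re).mem_nhds (by
        change (d : ℝ) / 2 < ((d : ℂ) / 2 + 1).re
        rw [Complex.add_re, hre, Complex.one_re]
        linarith)
    filter_upwards [h] with s hs
    exact (hZ.hasSum s hs).unique (hW.hasSum s hs)

end Continuation

/-! ### The limit. -/

section Limit

variable {d : ℕ} {Q : QuadraticForm ℝ (EuclideanSpace ℝ (Fin d))}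

theorem tendsto_alphaHat_sub_betaHat (hd : 4 ≤ d) (hQ : Q.PosDef) {s : ℂ}
    (hs : (d : ℝ) / 2 - 1 < s.re) (hsd : s.re < (d : ℝ) / 2) :
    Tendsto (fun N : ℝ => alphaHat Q N s - betaHat Q N s) atTop (𝓝 (epsteinZeta Q s)) := by
  have hd4 : (4 : ℝ) ≤ d := by exact_mod_cast hd
  have hs0 : 0 < s.re := by linarith
  have hΓ : Complex.Gamma s ≠ 0 := Complex.Gamma_ne_zero_of_re_pos hs0
  -- Twice the distance of `Re s` from `d/2 - 1`. The Mellin integral is of order `N^(3η-δ)`, and `η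
  -- ≤ δ/6` leaves `N^(-δ/2)`.
  set δ : ℝ := 2 * s.re - (d - 2) with hδ
  have hδ0 : 0 < δ := by linarith
  obtain ⟨J, hJ⟩ := exists_nat_gt s.re
  set η : ℝ := min 1 (δ / 6) with hη
  have hη0 : 0 < η := lt_min one_pos (by positivity)
  have hηδ : η ≤ δ / 6 := min_le_right _ _
  obtain ⟨C, hC, hbound⟩ := exists_abs_discrepancy_sub_theta_le hd hQ J hη0 (min_le_left _ _)
  set I : ℝ := ∫ u in Set.Ioi (0 : ℝ), u ^ (s.re - 1) * ((1 + u) ^ J)⁻¹ with hI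
  have hI0 : 0 ≤ I := setIntegral_nonneg measurableSet_Ioi fun u (hu : 0 < u) => by positivity
  have key : ∀ N : ℝ, 2 ≤ N → ‖Complex.Gamma s * (alphaHat Q N s - betaHat Q N s - epsteinZeta Q s)‖
      ≤ C * I * N ^ (-(δ / 2)) := fun N hN => by
    have hN0 : 0 < N := by linarith
    -- The constants `1` cancel in the difference of the two Mellin representations, leaving the
    -- quantity bounded uniformly in `u`.
    have hm : HasMellin
        (fun u => ((discrepancy Q N u - (thetaSeries Q u - gaussIntegral Q u) : ℝ) : ℂ)) s
        (Complex.Gamma s * (alphaHat Q N s - betaHat Q N s - epsteinZeta Q s)) := by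
      rw [mul_sub]
      refine HasMellin.congr (HasMellin.sub (hasMellin_discrepancy_sub_one hQ N hs0 hsd)
        (hasMellin_theta_sub_gaussIntegral hQ hs0 hsd)) fun u _ => ?_
      push_cast
      ring
    set A : ℝ := C * (N ^ (d - 2) * N ^ (3 * η)) with hA
    have hint := (integrableOn_rpow_mul_inv_one_add_mul_pow hs0 hJ
      (by positivity : 0 < N ^ 2)).const_mul A
    have e : ∀ u : ℝ, A * (u ^ (s.re - 1) * ((1 + u * N ^ 2) ^ J)⁻¹)
        = u ^ (s.re - 1) * (C * (N ^ (d - 2) * N ^ (3 * η) * ((1 + u * N ^ 2) ^ J)⁻¹)) :=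
      fun u => by rw [hA]; ring
    refine (HasMellin.norm_le hm (g := fun u =>
      C * (N ^ (d - 2) * N ^ (3 * η) * ((1 + u * N ^ 2) ^ J)⁻¹)) ?_ fun u hu =>
        hbound N u hN hu).trans ?_
    · simp_rw [← e]
      exact hint
    · simp_rw [← e]
      rw [integral_const_mul, integral_rpow_mul_inv_one_add_mul_pow _ _ (by positivity), ← hI]
      have e2 : N ^ (d - 2) * N ^ (3 * η) * (N ^ 2) ^ (-s.re) = N ^ (3 * η - δ) := by
        rw [← rpow_natCast N (d - 2), ← rpow_natCast N 2, ← rpow_mul hN0.le, ← rpow_add hN0,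
          ← rpow_add hN0, hδ]
        congr 1
        rw [Nat.cast_sub (by omega)]
        push_cast
        ring
      calc A * ((N ^ 2) ^ (-s.re) * I)
          = C * I * (N ^ (d - 2) * N ^ (3 * η) * (N ^ 2) ^ (-s.re)) := by rw [hA]; ring
        _ ≤ C * I * N ^ (-(δ / 2)) := by
          rw [e2]
          gcongr
          · linarith
          · linarith
  rw [tendsto_iff_norm_sub_tendsto_zero]
  have hlim : Tendsto (fun N : ℝ => ‖Complex.Gamma s‖⁻¹ * (C * I * N ^ (-(δ / 2)))) atTop (𝓝 0) := by
    have h := ((tendsto_rpow_neg_atTop (by positivity : 0 < δ / 2)).const_mul (C * I)).const_mul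
      ‖Complex.Gamma s‖⁻¹
    simpa using h
  refine squeeze_zero' (Eventually.of_forall fun _ => norm_nonneg _) ?_ hlim
  filter_upwards [eventually_ge_atTop 2] with N hN
  rw [le_inv_mul_iff₀ (norm_pos_iff.2 hΓ), ← norm_mul]
  exact key N hN

end Limit

end EpsteinWigner
end

theorem corollary5p2 (d : ℕ) (hd : 4 ≤ d)
    (Q : QuadraticForm ℝ (EuclideanSpace ℝ (Fin d))) (hQ : Q.PosDef) :
    (∃ Z : ℂ → ℂ, EpsteinWigner.IsEpsteinContinuation Q Z) ∧
    ∀ Z : ℂ → ℂ, EpsteinWigner.IsEpsteinContinuation Q Z →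
      ∀ s : ℂ, (d : ℝ) / 2 - 1 < s.re → s.re < (d : ℝ) / 2 →
        (∀ N : ℝ, IntegrableOn (fun x : EuclideanSpace ℝ (Fin d) => 1 / (Q x : ℂ) ^ s)
          (Metric.closedBall 0 N)) ∧
        Tendsto (fun N : ℝ => EpsteinWigner.alphaHat Q N s - EpsteinWigner.betaHat Q N s)
          atTop (𝓝 (Z s)) := by
  have hcont := EpsteinWigner.isEpsteinContinuation_epsteinZeta hQ
  refine ⟨⟨_, hcont⟩, fun Z hZ s hs hsd => ⟨fun N => ?_, ?_⟩⟩
  · have hd4 : (4 : ℝ) ≤ d := by exact_mod_cast hd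
    exact (EpsteinWigner.integrableOn_and_hasMellin_ballIntegral hQ N (by linarith) hsd).1
  · have hne : s ∈ ({(d : ℂ) / 2}ᶜ : Set ℂ) := fun h => by
      have hre : s.re = (d : ℝ) / 2 := by
        rw [Set.mem_singleton_iff.1 h, show ((d : ℂ) / 2) = (((d : ℝ) / 2 : ℝ) : ℂ) by
          push_cast; rfl, Complex.ofReal_re]
      linarith
    rw [EpsteinWigner.IsEpsteinContinuation.eqOn hZ hcont hne]
    exact EpsteinWigner.tendsto_alphaHat_sub_betaHat hd hQ hs hsd
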